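/- **Theorem 6.9 (type $C_n$).** Let $n\ge 2$, let $\mathbb K$ be an algebraically closed field containing $\mathbb C$, let $r,s\in\mathbb K$ be algebraically independent over $\mathbb C$, and fix square roots $r^{1/2},s^{1/2}\in\mathbb K$; put $(rs)^{1/2}=r^{1/2}s^{1/2}$. *The algebras.* Let $\varepsilon_1,\dots,\varepsilon_n$ be an orthonormal basis, $\alpha_i=\varepsilon_i-\varepsilon_{i+1}$ $(1\le i<n)$, $\alpha_n=2\varepsilon_n$, $\theta=2\varepsilon_1=2\alpha_1+\dots+2\alpha_{n-1}+\alpha_n$, and let the node $0$ correspond to $-\theta$. For $0\le i,j\le n$ let $d_i=\tfrac12(\alpha_i,\alpha_i)$, $r_i=r^{d_i}$, $s_i=s^{d_i}$, $c_{ij}=2(\alpha_i,\alpha_j)/(\alpha_i,\alpha_i)$ (with $-\theta$ in place of $\alpha_0$). Let $\langle\cdot,\cdot\rangle$ be the bilinear form on the root lattice with $\langle\alpha_i,\alpha_j\rangle=d_ic_{ij}$ for $i<j$, $d_i$ for $i=j$, $0$ for $i>j$ $(1\le i,j\le n)$, and put $\Omega_{ij}=r^{\langle\alpha_i,\alpha_j\rangle}s^{-\langle\alpha_j,\alpha_i\rangle}$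 for $0\le i,j\le n$ (again with $-\theta$ in place of $\alpha_0$). $U=U_{r,s}(\widehat{\mathfrak{sp}}_{2n})$ is the associative unital $\mathbb K$-algebra generated by $e_i,f_i,\omega_i^{\pm1},(\omega_i')^{\pm1}$ $(0\le i\le n)$, $\gamma^{\pm1},(\gamma')^{\pm1},D^{\pm1},(D')^{\pm1}$, where $x^{-1}$ is inverse to $x$, with relations: $\gamma=\omega_0\omega_\theta$ and $\gamma'=\omega_0'\omega_\theta'$ are central, where $\omega_\theta=\omega_1^2\cdots\omega_{n-1}^2\omega_n$ and likewise for $\omega'_\theta$; all $\omega_i,\omega_j'$ commute with each other and with $D,D'$; $DD'=D'D$; $$De_iD^{-1}=r_i^{\delta_{0i}}e_i,\quad Df_iD^{-1}=r_i^{-\delta_{0i}}f_i,\quad D'e_i(D')^{-1}=s_i^{\delta_{0i}}e_i,\quad D'f_i(D')^{-1}=s_i^{-\delta_{0i}}f_i;$$ $$\omega_ie_j=\Omega_{ji}e_j\omega_i,\quad \omega_if_j=\Omega_{ji}^{-1}f_j\omega_i,\quad \omega_i'e_j=\Omega_{ij}^{-1}e_j\omega_i',\quad \omega_i'f_j=\Omega_{ij}f_j\omega_i',\quad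 e_if_j-f_je_i=\delta_{ij}\frac{\omega_i-\omega_i'}{r_i-s_i};$$ and, for $i\ne j$, with $m=1-c_{ij}$ and $\lambda_k=(-1)^k\binom{m}{k}_{r_i,s_i}(r_is_i)^{k(k-1)/2}\,\Omega_{ji}^k\,s_i^{kc_{ij}}$, $$\sum_{k=0}^{m}\lambda_k\,e_i^{m-k}e_je_i^k=0,\qquad \sum_{k=0}^{m}\lambda_k\,f_i^{k}f_jf_i^{m-k}=0 .$$ Here $\binom{m}{k}_{r,s}=\frac{[m]!}{[k]!\,[m-k]!}$ with $[k]=\frac{r^k-s^k}{r-s}$ and $[k]!=[1][2]\cdots[k]$. The algebra $U'=U'_{r,s}(\widehat{\mathfrak{sp}}_{2n})$ has the same presentation without the generators $D^{\pm1},(D')^{\pm1}$ and the relations that contain them. Both have the coproduct $\Delta(e_i)=e_i\otimes1+\omega_i\otimes e_i$, $\Delta(f_i)=1\otimes f_i+f_i\otimes\omega_i'$, with all other generators group-like, and tensor products of modules are formed through $\Delta$. *The modules.* Let $V=\mathbb K^{2n}$ with matrix units $E_{ij}$ and $i'=2n+1-i$. Let $a,b\in\mathbb K^\times$ and $c=rs\,ab$.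 For $1\le i<n$ put $$e_i\mapsto E_{i,i+1}-E_{(i+1)',i'},\qquad f_i\mapsto E_{i+1,i}-(rs)^{-1}E_{i',(i+1)'},$$ $$\omega_i\mapsto rE_{ii}+sE_{i+1,i+1}+r^{-1}E_{i'i'}+s^{-1}E_{(i+1)',(i+1)'}+\sum_{j\le n,\ j\ne i,i+1}(E_{jj}+E_{j'j'});$$ further $$e_n\mapsto E_{nn'},\quad f_n\mapsto(rs)^{-1}E_{n'n},\quad \omega_n\mapsto rs^{-1}E_{nn}+r^{-1}sE_{n'n'}+\sum_{j<n}(r^{-1}s^{-1}E_{jj}+rsE_{j'j'}),$$ $$e_0\mapsto au\,E_{1'1},\quad f_0\mapsto bu^{-1}E_{11'},\quad \omega_0\mapsto c\Big(r^{-1}sE_{11}+rs^{-1}E_{1'1'}+\sum_{i=2}^n(r^{-1}s^{-1}E_{ii}+rsE_{i'i'})\Big),$$ and $\gamma,\gamma'\mapsto c\,\mathrm{Id}$; the image of $\omega_i'$ is obtained from that of $\omega_i$ by interchanging $r$ and $s$ (with $c$ unchanged). For $u\in\mathbb K^\times$ this defines a representation $\rho_u^{a,b}$ of $U'$ on $V(u)=V$.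 For an indeterminate $u$, together with $D(v\,u^k)=r_0^k\,v\,u^k$ and $D'(v\,u^k)=s_0^k\,v\,u^k$, it defines a representation $\rho_u^{a,b}$ of $U$ on $V(u)=V\otimes\mathbb K[u,u^{-1}]$. *The operator.* Let $\xi=r^{-n-1}s^{n+1}$; for $1\le i\le 2n$ let $\sigma_i=1,\ t_i=s^{i-n-1}$ if $i\le n$ and $\sigma_i=-1,\ t_i=-r^{n-i}$ if $i>n$. Let $$\hat R(z)=(z-r^{-1}s)(z-\xi)\sum_{i}E_{ii}\otimes E_{ii}+\sum_{j\ne i,i'}a_{ij}(z)E_{ij}\otimes E_{ji}+(1-r^{-1}s)(z-\xi)\sum_{i>j,\ j\ne i'}E_{ii}\otimes E_{jj}$$ $$\qquad+(1-r^{-1}s)\,z(z-\xi)\sum_{i<j,\ j\ne i'}E_{ii}\otimes E_{jj}+\sum_{i,j}b_{ij}(z)E_{i'j}\otimes E_{ij'},$$ with all sums over $1\le i,j\le2n$, where $$a_{ij}(z)=r^{-1/2}s^{1/2}(z-1)(z-\xi)\cdot\begin{cases}(rs)^{-\frac12\sigma_i\sigma_j}& i<j,j'\ \text{ or }\ i>j,j',\\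 (rs)^{\frac12\sigma_i\sigma_j}& j<i<j'\ \text{ or }\ j'<i<j,\end{cases}$$ $$b_{ij}(z)=\begin{cases}(r^{-1}sz-\xi)(z-1)& j=i,\\ (r^{-1}s-1)\big(\xi t_it_j^{-1}(z-1)-\delta_{ij'}(z-\xi)\big)& i<j,\\ (r^{-1}s-1)z\big(t_it_j^{-1}(z-1)-\delta_{ij'}(z-\xi)\big)& i>j.\end{cases}$$ **(a)** If $ab=(rs)^{-1}$, then $$\hat R(u/v)\circ(\rho_u^{a,b}\otimes\rho_v^{a,b})(x)=(\rho_v^{a,b}\otimes\rho_u^{a,b})(x)\circ\hat R(u/v)$$ as maps $V(u)\otimes V(v)\to V(v)\otimes V(u)$, for all $x\in U$ when $u,v$ are indeterminates, and for all $x\in U'$ when $u,v\in\mathbb K^\times$. **(b)** Let $\tau(x\otimes y)=y\otimes x$ and $R(z)=\hat R(z)\circ\tau$. On $V\otimes V\otimes V$ write $F_{12}=F\otimes\mathrm{Id}$, $F_{23}=\mathrm{Id}\otimes F$, $F_{13}=(\mathrm{Id}\otimes\tau)F_{12}(\mathrm{Id}\otimes\tau)$. For all $u,v,w\in\mathbb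 K^\times$, $$R_{12}(v/w)R_{13}(u/w)R_{23}(u/v)=R_{23}(u/v)R_{13}(u/w)R_{12}(v/w),$$ $$\hat R_{12}(v/w)\hat R_{23}(u/w)\hat R_{12}(u/v)=\hat R_{23}(u/v)\hat R_{12}(u/w)\hat R_{23}(v/w).$$ -/

import Mathlib

set_option linter.unusedTactic false
set_option linter.unreachableTactic false
set_option linter.unnecessarySeqFocus false
set_option linter.unusedSimpArgs false
set_option linter.unusedVariables false

open scoped TensorProduct

namespace TwoParamC

/-! ## Root data of type `C_n` and of its affinization

Nodes of the affine diagram are `0, 1, …, n`, i.e. elements of `Fin (n + 1)`.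
The basis vector `ε_{k+1}` of `ℝ^n` corresponds to `k : Fin n`. -/

/-- The finite part of the affine simple roots, in the orthonormal basis `ε_1, …, ε_n`:
`α_i = ε_i - ε_{i+1}` for `1 ≤ i < n`, `α_n = 2 ε_n`, and `-θ = -2 ε_1` at the node `0`. -/
def root {n : ℕ} (i : Fin (n + 1)) : Fin n → ℤ := fun k =>
  if (i : ℕ) = 0 then (if (k : ℕ) = 0 then -2 else 0)
  else if (i : ℕ) = n then (if (k : ℕ) + 1 = n then 2 else 0)
  else if (k : ℕ) + 1 = i then 1
  else if (k : ℕ) = i then -1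
  else 0

/-- The form `(·,·)` in which `ε_1, …, ε_n` is orthonormal. -/
def form {n : ℕ} (x y : Fin n → ℤ) : ℤ := ∑ k, x k * y k

/-- `d_i = (α_i, α_i) / 2`. -/
def d {n : ℕ} (i : Fin (n + 1)) : ℤ := form (root i) (root i) / 2

/-- The extended Cartan matrix `c_{ij} = 2 (α_i, α_j) / (α_i, α_i)`. -/
def cartan {n : ℕ} (i j : Fin (n + 1)) : ℤ :=
  2 * form (root i) (root j) / form (root i) (root i)

/-- The coefficients of the highest root `θ = 2 α_1 + … + 2 α_{n-1} + α_n`;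
`i : Fin n` stands for `α_{i+1}`. -/
def theta {n : ℕ} (i : Fin n) : ℕ := if (i : ℕ) + 1 = n then 1 else 2

/-- Coordinates in the basis `α_1, …, α_n` of the root lattice of `-θ` (node `0`) and of
`α_i` (node `i`). -/
def coords {n : ℕ} (i : Fin (n + 1)) : Fin n → ℤ :=
  Fin.cases (fun k => -(theta k : ℤ)) (fun j => Pi.single j 1) i

/-- The Ringel form on simple roots; `i : Fin n` stands for `α_{i+1}`. -/
def ringelSimple {n : ℕ} (i j : Fin n) : ℤ :=
  if i < j then d i.succ * cartan i.succ j.succ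
  else if i = j then d i.succ
  else 0

/-- The Ringel form `⟨·,·⟩`, extended bilinearly to the root lattice (in coordinates with respect
to the simple roots). -/
def ringel {n : ℕ} (x y : Fin n → ℤ) : ℤ := ∑ i, ∑ j, x i * y j * ringelSimple i j

section Scalars

variable {K : Type*} [Field K]

/-- The structure constants `Ω_{ij} = (ω'_i, ω_j)`, where
`(ω'_λ, ω_μ) = r^⟨λ,μ⟩ s^{-⟨μ,λ⟩}` and the node `0` corresponds to `-θ`. -/
def Om (r s : K) {n : ℕ} (i j : Fin (n + 1)) : K :=
  r ^ ringel (coords i) (coords j) * s ^ (-ringel (coords j) (coords i))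

/-- `[m]_{r,s}`. -/
def qInt (r s : K) (m : ℕ) : K := (r ^ m - s ^ m) / (r - s)

/-- `[m]_{r,s}!`. -/
def qFact (r s : K) (m : ℕ) : K := ∏ k ∈ Finset.range m, qInt r s (k + 1)

/-- The Gaussian binomial coefficient. -/
def qBinom (r s : K) (m k : ℕ) : K := qFact r s m / (qFact r s (m - k) * qFact r s k)

/-- The coefficient of the `k`-th summand of the Serre relation for `i ≠ j`:
`(-1)^k [1 - c_{ij} choose k]_{r_i,s_i} (r_i s_i)^{k(k-1)/2} Ω_{ji}^k s_i^{k c_{ij}}`. -/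
def serreCoeff (r s : K) {n : ℕ} (i j : Fin (n + 1)) (k : ℕ) : K :=
  (-1) ^ k * qBinom (r ^ d i) (s ^ d i) (1 - cartan i j).toNat k *
    (r ^ d i * s ^ d i) ^ (k * (k - 1) / 2) * Om r s j i ^ k * (s ^ d i) ^ ((k : ℤ) * cartan i j)

end Scalars

/-! ## The two-parameter quantum affine algebras of type `C_n^{(1)}` -/

/-- Generators of the algebra without degree generators:
`e_i, f_i, ω_i^{±1}, (ω'_i)^{±1}` for `0 ≤ i ≤ n`, and `γ^{±1}, (γ')^{±1}`. -/
inductive Gen (n : ℕ) : Type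
  | e (i : Fin (n + 1))
  | f (i : Fin (n + 1))
  | ω (i : Fin (n + 1))
  | ωinv (i : Fin (n + 1))
  | ω' (i : Fin (n + 1))
  | ω'inv (i : Fin (n + 1))
  | γ
  | γinv
  | γ'
  | γ'inv

/-- Generators of the algebra with the degree generators `D^{±1}, (D')^{±1}`. -/
inductive GenD (n : ℕ) : Type
  | base (g : Gen n)
  | D
  | Dinv
  | D'
  | D'inv

section Relations

variable {K : Type*} [Field K] (r s : K) {n : ℕ} {A : Type*} [Ring A] [Algebra K A]

/-- The product `y_1^{θ_1} ⋯ y_n^{θ_n}` for a family `y_0, …, y_n`; for `y = ω` this is `ω_θ`. -/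
def thetaProd (y : Fin (n + 1) → A) : A :=
  (List.ofFn fun i : Fin n => y i.succ ^ theta i).prod

/-- Left-hand side of the Serre relation for the `e_i`. -/
def serreE (x : Fin (n + 1) → A) (i j : Fin (n + 1)) : A :=
  ∑ k ∈ Finset.range ((1 - cartan i j).toNat + 1),
    serreCoeff r s i j k • (x i ^ ((1 - cartan i j).toNat - k) * x j * x i ^ k)

/-- Left-hand side of the Serre relation for the `f_i`. -/
def serreF (x : Fin (n + 1) → A) (i j : Fin (n + 1)) : A :=
  ∑ k ∈ Finset.range ((1 - cartan i j).toNat + 1),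
    serreCoeff r s i j k • (x i ^ k * x j * x i ^ ((1 - cartan i j).toNat - k))

/-- The defining relations of the algebra without degree generators, for a family `x` of elements
of an algebra indexed by the generators: `Rel r s x p q` means that `p = q` is one of them. -/
inductive Rel (x : Gen n → A) : A → A → Prop
  | ω_ω (i j) : Rel x (x (.ω i) * x (.ω j)) (x (.ω j) * x (.ω i))
  | ω_ω' (i j) : Rel x (x (.ω i) * x (.ω' j)) (x (.ω' j) * x (.ω i))
  | ω'_ω' (i j) : Rel x (x (.ω' i) * x (.ω' j)) (x (.ω' j) * x (.ω' i))
  | ω_inv (i) : Rel x (x (.ω i) * x (.ωinv i)) 1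
  | inv_ω (i) : Rel x (x (.ωinv i) * x (.ω i)) 1
  | ω'_inv (i) : Rel x (x (.ω' i) * x (.ω'inv i)) 1
  | inv_ω' (i) : Rel x (x (.ω'inv i) * x (.ω' i)) 1
  | γ_inv : Rel x (x .γ * x .γinv) 1
  | inv_γ : Rel x (x .γinv * x .γ) 1
  | γ'_inv : Rel x (x .γ' * x .γ'inv) 1
  | inv_γ' : Rel x (x .γ'inv * x .γ') 1
  | γ_eq : Rel x (x .γ) (x (.ω 0) * thetaProd fun i => x (.ω i))
  | γ'_eq : Rel x (x .γ') (x (.ω' 0) * thetaProd fun i => x (.ω' i))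
  | γ_central (g) : Rel x (x .γ * x g) (x g * x .γ)
  | γ'_central (g) : Rel x (x .γ' * x g) (x g * x .γ')
  | ω_e (i j) : Rel x (x (.ω i) * x (.e j)) (Om r s j i • (x (.e j) * x (.ω i)))
  | ω_f (i j) : Rel x (x (.ω i) * x (.f j)) ((Om r s j i)⁻¹ • (x (.f j) * x (.ω i)))
  | ω'_e (i j) : Rel x (x (.ω' i) * x (.e j)) ((Om r s i j)⁻¹ • (x (.e j) * x (.ω' i)))
  | ω'_f (i j) : Rel x (x (.ω' i) * x (.f j)) (Om r s i j • (x (.f j) * x (.ω' i)))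
  | e_f (i) : Rel x (x (.e i) * x (.f i) - x (.f i) * x (.e i))
      ((r ^ d i - s ^ d i)⁻¹ • (x (.ω i) - x (.ω' i)))
  | e_f_ne (i j) (h : i ≠ j) : Rel x (x (.e i) * x (.f j) - x (.f j) * x (.e i)) 0
  | serre_e (i j) (h : i ≠ j) : Rel x (serreE r s (fun k => x (.e k)) i j) 0
  | serre_f (i j) (h : i ≠ j) : Rel x (serreF r s (fun k => x (.f k)) i j) 0

/-- The defining relations of the algebra with degree generators. -/
inductive RelD (x : GenD n → A) : A → A → Prop
  | base {p q : A} (h : Rel r s (fun g => x (.base g)) p q) : RelD x p q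
  | D_inv : RelD x (x .D * x .Dinv) 1
  | inv_D : RelD x (x .Dinv * x .D) 1
  | D'_inv : RelD x (x .D' * x .D'inv) 1
  | inv_D' : RelD x (x .D'inv * x .D') 1
  | D_D' : RelD x (x .D * x .D') (x .D' * x .D)
  | D_ω (i) : RelD x (x .D * x (.base (.ω i))) (x (.base (.ω i)) * x .D)
  | D_ω' (i) : RelD x (x .D * x (.base (.ω' i))) (x (.base (.ω' i)) * x .D)
  | D'_ω (i) : RelD x (x .D' * x (.base (.ω i))) (x (.base (.ω i)) * x .D')
  | D'_ω' (i) : RelD x (x .D' * x (.base (.ω' i))) (x (.base (.ω' i)) * x .D')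
  | D_e (i) : RelD x (x .D * x (.base (.e i)) * x .Dinv)
      ((if i = 0 then r ^ d i else 1) • x (.base (.e i)))
  | D_f (i) : RelD x (x .D * x (.base (.f i)) * x .Dinv)
      ((if i = 0 then (r ^ d i)⁻¹ else 1) • x (.base (.f i)))
  | D'_e (i) : RelD x (x .D' * x (.base (.e i)) * x .D'inv)
      ((if i = 0 then s ^ d i else 1) • x (.base (.e i)))
  | D'_f (i) : RelD x (x .D' * x (.base (.f i)) * x .D'inv)
      ((if i = 0 then (s ^ d i)⁻¹ else 1) • x (.base (.f i)))
  | γ_central (g) : RelD x (x (.base .γ) * x g) (x g * x (.base .γ))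
  | γ'_central (g) : RelD x (x (.base .γ') * x g) (x g * x (.base .γ'))

end Relations

section Algebras

variable {K : Type*} [Field K] (r s : K) (n : ℕ)

/-- The algebra `U'_{r,s}(ŝp_{2n})` (without degree generators). -/
abbrev UAff' := RingQuot (Rel r s (n := n) (FreeAlgebra.ι K (X := Gen n)))

/-- The two-parameter quantum affine algebra `U_{r,s}(ŝp_{2n})`. -/
abbrev UAff := RingQuot (RelD r s (n := n) (FreeAlgebra.ι K (X := GenD n)))

/-- The generators of `U'_{r,s}(ŝp_{2n})`. -/
def UAff'.gen (g : Gen n) : UAff' r s n :=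
  RingQuot.mkAlgHom K (Rel r s (FreeAlgebra.ι K)) (FreeAlgebra.ι K g)

/-- The generators of `U_{r,s}(ŝp_{2n})`. -/
def UAff.gen (g : GenD n) : UAff r s n :=
  RingQuot.mkAlgHom K (RelD r s (FreeAlgebra.ι K)) (FreeAlgebra.ι K g)

end Algebras

section Lift

variable {K : Type*} [Field K] {r s : K} {n : ℕ} {A B : Type*} [Ring A] [Algebra K A]
  [Ring B] [Algebra K B]

theorem map_thetaProd (φ : A →ₐ[K] B) (y : Fin (n + 1) → A) :
    φ (thetaProd y) = thetaProd fun i => φ (y i) := by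
  simp [thetaProd, map_list_prod, List.map_ofFn, Function.comp_def]

theorem map_serreE (φ : A →ₐ[K] B) (x : Fin (n + 1) → A) (i j : Fin (n + 1)) :
    φ (serreE r s x i j) = serreE r s (fun k => φ (x k)) i j := by
  simp [serreE, map_sum]

theorem map_serreF (φ : A →ₐ[K] B) (x : Fin (n + 1) → A) (i j : Fin (n + 1)) :
    φ (serreF r s x i j) = serreF r s (fun k => φ (x k)) i j := by
  simp [serreF, map_sum]

theorem Rel.map (φ : A →ₐ[K] B) {x : Gen n → A} {p q : A} (h : Rel r s x p q) :
    Rel r s (fun g => φ (x g)) (φ p) (φ q) := by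
  cases h <;>
  simp only [map_mul, map_one, map_zero, map_sub, map_smul, map_thetaProd, map_serreE,
    map_serreF] <;> constructor <;> assumption

theorem RelD.map (φ : A →ₐ[K] B) {x : GenD n → A} {p q : A} (h : RelD r s x p q) :
    RelD r s (fun g => φ (x g)) (φ p) (φ q) := by
  cases h with
  | base h => exact .base (h.map φ)
  | _ =>
    simp only [map_mul, map_one, map_smul]
    first
      | exact .D_inv | exact .inv_D | exact .D'_inv | exact .inv_D' | exact .D_D'
      | exact .D_ω _ | exact .D_ω' _ | exact .D'_ω _ | exact .D'_ω' _
      | exact .D_e _ | exact .D_f _ | exact .D'_e _ | exact .D'_f _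
      | exact .γ_central _ | exact .γ'_central _

/-- A family of elements satisfying the relations defines a homomorphism from `U'`. -/
def UAff'.lift (x : Gen n → A) (hx : ∀ p q, Rel r s x p q → p = q) : UAff' r s n →ₐ[K] A :=
  RingQuot.liftAlgHom K ⟨FreeAlgebra.lift K x, fun _ _ h => hx _ _ (by
    simpa using h.map (FreeAlgebra.lift K x))⟩

/-- A family of elements satisfying the relations defines a homomorphism from `U`. -/
def UAff.lift (x : GenD n → A) (hx : ∀ p q, RelD r s x p q → p = q) : UAff r s n →ₐ[K] A :=
  RingQuot.liftAlgHom K ⟨FreeAlgebra.lift K x, fun _ _ h => hx _ _ (by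
    simpa using h.map (FreeAlgebra.lift K x))⟩

theorem Rel.exists_of_map (φ : A →ₐ[K] B) {x : Gen n → A} {p q : B}
    (h : Rel r s (fun g => φ (x g)) p q) : ∃ p₀ q₀, Rel r s x p₀ q₀ ∧ φ p₀ = p ∧ φ q₀ = q := by
  cases h
  case ω_ω i j => exact ⟨_, _, .ω_ω i j, by simp, by simp⟩
  case ω_ω' i j => exact ⟨_, _, .ω_ω' i j, by simp, by simp⟩
  case ω'_ω' i j => exact ⟨_, _, .ω'_ω' i j, by simp, by simp⟩
  case ω_inv i => exact ⟨_, _, .ω_inv i, by simp, by simp⟩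
  case inv_ω i => exact ⟨_, _, .inv_ω i, by simp, by simp⟩
  case ω'_inv i => exact ⟨_, _, .ω'_inv i, by simp, by simp⟩
  case inv_ω' i => exact ⟨_, _, .inv_ω' i, by simp, by simp⟩
  case γ_inv => exact ⟨_, _, .γ_inv, by simp, by simp⟩
  case inv_γ => exact ⟨_, _, .inv_γ, by simp, by simp⟩
  case γ'_inv => exact ⟨_, _, .γ'_inv, by simp, by simp⟩
  case inv_γ' => exact ⟨_, _, .inv_γ', by simp, by simp⟩
  case γ_eq => exact ⟨_, _, .γ_eq, by simp, by simp [map_thetaProd]⟩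
  case γ'_eq => exact ⟨_, _, .γ'_eq, by simp, by simp [map_thetaProd]⟩
  case γ_central g => exact ⟨_, _, .γ_central g, by simp, by simp⟩
  case γ'_central g => exact ⟨_, _, .γ'_central g, by simp, by simp⟩
  case ω_e i j => exact ⟨_, _, .ω_e i j, by simp, by simp⟩
  case ω_f i j => exact ⟨_, _, .ω_f i j, by simp, by simp⟩
  case ω'_e i j => exact ⟨_, _, .ω'_e i j, by simp, by simp⟩
  case ω'_f i j => exact ⟨_, _, .ω'_f i j, by simp, by simp⟩
  case e_f i => exact ⟨_, _, .e_f i, by simp, by simp⟩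
  case e_f_ne i j h => exact ⟨_, _, .e_f_ne i j h, by simp, by simp⟩
  case serre_e i j h => exact ⟨_, _, .serre_e i j h, by simp [map_serreE], by simp⟩
  case serre_f i j h => exact ⟨_, _, .serre_f i j h, by simp [map_serreF], by simp⟩

theorem RelD.exists_of_map (φ : A →ₐ[K] B) {x : GenD n → A} {p q : B}
    (h : RelD r s (fun g => φ (x g)) p q) : ∃ p₀ q₀, RelD r s x p₀ q₀ ∧ φ p₀ = p ∧ φ q₀ = q := by
  cases h
  case base h =>
    obtain ⟨p₀, q₀, h0, h1, h2⟩ := Rel.exists_of_map φ h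
    exact ⟨p₀, q₀, .base h0, h1, h2⟩
  case D_inv => exact ⟨_, _, .D_inv, by simp, by simp⟩
  case inv_D => exact ⟨_, _, .inv_D, by simp, by simp⟩
  case D'_inv => exact ⟨_, _, .D'_inv, by simp, by simp⟩
  case inv_D' => exact ⟨_, _, .inv_D', by simp, by simp⟩
  case D_D' => exact ⟨_, _, .D_D', by simp, by simp⟩
  case D_ω i => exact ⟨_, _, .D_ω i, by simp, by simp⟩
  case D_ω' i => exact ⟨_, _, .D_ω' i, by simp, by simp⟩
  case D'_ω i => exact ⟨_, _, .D'_ω i, by simp, by simp⟩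
  case D'_ω' i => exact ⟨_, _, .D'_ω' i, by simp, by simp⟩
  case D_e i => exact ⟨_, _, .D_e i, by simp, map_smul _ _ _⟩
  case D_f i => exact ⟨_, _, .D_f i, by simp, map_smul _ _ _⟩
  case D'_e i => exact ⟨_, _, .D'_e i, by simp, map_smul _ _ _⟩
  case D'_f i => exact ⟨_, _, .D'_f i, by simp, map_smul _ _ _⟩
  case γ_central g => exact ⟨_, _, .γ_central g, by simp, by simp⟩
  case γ'_central g => exact ⟨_, _, .γ'_central g, by simp, by simp⟩

/-- The generators of `U'` satisfy the defining relations. -/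
theorem UAff'.rel (p q : UAff' r s n) (h : Rel r s (UAff'.gen r s n) p q) : p = q := by
  obtain ⟨p₀, q₀, h0, rfl, rfl⟩ := Rel.exists_of_map (RingQuot.mkAlgHom K _) h
  exact RingQuot.mkAlgHom_rel K h0

/-- The generators of `U` satisfy the defining relations. -/
theorem UAff.rel (p q : UAff r s n) (h : RelD r s (UAff.gen r s n) p q) : p = q := by
  obtain ⟨p₀, q₀, h0, rfl, rfl⟩ := RelD.exists_of_map (RingQuot.mkAlgHom K _) h
  exact RingQuot.mkAlgHom_rel K h0

end Lift

section Tables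

variable {n : ℕ}

theorem form_root_left (hn : 2 ≤ n) (i : Fin (n + 1)) (y : Fin n → ℤ) :
    form (root i) y =
      if h0 : (i : ℕ) = 0 then -2 * y ⟨0, by omega⟩
      else if hn' : (i : ℕ) = n then 2 * y ⟨n - 1, by omega⟩
      else y ⟨i - 1, by omega⟩ - y ⟨i, by omega⟩ := by
  unfold form root
  split_ifs with h0 h1
  · rw [Finset.sum_eq_single ⟨0, by omega⟩]
    · simp
    · intro k _ hk
      have : (k : ℕ) ≠ 0 := fun h => hk (Fin.ext h)
      simp [this]
    · simp
  · rw [Finset.sum_eq_single ⟨n - 1, by omega⟩]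
    · rw [if_pos (by first | (simp; omega) | omega)]
    · intro k _ hk
      have : (k : ℕ) + 1 ≠ n := fun h => hk (Fin.ext (by first | (simp; omega) | omega))
      simp [this]
    · simp
  · have hlt := i.2
    rw [Finset.sum_eq_add (⟨i - 1, by omega⟩ : Fin n) ⟨i, by omega⟩]
    · rw [if_pos (by first | (simp; omega) | omega), if_neg (by simp), if_pos (by simp)]
      ring
    · intro h
      have := congrArg Fin.val h
      simp at this
      omega
    · intro k _ hk
      have h2 : (k : ℕ) + 1 ≠ i := fun h => hk.1 (Fin.ext (by first | (simp; omega) | omega))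
      have h3 : (k : ℕ) ≠ i := fun h => hk.2 (Fin.ext (by first | (simp; omega) | omega))
      simp [h2, h3]
    · simp
    · simp

theorem form_root (hn : 2 ≤ n) (i j : Fin (n + 1)) :
    form (root i) (root j) =
      if (i : ℕ) = j then (if (i : ℕ) = 0 ∨ (i : ℕ) = n then 4 else 2)
      else if (i : ℕ) + 1 = j then (if (i : ℕ) = 0 ∨ (j : ℕ) = n then -2 else -1)
      else if (j : ℕ) + 1 = i then (if (j : ℕ) = 0 ∨ (i : ℕ) = n then -2 else -1)
      else 0 := by
  have hi := i.2
  have hj := j.2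
  rw [form_root_left hn]
  unfold root
  dsimp only
  split_ifs <;> first | rfl | omega | (simp at * <;> omega)

theorem d_eq (hn : 2 ≤ n) (i : Fin (n + 1)) :
    d i = if (i : ℕ) = 0 ∨ (i : ℕ) = n then 2 else 1 := by
  rw [d, form_root hn, if_pos rfl]
  split_ifs <;> rfl

theorem cartan_eq (hn : 2 ≤ n) (i j : Fin (n + 1)) :
    cartan i j =
      if (i : ℕ) = j then 2
      else if (i : ℕ) + 1 = j then (if (i : ℕ) ≠ 0 ∧ (j : ℕ) = n then -2 else -1)
      else if (j : ℕ) + 1 = i then (if (j : ℕ) = 0 ∧ (i : ℕ) ≠ n then -2 else -1)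
      else 0 := by
  have hi := i.2
  have hj := j.2
  rw [cartan, form_root hn, form_root hn, if_pos rfl]
  split_ifs <;> first | rfl | omega | (simp at * <;> omega)

theorem ringelSimple_eq (hn : 2 ≤ n) (i j : Fin n) :
    ringelSimple i j =
      if (i : ℕ) = j then (if (i : ℕ) + 1 = n then 2 else 1)
      else if (i : ℕ) + 1 = j then (if (j : ℕ) + 1 = n then -2 else -1)
      else 0 := by
  have hi := i.2
  have hj := j.2
  rw [ringelSimple, d_eq hn, cartan_eq hn]
  simp only [Fin.lt_def, Fin.ext_iff, Fin.val_succ, Nat.add_eq_zero_iff, one_ne_zero, and_false, false_or]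
  split_ifs <;> first | rfl | omega | (simp at * <;> omega)

theorem sum_theta_ringel (hn : 2 ≤ n) (j : Fin n) :
    ∑ i, (theta i : ℤ) * ringelSimple i j =
      if (j : ℕ) = 0 then 2 else if (j : ℕ) + 1 = n then -2 else 0 := by
  have hj := j.2
  by_cases h0 : (j : ℕ) = 0
  · rw [Finset.sum_eq_single j]
    · simp only [ringelSimple_eq hn, theta]
      split_ifs <;> first | rfl | omega | (simp at * <;> omega)
    · intro i _ hij
      have : (i : ℕ) ≠ j := fun h => hij (Fin.ext h)
      rw [ringelSimple_eq hn, if_neg this, if_neg (by omega), mul_zero]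
    · simp
  · rw [Finset.sum_eq_add (⟨j - 1, by omega⟩ : Fin n) j]
    · simp only [ringelSimple_eq hn, theta]
      split_ifs <;> first | rfl | omega | (simp at * <;> omega)
    · intro h
      have := congrArg Fin.val h
      simp at this
      omega
    · intro k _ hk
      have h2 : (k : ℕ) + 1 ≠ j := fun h => hk.1 (Fin.ext (by first | (simp; omega) | omega))
      have h3 : (k : ℕ) ≠ j := fun h => hk.2 (Fin.ext (by first | (simp; omega) | omega))
      simp [ringelSimple_eq hn, h2, h3]
    · simp
    · simp

theorem sum_ringel_theta (hn : 2 ≤ n) (i : Fin n) :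
    ∑ j, (theta j : ℤ) * ringelSimple i j = if (i : ℕ) + 1 = n then 2 else 0 := by
  have hi := i.2
  by_cases h0 : (i : ℕ) + 1 = n
  · rw [Finset.sum_eq_single i]
    · simp only [ringelSimple_eq hn, theta]
      split_ifs <;> first | rfl | omega | (simp at * <;> omega)
    · intro j _ hij
      have hj := j.2
      have : (i : ℕ) ≠ j := fun h => hij (Fin.ext h.symm)
      rw [ringelSimple_eq hn, if_neg this, if_neg (by omega), mul_zero]
    · simp
  · rw [Finset.sum_eq_add i (⟨i + 1, by omega⟩ : Fin n)]
    · simp only [ringelSimple_eq hn, theta]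
      split_ifs <;> first | rfl | omega | (simp at * <;> omega)
    · intro h
      have := congrArg Fin.val h
      simp at this
    · intro k _ hk
      have h2 : (i : ℕ) + 1 ≠ k := fun h => hk.2 (Fin.ext (by first | (simp; omega) | omega))
      have h3 : (i : ℕ) ≠ k := fun h => hk.1 (Fin.ext (by first | (simp; omega) | omega))
      simp [ringelSimple_eq hn, h2, h3]
    · simp
    · simp

theorem ringel_eq (hn : 2 ≤ n) (i j : Fin (n + 1)) :
    ringel (coords i) (coords j) =
      if (i : ℕ) = j then (if (i : ℕ) = 0 ∨ (i : ℕ) = n then 2 else 1)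
      else if (i : ℕ) + 1 = j then (if (i : ℕ) = 0 ∨ (j : ℕ) = n then -2 else -1)
      else if (i : ℕ) = 0 ∧ (j : ℕ) = n then 2
      else if (i : ℕ) = n ∧ (j : ℕ) = 0 then -2
      else 0 := by
  have key1 (y : Fin n → ℤ) (a : Fin n) :
      ringel (coords a.succ) y = ∑ b, y b * ringelSimple a b := by
    unfold ringel coords
    rw [Finset.sum_eq_single a]
    · simp
    · intro b _ hb
      simp [hb]
    · simp
  refine Fin.cases ?_ (fun a => ?_) i <;> refine Fin.cases ?_ (fun b => ?_) j
  · have : ringel (coords (0 : Fin (n + 1))) (coords 0) =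
        ∑ j : Fin n, (theta j : ℤ) * ∑ i : Fin n, (theta i : ℤ) * ringelSimple i j := by
      unfold ringel coords
      rw [Finset.sum_comm]
      simp only [Finset.mul_sum]
      refine Finset.sum_congr rfl fun j _ => Finset.sum_congr rfl fun i _ => ?_
      simp only [Fin.cases_zero]
      ring
    rw [this]
    simp only [sum_theta_ringel hn]
    rw [Finset.sum_eq_add (⟨0, by omega⟩ : Fin n) ⟨n - 1, by omega⟩]
    · simp only [theta]
      simp only [Fin.val_zero]
      split_ifs <;> first | rfl | omega | (simp at * <;> omega)
    · intro h
      have := congrArg Fin.val h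
      simp at this
      omega
    · intro k _ hk
      have h2 : (k : ℕ) ≠ 0 := fun h => hk.1 (Fin.ext (by first | (simp; omega) | omega))
      have h3 : (k : ℕ) + 1 ≠ n := fun h => hk.2 (Fin.ext (by first | (simp; omega) | omega))
      simp [h2, h3]
    · simp
    · simp
  · have : ringel (coords (0 : Fin (n + 1))) (coords b.succ) =
        -∑ i : Fin n, (theta i : ℤ) * ringelSimple i b := by
      unfold ringel coords
      rw [← Finset.sum_neg_distrib]
      refine Finset.sum_congr rfl fun i _ => ?_
      rw [Finset.sum_eq_single b]
      · simp
      · intro c _ hc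
        simp [hc]
      · simp
    rw [this, sum_theta_ringel hn]
    have hb := b.2
    simp only [Fin.val_succ, Fin.val_zero]
    split_ifs <;> first | rfl | omega | (simp at * <;> omega)
  · have : ringel (coords a.succ) (coords (0 : Fin (n + 1))) =
        -∑ j : Fin n, (theta j : ℤ) * ringelSimple a j := by
      rw [key1, ← Finset.sum_neg_distrib]
      refine Finset.sum_congr rfl fun i _ => ?_
      simp [coords]
    rw [this, sum_ringel_theta hn]
    have ha := a.2
    simp only [Fin.val_succ, Fin.val_zero]
    split_ifs <;> first | rfl | omega | (simp at * <;> omega)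
  · have : ringel (coords a.succ) (coords b.succ) = ringelSimple a b := by
      rw [key1, Finset.sum_eq_single b]
      · simp [coords]
      · intro c _ hc
        simp [coords, hc]
      · simp
    rw [this, ringelSimple_eq hn]
    have ha := a.2
    have hb := b.2
    simp only [Fin.val_succ, Nat.add_eq_zero_iff, one_ne_zero, and_false, false_or]
    split_ifs <;> first | rfl | omega | (simp at * <;> omega)

end Tables

/-- Genericity of the parameters: `r`, `s` are nonzero and `r / s` is not a root of unity. -/
structure Good {K : Type*} [Field K] (r s : K) : Prop where
  r_ne : r ≠ 0
  s_ne : s ≠ 0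
  pow_ne : ∀ k : ℕ, 0 < k → r ^ k ≠ s ^ k

theorem Good.of_algebraicIndependent {K : Type*} [Field K] [Algebra ℂ K] {r s : K}
    (h : AlgebraicIndependent ℂ ![r, s]) : Good r s := by
  have hr : r ≠ 0 := by simpa using h.ne_zero 0
  have hs : s ≠ 0 := by simpa using h.ne_zero 1
  refine ⟨hr, hs, fun k hk hrs => ?_⟩
  have h2 : MvPolynomial.aeval ![r, s]
      (MvPolynomial.X 0 ^ k - MvPolynomial.X 1 ^ k : MvPolynomial (Fin 2) ℂ) = 0 := by
    simp [hrs]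
  have h3 := (injective_iff_map_eq_zero _).1 h _ h2
  have h4 := congrArg (MvPolynomial.eval ![(1 : ℂ), 0]) h3
  simp [hk.ne'] at h4

section Serre

variable {K : Type*} [Field K] {r s : K} {n : ℕ}

theorem Good.zpow (h : Good r s) {m : ℤ} (hm : m = 1 ∨ m = 2) : Good (r ^ m) (s ^ m) := by
  rcases hm with rfl | rfl
  · simpa using h
  · refine ⟨zpow_ne_zero _ h.r_ne, zpow_ne_zero _ h.s_ne, fun k hk => ?_⟩
    have := h.pow_ne (2 * k) (by omega)
    simpa [pow_mul, zpow_ofNat] using this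

theorem qInt_one (h : Good r s) : qInt r s 1 = 1 := by
  have : r - s ≠ 0 := sub_ne_zero.2 (by simpa using h.pow_ne 1 one_pos)
  simp [qInt, this]

theorem qInt_two (h : Good r s) : qInt r s 2 = r + s := by
  have : r - s ≠ 0 := sub_ne_zero.2 (by simpa using h.pow_ne 1 one_pos)
  rw [qInt]
  field_simp
  ring

theorem qInt_three (h : Good r s) : qInt r s 3 = r ^ 2 + r * s + s ^ 2 := by
  have : r - s ≠ 0 := sub_ne_zero.2 (by simpa using h.pow_ne 1 one_pos)
  rw [qInt]
  field_simp
  ring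

theorem qInt_ne (h : Good r s) {m : ℕ} (hm : 0 < m) : qInt r s m ≠ 0 :=
  div_ne_zero (sub_ne_zero.2 (h.pow_ne m hm)) (sub_ne_zero.2 (by simpa using h.pow_ne 1 one_pos))

theorem qFact_ne (h : Good r s) (m : ℕ) : qFact r s m ≠ 0 :=
  Finset.prod_ne_zero_iff.2 fun k _ => qInt_ne h (Nat.succ_pos k)

theorem qFact_succ (m : ℕ) : qFact r s (m + 1) = qFact r s m * qInt r s (m + 1) := by
  simp [qFact, Finset.prod_range_succ]

theorem qFact_zero : qFact r s 0 = 1 := by simp [qFact]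

theorem qBinom_zero (h : Good r s) (m : ℕ) : qBinom r s m 0 = 1 := by
  have := qFact_ne h m
  rw [qBinom]
  simp [this, qFact_zero]

theorem qBinom_self (h : Good r s) (m : ℕ) : qBinom r s m m = 1 := by
  have := qFact_ne h m
  rw [qBinom]
  simp [this, qFact_zero]

theorem qBinom_two_one (h : Good r s) : qBinom r s 2 1 = r + s := by
  simp [qBinom, qFact, Finset.prod_range_succ, qInt_one h, qInt_two h]

theorem qBinom_three_one (h : Good r s) : qBinom r s 3 1 = r ^ 2 + r * s + s ^ 2 := by
  have := qInt_ne h (m := 2) (by norm_num)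
  simp [qBinom, qFact, Finset.prod_range_succ, qInt_one h, qInt_three h]
  field_simp

theorem qBinom_three_two (h : Good r s) : qBinom r s 3 2 = r ^ 2 + r * s + s ^ 2 := by
  have := qInt_ne h (m := 2) (by norm_num)
  simp [qBinom, qFact, Finset.prod_range_succ, qInt_one h, qInt_three h]
  field_simp

variable {A : Type*} [Ring A] [Algebra K A]

/-- The twisted commutator `X a - t a X`. -/
def tcomm (t : K) (X a : A) : A := X * a - t • (a * X)

theorem tcomm_left {x y a : A} {q t : K} (hxy : y * x = q • (x * y)) (ha : y * a = t • (a * y)) :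
    tcomm t (x + y) a = tcomm t x a ∧
      y * tcomm t x a = (t * q) • (tcomm t x a * y) := by
  constructor
  · simp only [tcomm, add_mul, mul_add, smul_add, ha]
    abel
  · simp only [tcomm, mul_sub, sub_mul, mul_smul_comm, smul_mul_assoc, smul_sub]
    rw [← mul_assoc, hxy, ← mul_assoc, ha, smul_mul_assoc, mul_assoc, ha, smul_mul_assoc,
      mul_assoc, hxy]
    simp only [mul_smul_comm, smul_smul, mul_assoc]
    congr 2 <;> ring

theorem tcomm_right {x y b : A} {q t t' : K} (hxy : y * x = q • (x * y))
    (hb : b * x = t' • (x * b)) (htt : t * t' = 1) :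
    tcomm t (x + y) b = tcomm t y b ∧
      tcomm t y b * x = (t' * q) • (x * tcomm t y b) := by
  constructor
  · simp only [tcomm, add_mul, mul_add, smul_add, hb, smul_smul, htt, one_smul]
    abel
  · simp only [tcomm, mul_sub, sub_mul, mul_smul_comm, smul_mul_assoc, smul_sub]
    rw [mul_assoc, hb, mul_assoc b y x, hxy]
    simp only [mul_smul_comm, smul_smul, ← mul_assoc]
    rw [hxy, hb]
    simp only [smul_mul_assoc, smul_smul]
    congr 2; ring

theorem tcomm_tcomm (t t' : K) (X a : A) :
    tcomm t X (tcomm t' X a) = tcomm t' X (tcomm t X a) := by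
  simp only [tcomm, mul_sub, sub_mul, mul_smul_comm, smul_mul_assoc, smul_sub, smul_smul,
    mul_assoc, mul_comm t t']
  abel

/-- The Serre expression as an iterated twisted commutator. -/
theorem serreE_eq (hn : 2 ≤ n) (h : Good r s) (x : Fin (n + 1) → A) {i j : Fin (n + 1)}
    (hij : i ≠ j) :
    (cartan i j = 0 ∧ serreE r s x i j = tcomm (Om r s j i) (x i) (x j)) ∨
    (cartan i j = -1 ∧ serreE r s x i j = tcomm (Om r s j i * Om r s i i) (x i)
      (tcomm (Om r s j i) (x i) (x j))) ∨
    (cartan i j = -2 ∧ serreE r s x i j = tcomm (Om r s j i * Om r s i i ^ 2) (x i)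
      (tcomm (Om r s j i * Om r s i i) (x i) (tcomm (Om r s j i) (x i) (x j)))) := by
  have hd : d i = 1 ∨ d i = 2 := by rw [d_eq hn]; split_ifs <;> simp
  have hg := h.zpow hd
  have hO : Om r s i i = r ^ d i / s ^ d i := by
    rw [Om, ringel_eq hn, d_eq hn, if_pos rfl, zpow_neg, div_eq_mul_inv]
  have hc : cartan i j = 0 ∨ cartan i j = -1 ∨ cartan i j = -2 := by
    have : (i : ℕ) ≠ j := fun h => hij (Fin.ext h)
    rw [cartan_eq hn, if_neg this]
    split_ifs <;> simp
  have hs := hg.s_ne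
  rcases hc with hc | hc | hc
  · refine Or.inl ⟨hc, ?_⟩
    simp [serreE, hc, Finset.sum_range_succ, serreCoeff, qBinom_zero hg, qBinom_self hg, tcomm,
      sub_eq_add_neg]
  · refine Or.inr (Or.inl ⟨hc, ?_⟩)
    have hm : (1 - cartan i j).toNat = 2 := by rw [hc]; rfl
    rw [hO]
    simp only [serreE, serreCoeff, hm]
    simp only [hc, Finset.sum_range_succ]
    norm_num [qBinom_zero hg, qBinom_self hg, qBinom_two_one hg]
    simp only [tcomm, mul_sub, sub_mul, mul_smul_comm, smul_mul_assoc, smul_sub, smul_smul,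
      mul_assoc, pow_succ, pow_zero, one_mul]
    match_scalars <;> field_simp <;> ring
  · refine Or.inr (Or.inr ⟨hc, ?_⟩)
    have hm : (1 - cartan i j).toNat = 3 := by rw [hc]; rfl
    rw [hO]
    simp only [serreE, serreCoeff, hm]
    simp only [hc, Finset.sum_range_succ]
    norm_num [qBinom_zero hg, qBinom_self hg, qBinom_three_one hg, qBinom_three_two hg]
    simp only [tcomm, mul_sub, sub_mul, mul_smul_comm, smul_mul_assoc, smul_sub, smul_smul,
      mul_assoc, pow_succ, pow_zero, one_mul]
    match_scalars <;> field_simp <;> ring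


set_option maxHeartbeats 1000000 in
theorem ringel_add (hn : 2 ≤ n) {i j : Fin (n + 1)} (hij : i ≠ j) :
    ringel (coords j) (coords i) + ringel (coords i) (coords j) -
      cartan i j * ringel (coords i) (coords i) = 0 := by
  have hi := i.2
  have hj := j.2
  have hne : (i : ℕ) ≠ j := fun h => hij (Fin.ext h)
  rw [cartan_eq hn, ringel_eq hn, ringel_eq hn, ringel_eq hn, if_neg hne, if_neg hne,
    if_neg hne.symm]
  split_ifs <;> first | rfl | omega

theorem Om_mul_Om (hn : 2 ≤ n) (h : Good r s) {i j : Fin (n + 1)} (hij : i ≠ j) {m : ℕ}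
    (hm : cartan i j = -m) : Om r s j i * Om r s i j * Om r s i i ^ m = 1 := by
  have hr := h.r_ne
  have hs := h.s_ne
  have key := ringel_add hn hij
  rw [hm] at key
  unfold Om
  generalize ringel (coords j) (coords i) = a at key ⊢
  generalize ringel (coords i) (coords j) = b at key ⊢
  generalize ringel (coords i) (coords i) = c at key ⊢
  have e (t : K) (ht : t ≠ 0) (a b c : ℤ) (habc : a + b - -m * c = 0) :
      t ^ a * t ^ b * (t ^ c) ^ m = 1 := by
    rw [← zpow_natCast, ← zpow_mul, ← zpow_add₀ ht, ← zpow_add₀ ht, ← zpow_zero t]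
    congr 1
    linarith
  have er := e r hr a b c key
  have es := e s hs (-b) (-a) (-c) (by linarith)
  calc _ = (r ^ a * r ^ b * (r ^ c) ^ m) * (s ^ (-b) * s ^ (-a) * (s ^ (-c)) ^ m) := by
          rw [mul_pow]; ring
    _ = 1 := by rw [er, es, one_mul]

theorem serreE_add (hn : 2 ≤ n) (h : Good r s) (X Y : Fin (n + 1) → A)
    (hXY : ∀ a b, Y a * X b = Om r s b a • (X b * Y a)) {i j : Fin (n + 1)} (hij : i ≠ j) :
    serreE r s (fun k => X k + Y k) i j = serreE r s X i j + serreE r s Y i j := by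
  have lin (t : K) (Z a b : A) : tcomm t Z (a + b) = tcomm t Z a + tcomm t Z b := by
    simp only [tcomm, mul_add, add_mul, smul_add]; abel
  have E0 := serreE_eq hn h (fun k => X k + Y k) hij
  have E1 := serreE_eq hn h X hij
  have E2 := serreE_eq hn h Y hij
  have hl := tcomm_left (hXY i i) (hXY i j)
  rcases E0 with ⟨hc, E0⟩ | ⟨hc, E0⟩ | ⟨hc, E0⟩ <;>
    simp only [hc, true_and, false_and, or_false, false_or, zero_eq_neg,
      neg_eq_zero, one_ne_zero, OfNat.ofNat_ne_zero, neg_inj, OfNat.ofNat_ne_one,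
      OfNat.one_ne_ofNat] at E1 E2
  · have hO := Om_mul_Om hn h hij (m := 0) (by simpa using hc)
    rw [pow_zero, mul_one] at hO
    rw [E0, E1, E2, lin, hl.1, (tcomm_right (hXY i i) (hXY j i) hO).1]
  · have hO := Om_mul_Om hn h hij (m := 1) (by simpa using hc)
    rw [pow_one] at hO
    have hl2 := tcomm_left (hXY i i) hl.2
    have hr1 := tcomm_right (hXY i i) (hXY j i) (t := Om r s j i * Om r s i i)
      (by rw [← hO]; ring)
    have hr2 := tcomm_right (hXY i i) hr1.2 (t := Om r s j i) (by rw [← hO]; ring)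
    rw [E0, E1, E2, lin, lin, hl.1, hl2.1, tcomm_tcomm _ _ (X i + Y i) (Y j), hr1.1, hr2.1,
      tcomm_tcomm _ _ (Y i) (Y j)]
  · have hO := Om_mul_Om hn h hij (m := 2) (by simpa using hc)
    have hl2 := tcomm_left (hXY i i) hl.2
    have hl3 := tcomm_left (hXY i i) hl2.2
    rw [mul_assoc, ← pow_two] at hl3
    have hr1 := tcomm_right (hXY i i) (hXY j i) (t := Om r s j i * Om r s i i ^ 2)
      (by rw [← hO]; ring)
    have hr2 := tcomm_right (hXY i i) hr1.2 (t := Om r s j i * Om r s i i) (by rw [← hO]; ring)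
    have hr3 := tcomm_right (hXY i i) hr2.2 (t := Om r s j i) (by rw [← hO]; ring)
    have rev (Z : A) : tcomm (Om r s j i * Om r s i i ^ 2) Z
        (tcomm (Om r s j i * Om r s i i) Z (tcomm (Om r s j i) Z (Y j))) =
        tcomm (Om r s j i) Z (tcomm (Om r s j i * Om r s i i) Z
          (tcomm (Om r s j i * Om r s i i ^ 2) Z (Y j))) := by
      rw [tcomm_tcomm (Om r s j i * Om r s i i) (Om r s j i), tcomm_tcomm _ (Om r s j i),
        tcomm_tcomm (Om r s j i * Om r s i i ^ 2) (Om r s j i * Om r s i i)]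
    rw [E0, E1, E2, lin, lin, lin, hl.1, hl2.1, hl3.1, rev, hr1.1, hr2.1, hr3.1, rev]

theorem serreE_tmul (w x : Fin (n + 1) → A) (hw : ∀ a b, w a * w b = w b * w a)
    (i j : Fin (n + 1)) :
    serreE r s (fun k => w k ⊗ₜ[K] x k) i j =
      (w i ^ (1 - cartan i j).toNat * w j) ⊗ₜ[K] serreE r s x i j := by
  simp only [serreE, TensorProduct.tmul_sum, TensorProduct.tmul_smul]
  refine Finset.sum_congr rfl fun k hk => ?_
  have hk' : k ≤ (1 - cartan i j).toNat := by simpa [Nat.lt_succ_iff] using hk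
  simp only [Algebra.TensorProduct.tmul_pow, Algebra.TensorProduct.tmul_mul_tmul]
  congr 2
  have hc : w j * w i ^ k = w i ^ k * w j := ((show Commute (w j) (w i) from hw j i).pow_right k)
  rw [mul_assoc, hc, ← mul_assoc, ← pow_add, Nat.sub_add_cancel hk']

theorem op_serreF (x : Fin (n + 1) → A) (i j : Fin (n + 1)) :
    MulOpposite.op (serreF r s x i j) = serreE r s (fun k => MulOpposite.op (x k)) i j := by
  simp [serreE, serreF, mul_assoc]

theorem serreF_add (hn : 2 ≤ n) (h : Good r s) (X Y : Fin (n + 1) → A)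
    (hXY : ∀ a b, X b * Y a = Om r s b a • (Y a * X b)) {i j : Fin (n + 1)} (hij : i ≠ j) :
    serreF r s (fun k => X k + Y k) i j = serreF r s X i j + serreF r s Y i j := by
  apply MulOpposite.op_injective
  rw [MulOpposite.op_add, op_serreF, op_serreF, op_serreF]
  simp only [MulOpposite.op_add]
  refine serreE_add hn h _ _ (fun a b => ?_) hij
  rw [← MulOpposite.op_mul, hXY, MulOpposite.op_smul, MulOpposite.op_mul]

theorem serreF_tmul (x w : Fin (n + 1) → A) (hw : ∀ a b, w a * w b = w b * w a)
    (i j : Fin (n + 1)) :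
    serreF r s (fun k => x k ⊗ₜ[K] w k) i j =
      serreF r s x i j ⊗ₜ[K] (w i ^ (1 - cartan i j).toNat * w j) := by
  simp only [serreF, TensorProduct.sum_tmul]
  refine Finset.sum_congr rfl fun k hk => ?_
  have hk' : k ≤ (1 - cartan i j).toNat := by simpa [Nat.lt_succ_iff] using hk
  simp only [Algebra.TensorProduct.tmul_pow, Algebra.TensorProduct.tmul_mul_tmul,
    TensorProduct.smul_tmul']
  congr 1
  have hc : w i ^ k * w j = w j * w i ^ k := ((show Commute (w i) (w j) from hw i j).pow_left k)
  rw [hc, mul_assoc, ← pow_add, Nat.add_sub_cancel' hk', (show Commute (w j) (w i) from hw j i).pow_right]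

theorem thetaProd_tmul (w w' : Fin (n + 1) → A) :
    thetaProd (fun i => w i ⊗ₜ[K] w' i) = thetaProd w ⊗ₜ[K] thetaProd w' := by
  have key : ∀ (l : List (Fin n)),
      (l.map fun i => (w i.succ ⊗ₜ[K] w' i.succ) ^ theta i).prod =
        (l.map fun i => w i.succ ^ theta i).prod ⊗ₜ[K] (l.map fun i => w' i.succ ^ theta i).prod := by
    intro l
    induction l with
    | nil => rfl
    | cons a l ih =>
      rw [List.map_cons, List.prod_cons, ih, List.map_cons, List.prod_cons, List.map_cons,
        List.prod_cons, Algebra.TensorProduct.tmul_pow, Algebra.TensorProduct.tmul_mul_tmul]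
  simpa [thetaProd, List.ofFn_eq_map] using key (List.finRange n)

end Serre

section Coproduct

variable {K : Type*} [Field K] {r s : K} {n : ℕ} {A : Type*} [Ring A] [Algebra K A]

/-- The coproduct on generators: `Δ(e_i) = e_i ⊗ 1 + ω_i ⊗ e_i`, `Δ(f_i) = 1 ⊗ f_i + f_i ⊗ ω'_i`,
and all other generators are group-like. -/
def comulGen (x : Gen n → A) : Gen n → A ⊗[K] A
  | .e i => x (.e i) ⊗ₜ 1 + x (.ω i) ⊗ₜ x (.e i)
  | .f i => 1 ⊗ₜ x (.f i) + x (.f i) ⊗ₜ x (.ω' i)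
  | .ω i => x (.ω i) ⊗ₜ x (.ω i)
  | .ωinv i => x (.ωinv i) ⊗ₜ x (.ωinv i)
  | .ω' i => x (.ω' i) ⊗ₜ x (.ω' i)
  | .ω'inv i => x (.ω'inv i) ⊗ₜ x (.ω'inv i)
  | .γ => x .γ ⊗ₜ x .γ
  | .γinv => x .γinv ⊗ₜ x .γinv
  | .γ' => x .γ' ⊗ₜ x .γ'
  | .γ'inv => x .γ'inv ⊗ₜ x .γ'inv

/-- The coproduct on the generators of the algebra with degree generators; `D`, `D'` are
group-like. -/
def comulGenD (x : GenD n → A) : GenD n → A ⊗[K] A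
  | .base g => comulGen (fun g => x (.base g)) g
  | .D => x .D ⊗ₜ x .D
  | .Dinv => x .Dinv ⊗ₜ x .Dinv
  | .D' => x .D' ⊗ₜ x .D'
  | .D'inv => x .D'inv ⊗ₜ x .D'inv

theorem comulGen_rel (hn : 2 ≤ n) (h : Good r s) (x : Gen n → A)
    (hx : ∀ p q, Rel r s x p q → p = q) (p q : A ⊗[K] A)
    (hpq : Rel r s (comulGen (K := K) x) p q) : p = q := by
  have hO : ∀ i j : Fin (n + 1), Om r s i j ≠ 0 := fun i j =>
    mul_ne_zero (zpow_ne_zero _ h.r_ne) (zpow_ne_zero _ h.s_ne)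
  have hωω := fun i j => hx _ _ (.ω_ω i j)
  have hωω' := fun i j => hx _ _ (.ω_ω' i j)
  have hω'ω' := fun i j => hx _ _ (.ω'_ω' i j)
  have hωe := fun i j => hx _ _ (.ω_e i j)
  have hωf := fun i j => hx _ _ (.ω_f i j)
  have hω'e := fun i j => hx _ _ (.ω'_e i j)
  have hω'f := fun i j => hx _ _ (.ω'_f i j)
  have hef := fun i => hx _ _ (.e_f i)
  have hefne := fun i j h => hx _ _ (.e_f_ne i j h)
  have hγ := fun g => hx _ _ (.γ_central g)
  have hγ' := fun g => hx _ _ (.γ'_central g)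
  -- the commutator of `Δ(e_i)` and `Δ(f_j)`
  have comm : ∀ i j, comulGen (K := K) x (.e i) * comulGen x (.f j)
      - comulGen x (.f j) * comulGen x (.e i) =
      (x (.e i) * x (.f j) - x (.f j) * x (.e i)) ⊗ₜ x (.ω' j)
        + x (.ω i) ⊗ₜ (x (.e i) * x (.f j) - x (.f j) * x (.e i)) := by
    intro i j
    have h1 : (x (.ω i) * x (.f j)) ⊗ₜ[K] (x (.e i) * x (.ω' j)) =
        (x (.f j) * x (.ω i)) ⊗ₜ[K] (x (.ω' j) * x (.e i)) := by
      rw [hωf, hω'e, TensorProduct.smul_tmul]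
    simp only [comulGen, add_mul, mul_add, Algebra.TensorProduct.tmul_mul_tmul, mul_one, one_mul,
      TensorProduct.sub_tmul, TensorProduct.tmul_sub, h1]
    abel
  cases hpq with
  | ω_ω i j => simp only [comulGen, Algebra.TensorProduct.tmul_mul_tmul, hωω i j]
  | ω_ω' i j => simp only [comulGen, Algebra.TensorProduct.tmul_mul_tmul, hωω' i j]
  | ω'_ω' i j => simp only [comulGen, Algebra.TensorProduct.tmul_mul_tmul, hω'ω' i j]
  | ω_inv i => simp only [comulGen, Algebra.TensorProduct.tmul_mul_tmul, hx _ _ (.ω_inv i)]; rfl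
  | inv_ω i => simp only [comulGen, Algebra.TensorProduct.tmul_mul_tmul, hx _ _ (.inv_ω i)]; rfl
  | ω'_inv i => simp only [comulGen, Algebra.TensorProduct.tmul_mul_tmul, hx _ _ (.ω'_inv i)]; rfl
  | inv_ω' i => simp only [comulGen, Algebra.TensorProduct.tmul_mul_tmul, hx _ _ (.inv_ω' i)]; rfl
  | γ_inv => simp only [comulGen, Algebra.TensorProduct.tmul_mul_tmul, hx _ _ .γ_inv]; rfl
  | inv_γ => simp only [comulGen, Algebra.TensorProduct.tmul_mul_tmul, hx _ _ .inv_γ]; rfl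
  | γ'_inv => simp only [comulGen, Algebra.TensorProduct.tmul_mul_tmul, hx _ _ .γ'_inv]; rfl
  | inv_γ' => simp only [comulGen, Algebra.TensorProduct.tmul_mul_tmul, hx _ _ .inv_γ']; rfl
  | γ_eq =>
    simp only [comulGen, thetaProd_tmul, Algebra.TensorProduct.tmul_mul_tmul]
    rw [← hx _ _ .γ_eq]
  | γ'_eq =>
    simp only [comulGen, thetaProd_tmul, Algebra.TensorProduct.tmul_mul_tmul]
    rw [← hx _ _ .γ'_eq]
  | γ_central g =>
    cases g <;> simp only [comulGen, add_mul, mul_add, Algebra.TensorProduct.tmul_mul_tmul,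
      one_mul, mul_one, hγ]
  | γ'_central g =>
    cases g <;> simp only [comulGen, add_mul, mul_add, Algebra.TensorProduct.tmul_mul_tmul,
      one_mul, mul_one, hγ']
  | ω_e i j =>
    simp only [comulGen, add_mul, mul_add, Algebra.TensorProduct.tmul_mul_tmul, one_mul, mul_one,
      hωe i j, hωω i j, TensorProduct.tmul_smul, TensorProduct.smul_tmul', smul_add]
  | ω_f i j =>
    simp only [comulGen, add_mul, mul_add, Algebra.TensorProduct.tmul_mul_tmul, one_mul, mul_one,
      hωf i j, hωω' i j, TensorProduct.tmul_smul, TensorProduct.smul_tmul', smul_add]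
  | ω'_e i j =>
    simp only [comulGen, add_mul, mul_add, Algebra.TensorProduct.tmul_mul_tmul, one_mul, mul_one,
      hω'e i j, ← hωω' j i, TensorProduct.tmul_smul, TensorProduct.smul_tmul', smul_add]
  | ω'_f i j =>
    simp only [comulGen, add_mul, mul_add, Algebra.TensorProduct.tmul_mul_tmul, one_mul, mul_one,
      hω'f i j, hω'ω' i j, TensorProduct.tmul_smul, TensorProduct.smul_tmul', smul_add]
  | e_f i =>
    rw [comm, hef]
    simp only [comulGen, ← TensorProduct.smul_tmul', TensorProduct.tmul_smul, ← smul_add]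
    congr 1
    simp only [TensorProduct.sub_tmul, TensorProduct.tmul_sub]
    abel
  | e_f_ne i j hij => rw [comm, hefne i j hij]; simp
  | serre_e i j hij =>
    have e1 : serreE r s (fun k => x (.e k) ⊗ₜ[K] (1 : A)) i j = 0 := by
      have := map_serreE (r := r) (s := s) (Algebra.TensorProduct.includeLeft (R := K) (S := K)
        (A := A) (B := A)) (fun k => x (.e k)) i j
      rw [hx _ _ (.serre_e i j hij), map_zero] at this
      exact this.symm
    have e2 := serreE_tmul (r := r) (s := s) (fun k => x (.ω k)) (fun k => x (.e k)) hωω i j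
    rw [hx _ _ (.serre_e i j hij), TensorProduct.tmul_zero] at e2
    have e3 := serreE_add hn h (fun k => x (.e k) ⊗ₜ[K] (1 : A))
      (fun k => x (.ω k) ⊗ₜ[K] x (.e k)) (fun a b => by
        simp only [Algebra.TensorProduct.tmul_mul_tmul, one_mul, mul_one, hωe,
          TensorProduct.smul_tmul']) hij
    rw [e1, e2, add_zero] at e3
    exact e3
  | serre_f i j hij =>
    have e1 : serreF r s (fun k => (1 : A) ⊗ₜ[K] x (.f k)) i j = 0 := by
      have := map_serreF (r := r) (s := s) (Algebra.TensorProduct.includeRight (R := K)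
        (A := A) (B := A)) (fun k => x (.f k)) i j
      rw [hx _ _ (.serre_f i j hij), map_zero] at this
      exact this.symm
    have e2 := serreF_tmul (r := r) (s := s) (fun k => x (.f k)) (fun k => x (.ω' k)) hω'ω' i j
    rw [hx _ _ (.serre_f i j hij), TensorProduct.zero_tmul] at e2
    have e3 := serreF_add hn h (fun k => x (.f k) ⊗ₜ[K] x (.ω' k))
      (fun k => (1 : A) ⊗ₜ[K] x (.f k)) (fun a b => by
        simp only [Algebra.TensorProduct.tmul_mul_tmul, one_mul, mul_one, hω'f,
          TensorProduct.tmul_smul]) hij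
    rw [e1, e2, add_zero] at e3
    simpa only [comulGen, add_comm] using e3

theorem comulGenD_rel (hn : 2 ≤ n) (h : Good r s) (x : GenD n → A)
    (hx : ∀ p q, RelD r s x p q → p = q) (p q : A ⊗[K] A)
    (hpq : RelD r s (comulGenD (K := K) x) p q) : p = q := by
  have hDω := fun i => hx _ _ (.D_ω i)
  have hDω' := fun i => hx _ _ (.D_ω' i)
  have hD'ω := fun i => hx _ _ (.D'_ω i)
  have hD'ω' := fun i => hx _ _ (.D'_ω' i)
  have hγ := fun g => hx _ _ (.γ_central g)
  have hγ' := fun g => hx _ _ (.γ'_central g)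
  have hD := hx _ _ .D_inv
  have hD' := hx _ _ .D'_inv
  have c1 (i) : x .D * x (.base (.ω i)) * x .Dinv = x (.base (.ω i)) := by
    rw [hDω, mul_assoc, hD, mul_one]
  have c2 (i) : x .D * x (.base (.ω' i)) * x .Dinv = x (.base (.ω' i)) := by
    rw [hDω', mul_assoc, hD, mul_one]
  have c3 (i) : x .D' * x (.base (.ω i)) * x .D'inv = x (.base (.ω i)) := by
    rw [hD'ω, mul_assoc, hD', mul_one]
  have c4 (i) : x .D' * x (.base (.ω' i)) * x .D'inv = x (.base (.ω' i)) := by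
    rw [hD'ω', mul_assoc, hD', mul_one]
  cases hpq with
  | base hb => exact comulGen_rel hn h _ (fun p q h => hx _ _ (.base h)) p q hb
  | D_inv => simp only [comulGenD, Algebra.TensorProduct.tmul_mul_tmul, hx _ _ .D_inv]; rfl
  | inv_D => simp only [comulGenD, Algebra.TensorProduct.tmul_mul_tmul, hx _ _ .inv_D]; rfl
  | D'_inv => simp only [comulGenD, Algebra.TensorProduct.tmul_mul_tmul, hx _ _ .D'_inv]; rfl
  | inv_D' => simp only [comulGenD, Algebra.TensorProduct.tmul_mul_tmul, hx _ _ .inv_D']; rfl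
  | D_D' => simp only [comulGenD, Algebra.TensorProduct.tmul_mul_tmul, hx _ _ .D_D']
  | D_ω i => simp only [comulGenD, comulGen, Algebra.TensorProduct.tmul_mul_tmul, hDω]
  | D_ω' i => simp only [comulGenD, comulGen, Algebra.TensorProduct.tmul_mul_tmul, hDω']
  | D'_ω i => simp only [comulGenD, comulGen, Algebra.TensorProduct.tmul_mul_tmul, hD'ω]
  | D'_ω' i => simp only [comulGenD, comulGen, Algebra.TensorProduct.tmul_mul_tmul, hD'ω']
  | D_e i =>
    simp only [comulGenD, comulGen, add_mul, mul_add, Algebra.TensorProduct.tmul_mul_tmul, mul_one,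
      hD, hx _ _ (.D_e i), c1, TensorProduct.smul_tmul', TensorProduct.tmul_smul, smul_add]
  | D_f i =>
    simp only [comulGenD, comulGen, add_mul, mul_add, Algebra.TensorProduct.tmul_mul_tmul, mul_one,
      hD, hx _ _ (.D_f i), c2, TensorProduct.smul_tmul', TensorProduct.tmul_smul, smul_add]
  | D'_e i =>
    simp only [comulGenD, comulGen, add_mul, mul_add, Algebra.TensorProduct.tmul_mul_tmul, mul_one,
      hD', hx _ _ (.D'_e i), c3, TensorProduct.smul_tmul', TensorProduct.tmul_smul, smul_add]
  | D'_f i =>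
    simp only [comulGenD, comulGen, add_mul, mul_add, Algebra.TensorProduct.tmul_mul_tmul, mul_one,
      hD', hx _ _ (.D'_f i), c4, TensorProduct.smul_tmul', TensorProduct.tmul_smul, smul_add]
  | γ_central g =>
    rcases g with g | _ | _ | _ | _ <;> [cases g; skip; skip; skip; skip] <;>
    simp only [comulGenD, comulGen, add_mul, mul_add, Algebra.TensorProduct.tmul_mul_tmul, one_mul,
      mul_one, hγ]
  | γ'_central g =>
    rcases g with g | _ | _ | _ | _ <;> [cases g; skip; skip; skip; skip] <;>
    simp only [comulGenD, comulGen, add_mul, mul_add, Algebra.TensorProduct.tmul_mul_tmul, one_mul,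
      mul_one, hγ']

end Coproduct
section VectorRep

variable {K : Type*} [Field K] (r s : K) {n : ℕ}

/-- The matrix unit `E_{kl}` of size `2n`, with indices `1 ≤ k, l ≤ 2n`. -/
def E (K : Type*) [Field K] (n : ℕ) (k l : ℕ) : Matrix (Fin (2 * n)) (Fin (2 * n)) K :=
  Matrix.of fun x y => if (x : ℕ) + 1 = k ∧ (y : ℕ) + 1 = l then 1 else 0

/-- The matrices of `e_1, …, e_n` in the vector representation, and, at the node `0`,
the matrix unit `E_{1'1}`. Here `i' = 2n + 1 - i`. -/
def matE (i : Fin (n + 1)) : Matrix (Fin (2 * n)) (Fin (2 * n)) K :=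
  if (i : ℕ) = 0 then E K n (2 * n) 1
  else if (i : ℕ) = n then E K n n (n + 1)
  else E K n i (i + 1) - E K n (2 * n + 1 - (i + 1)) (2 * n + 1 - i)

/-- The matrices of `f_1, …, f_n` in the vector representation, and, at the node `0`,
the matrix unit `E_{11'}`. -/
def matF (i : Fin (n + 1)) : Matrix (Fin (2 * n)) (Fin (2 * n)) K :=
  if (i : ℕ) = 0 then E K n 1 (2 * n)
  else if (i : ℕ) = n then (r * s)⁻¹ • E K n (n + 1) n
  else E K n (i + 1) i - (r * s)⁻¹ • E K n (2 * n + 1 - i) (2 * n + 1 - (i + 1))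

/-- The eigenvalue of `ω_i` on the basis vector `v_{x+1}` in the vector representation; at the
node `0`, the eigenvalue of `ω_0` divided by `c`. The eigenvalues of `ω'_i` are obtained by
interchanging `r` and `s`. -/
def weight (i : Fin (n + 1)) (x : Fin (2 * n)) : K :=
  let k : ℕ := x + 1
  if (i : ℕ) = 0 then
    if k = 1 then r⁻¹ * s
    else if k = 2 * n then r * s⁻¹
    else if k ≤ n then r⁻¹ * s⁻¹
    else r * s
  else if (i : ℕ) = n then
    if k = n then r * s⁻¹
    else if k = n + 1 then r⁻¹ * s
    else if k < n then r⁻¹ * s⁻¹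
    else r * s
  else
    if k = i then r
    else if k = i + 1 then s
    else if k = 2 * n + 1 - i then r⁻¹
    else if k = 2 * n + 1 - (i + 1) then s⁻¹
    else 1

/-- The exponent of `r` in the eigenvalue `weight`. -/
def wexp (n i k : ℕ) : ℤ :=
  if i = 0 then
    if k = 1 then -1
    else if k = 2 * n then 1
    else if k ≤ n then -1
    else 1
  else if i = n then
    if k = n then 1
    else if k = n + 1 then -1
    else if k < n then -1
    else 1
  else
    if k = i then 1
    else if k = i + 1 then 0
    else if k = 2 * n + 1 - i then -1
    else 0

/-- The exponent of `s` in the eigenvalue `weight`. -/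
def wexp' (n i k : ℕ) : ℤ :=
  if i = 0 then
    if k = 1 then 1
    else if k = 2 * n then -1
    else if k ≤ n then -1
    else 1
  else if i = n then
    if k = n then -1
    else if k = n + 1 then 1
    else if k < n then -1
    else 1
  else
    if k = i + 1 then 1
    else if k = 2 * n + 1 - (i + 1) then -1
    else 0

theorem weight_eq (i : Fin (n + 1)) (x : Fin (2 * n)) :
    weight r s i x = r ^ wexp n i (x + 1) * s ^ wexp' n i (x + 1) := by
  have := i.2
  unfold weight wexp wexp'
  dsimp only
  split_ifs <;> first | (exfalso; omega) | simp

/-- The values of the Ringel form. -/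
def rf (n i j : ℕ) : ℤ :=
  if i = j then (if i = 0 ∨ i = n then 2 else 1)
  else if i + 1 = j then (if i = 0 ∨ j = n then -2 else -1)
  else if i = 0 ∧ j = n then 2
  else if i = n ∧ j = 0 then -2
  else 0

set_option maxHeartbeats 1000000 in
theorem wexp_add_aux (n i j : ℕ) (hi : i ≤ n) (hj : j ≤ n) (hn : 2 ≤ n) (k l : ℕ)
    (h : (j = 0 ∧ k = 2 * n ∧ l = 1) ∨ (j = n ∧ k = n ∧ l = n + 1) ∨
      (j ≠ 0 ∧ j ≠ n ∧ (k = j ∧ l = j + 1 ∨ k = 2 * n - j ∧ l = 2 * n + 1 - j))) :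
    wexp n i k = wexp n i l + rf n j i  := by
  have hn0 : n ≠ 0 := by omega
  unfold wexp rf
  rcases Nat.eq_zero_or_pos i with rfl | hi0
  · simp only [hn0, hn0.symm, if_true, if_false, true_and, and_true, false_and, and_false, true_or, or_true, false_or, or_false]
    rcases h with ⟨h1, h2, h3⟩ | ⟨h1, h2, h3⟩ | ⟨h1, h2, ⟨h3, h4⟩ | ⟨h3, h4⟩⟩ <;> omega
  rw [if_neg (by omega : ¬ i = 0), if_neg (by omega : ¬ i = 0)]
  rcases eq_or_ne i n with rfl | hin
  · simp only [hn0, hn0.symm, if_true, if_false, true_and, and_true, false_and, and_false, true_or, or_true, false_or, or_false]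
    rcases h with ⟨h1, h2, h3⟩ | ⟨h1, h2, h3⟩ | ⟨h1, h2, ⟨h3, h4⟩ | ⟨h3, h4⟩⟩ <;> omega
  simp only [hn0, hn0.symm, if_true, if_false, true_and, and_true, false_and, and_false, true_or, or_true, false_or, or_false, hin]
  rcases h with ⟨h1, h2, h3⟩ | ⟨h1, h2, h3⟩ | ⟨h1, h2, ⟨h3, h4⟩ | ⟨h3, h4⟩⟩ <;> omega

set_option maxHeartbeats 1000000 in
theorem wexp'_add_aux (n i j : ℕ) (hi : i ≤ n) (hj : j ≤ n) (hn : 2 ≤ n) (k l : ℕ)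
    (h : (j = 0 ∧ k = 2 * n ∧ l = 1) ∨ (j = n ∧ k = n ∧ l = n + 1) ∨
      (j ≠ 0 ∧ j ≠ n ∧ (k = j ∧ l = j + 1 ∨ k = 2 * n - j ∧ l = 2 * n + 1 - j))) :
   wexp' n i k = wexp' n i l - rf n i j := by
  have hn0 : n ≠ 0 := by omega
  unfold wexp' rf
  rcases Nat.eq_zero_or_pos i with rfl | hi0
  · simp only [hn0, hn0.symm, if_true, if_false, true_and, and_true, false_and, and_false, true_or, or_true, false_or, or_false]
    rcases h with ⟨h1, h2, h3⟩ | ⟨h1, h2, h3⟩ | ⟨h1, h2, ⟨h3, h4⟩ | ⟨h3, h4⟩⟩ <;> omega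
  rw [if_neg (by omega : ¬ i = 0), if_neg (by omega : ¬ i = 0)]
  rcases eq_or_ne i n with rfl | hin
  · simp only [hn0, hn0.symm, if_true, if_false, true_and, and_true, false_and, and_false, true_or, or_true, false_or, or_false]
    rcases h with ⟨h1, h2, h3⟩ | ⟨h1, h2, h3⟩ | ⟨h1, h2, ⟨h3, h4⟩ | ⟨h3, h4⟩⟩ <;> omega
  simp only [hn0, hn0.symm, if_true, if_false, true_and, and_true, false_and, and_false, true_or, or_true, false_or, or_false, hin]
  rcases h with ⟨h1, h2, h3⟩ | ⟨h1, h2, h3⟩ | ⟨h1, h2, ⟨h3, h4⟩ | ⟨h3, h4⟩⟩ <;> omega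

theorem wexp_add (hn : 2 ≤ n) (i j : Fin (n + 1)) (k l : ℕ)
    (h : ((j : ℕ) = 0 ∧ k = 2 * n ∧ l = 1) ∨ ((j : ℕ) = n ∧ k = n ∧ l = n + 1) ∨
      ((j : ℕ) ≠ 0 ∧ (j : ℕ) ≠ n ∧ (k = j ∧ l = j + 1 ∨ k = 2 * n - j ∧ l = 2 * n + 1 - j))) :
    wexp n i k = wexp n i l + ringel (coords j) (coords i) ∧
      wexp' n i k = wexp' n i l - ringel (coords i) (coords j) := by
  rw [ringel_eq hn, ringel_eq hn]
  exact ⟨wexp_add_aux n i j (Nat.lt_succ_iff.1 i.2) (Nat.lt_succ_iff.1 j.2) hn k l h,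
    wexp'_add_aux n i j (Nat.lt_succ_iff.1 i.2) (Nat.lt_succ_iff.1 j.2) hn k l h⟩

theorem sum_ite_fin {M : Type*} [AddCommMonoid M] (m : ℕ) (c : M) :
    ∑ i : Fin n, (if (i : ℕ) = m then c else 0) = if m < n then c else 0 := by
  split_ifs with h
  · rw [Finset.sum_eq_single (⟨m, h⟩ : Fin n)]
    · simp
    · intro b _ hb
      exact if_neg fun h' => hb (Fin.ext h')
    · simp
  · exact Finset.sum_eq_zero fun i _ => if_neg fun h' => h (by omega)

set_option maxHeartbeats 4000000 in
theorem sum_wexp (hn : 2 ≤ n) (x : Fin (2 * n)) :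
    wexp n 0 (x + 1) + ∑ i : Fin n, (theta i : ℤ) * wexp n (i.succ : Fin (n + 1)) (x + 1) = 0 := by
  have hx := x.2
  revert hx
  generalize (x : ℕ) = x
  intro hx
  have key : ∀ i : Fin n, (theta i : ℤ) * wexp n (i.succ : Fin (n + 1)) (x + 1) =
      (if (i : ℕ) = n - 1 then (if x + 1 = n then 1 else if x = n then -1 else if x < n then -1
        else 1) else 0) + (if (i : ℕ) = x then (if x + 1 < n then 2 else 0) else 0) +
      (if (i : ℕ) = 2 * n - 1 - x then (if n < x then -2 else 0) else 0) := by
    rintro ⟨i, hi⟩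
    unfold theta wexp
    simp only [Fin.val_succ]
    simp only [Nat.add_eq_zero_iff, one_ne_zero, and_false, if_false]
    by_cases h : i + 1 = n
    · rw [if_pos h, if_pos h]
      push_cast
      omega
    · rw [if_neg h, if_neg h]
      push_cast
      omega
  rw [Finset.sum_congr rfl fun i _ => key i]
  simp only [Finset.sum_add_distrib, sum_ite_fin]
  unfold wexp
  simp only [if_true]
  omega

set_option maxHeartbeats 4000000 in
theorem sum_wexp' (hn : 2 ≤ n) (x : Fin (2 * n)) :
    wexp' n 0 (x + 1) + ∑ i : Fin n, (theta i : ℤ) * wexp' n (i.succ : Fin (n + 1)) (x + 1) = 0 := by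
  have hx := x.2
  revert hx
  generalize (x : ℕ) = x
  intro hx
  have key : ∀ i : Fin n, (theta i : ℤ) * wexp' n (i.succ : Fin (n + 1)) (x + 1) =
      (if (i : ℕ) = n - 1 then (if x + 1 = n then -1 else if x = n then 1 else if x < n then -1
        else 1) else 0) + (if (i : ℕ) = x - 1 then (if x < n ∧ 0 < x then 2 else 0) else 0) +
      (if (i : ℕ) = 2 * n - 2 - x then (if n ≤ x ∧ x + 1 < 2 * n then -2 else 0) else 0) := by
    rintro ⟨i, hi⟩
    unfold theta wexp'
    simp only [Fin.val_succ]
    simp only [Nat.add_eq_zero_iff, one_ne_zero, and_false, if_false]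
    by_cases h : i + 1 = n
    · rw [if_pos h, if_pos h]
      push_cast
      omega
    · rw [if_neg h, if_neg h]
      push_cast
      omega
  rw [Finset.sum_congr rfl fun i _ => key i]
  simp only [Finset.sum_add_distrib, sum_ite_fin]
  unfold wexp'
  simp only [if_true]
  omega

theorem weight_theta (hn : 2 ≤ n) (hr : r ≠ 0) (hs : s ≠ 0) (x : Fin (2 * n)) :
    weight r s (0 : Fin (n + 1)) x * ∏ i : Fin n, weight r s i.succ x ^ theta i = 1 := by
  have h1 : ∏ i : Fin n, weight r s i.succ x ^ theta i =
      r ^ (∑ i : Fin n, (theta i : ℤ) * wexp n (i.succ : Fin (n + 1)) (x + 1)) *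
        s ^ (∑ i : Fin n, (theta i : ℤ) * wexp' n (i.succ : Fin (n + 1)) (x + 1)) := by
    have hz : ∀ (q : K), q ≠ 0 → ∀ (t : Finset (Fin n)) (g : Fin n → ℤ),
        q ^ (∑ i ∈ t, g i) = ∏ i ∈ t, q ^ g i := by
      intro q hq t g
      induction t using Finset.induction_on with
      | empty => simp
      | insert a t ha ih => rw [Finset.sum_insert ha, Finset.prod_insert ha, zpow_add₀ hq, ih]
    rw [hz r hr, hz s hs, ← Finset.prod_mul_distrib]
    refine Finset.prod_congr rfl fun i _ => ?_
    rw [weight_eq, mul_pow, mul_comm, mul_comm (theta i : ℤ), mul_comm (theta i : ℤ),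
      zpow_mul, zpow_mul, zpow_natCast, zpow_natCast, mul_comm]
  rw [h1, weight_eq, Fin.val_zero, mul_mul_mul_comm, ← zpow_add₀ hr, ← zpow_add₀ hs, sum_wexp hn, sum_wexp' hn]
  simp

theorem weight_ne (hr : r ≠ 0) (hs : s ≠ 0) (i : Fin (n + 1)) (x : Fin (2 * n)) :
    weight r s i x ≠ 0 := by
  rw [weight_eq]
  exact mul_ne_zero (zpow_ne_zero _ hr) (zpow_ne_zero _ hs)

theorem weight_swap (i : Fin (n + 1)) (x : Fin (2 * n)) :
    weight s r i x = r ^ wexp' n i (x + 1) * s ^ wexp n i (x + 1) := by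
  rw [weight_eq, mul_comm]

/-- The diagonal matrix of eigenvalues `weight`. -/
def matW (i : Fin (n + 1)) : Matrix (Fin (2 * n)) (Fin (2 * n)) K := Matrix.diagonal (weight r s i)

theorem E_mul_E (k l k' l' : ℕ) :
    E K n k l * E K n k' l' = if l = k' ∧ 1 ≤ l ∧ l ≤ 2 * n then E K n k l' else 0 := by
  ext x y
  rw [Matrix.mul_apply]
  split_ifs with h
  · rw [Finset.sum_eq_single (⟨l - 1, by omega⟩ : Fin (2 * n))]
    · have : l - 1 + 1 = l := by omega
      simp [E, this, h.1, ite_and]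
      have : k' - 1 + 1 = k' := by omega
      simp only [this, and_true, ite_true]
      split_ifs <;> rfl
    · intro b _ hb
      have : (b : ℕ) + 1 ≠ l := fun h' => hb (Fin.ext (by simp; omega))
      simp [E, this]
    · simp
  · refine Finset.sum_eq_zero fun b _ => ?_
    have hb := b.2
    by_cases h1 : (b : ℕ) + 1 = l
    · have : (b : ℕ) + 1 ≠ k' := by omega
      simp [E, this]
    · simp [E, h1]

/-- The positions of the nonzero entries of `matE j`. -/
def PosE (j : Fin (n + 1)) (k l : ℕ) : Prop :=
  ((j : ℕ) = 0 ∧ k = 2 * n ∧ l = 1) ∨ ((j : ℕ) = n ∧ k = n ∧ l = n + 1) ∨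
    ((j : ℕ) ≠ 0 ∧ (j : ℕ) ≠ n ∧ (k = j ∧ l = j + 1 ∨ k = 2 * n - j ∧ l = 2 * n + 1 - j))

theorem matE_apply_ne (j : Fin (n + 1)) (x y : Fin (2 * n)) (h : matE (K := K) j x y ≠ 0) :
    PosE j (x + 1) (y + 1) := by
  have hj := j.2
  unfold PosE
  contrapose! h
  unfold matE E
  split_ifs with h1 h2
  · simp only [Matrix.of_apply, ite_eq_right_iff, one_ne_zero, imp_false]
    omega
  · simp only [Matrix.of_apply, ite_eq_right_iff, one_ne_zero, imp_false]
    omega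
  · simp only [Matrix.of_apply, Matrix.sub_apply]
    rw [if_neg (by omega), if_neg (by omega), sub_zero]

theorem matF_apply_ne (j : Fin (n + 1)) (x y : Fin (2 * n)) (h : matF r s j x y ≠ 0) :
    PosE j (y + 1) (x + 1) := by
  have hj := j.2
  unfold PosE
  contrapose! h
  unfold matF E
  split_ifs with h1 h2
  · simp only [Matrix.of_apply, ite_eq_right_iff, one_ne_zero, imp_false]
    omega
  · simp only [Matrix.of_apply, Matrix.smul_apply]
    rw [if_neg (by omega), smul_zero]
  · simp only [Matrix.of_apply, Matrix.sub_apply, Matrix.smul_apply]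
    rw [if_neg (by omega), if_neg (by omega), smul_zero, sub_zero]

theorem weight_pos (hn : 2 ≤ n) (hr : r ≠ 0) (hs : s ≠ 0) (i j : Fin (n + 1)) (x y : Fin (2 * n))
    (h : PosE j (x + 1) (y + 1)) :
    weight r s i x = Om r s j i * weight r s i y ∧
      Om r s i j * weight s r i x = weight s r i y := by
  obtain ⟨h1, h2⟩ := wexp_add hn i j _ _ h
  constructor
  · rw [weight_eq, weight_eq, h1, h2, Om, zpow_add₀ hr, sub_eq_add_neg, zpow_add₀ hs]
    ring
  · rw [weight_swap, weight_swap, h1, h2, Om, zpow_add₀ hs, sub_eq_add_neg, zpow_add₀ hr,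
      zpow_neg, zpow_neg]
    have := zpow_ne_zero (ringel (coords i) (coords j)) hr
    have := zpow_ne_zero (ringel (coords j) (coords i)) hs
    field_simp

theorem matW_matE (hn : 2 ≤ n) (hr : r ≠ 0) (hs : s ≠ 0) (i j : Fin (n + 1)) :
    matW r s i * matE j = Om r s j i • (matE j * matW r s i) := by
  ext x y
  simp only [matW, Matrix.diagonal_mul, Matrix.smul_apply, Matrix.mul_diagonal, smul_eq_mul]
  by_cases h : matE (K := K) j x y = 0
  · simp [h]
  · rw [(weight_pos r s hn hr hs i j x y (matE_apply_ne j x y h)).1]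
    ring

theorem matW_matF (hn : 2 ≤ n) (hr : r ≠ 0) (hs : s ≠ 0) (i j : Fin (n + 1)) :
    matW r s i * matF r s j = (Om r s j i)⁻¹ • (matF r s j * matW r s i) := by
  have hO : Om r s j i ≠ 0 := mul_ne_zero (zpow_ne_zero _ hr) (zpow_ne_zero _ hs)
  ext x y
  simp only [matW, Matrix.diagonal_mul, Matrix.smul_apply, Matrix.mul_diagonal, smul_eq_mul]
  by_cases h : matF r s j x y = 0
  · simp [h]
  · rw [(weight_pos r s hn hr hs i j y x (matF_apply_ne r s j x y h)).1]
    field_simp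

theorem matW'_matE (hn : 2 ≤ n) (hr : r ≠ 0) (hs : s ≠ 0) (i j : Fin (n + 1)) :
    matW s r i * matE j = (Om r s i j)⁻¹ • (matE j * matW s r i) := by
  have hO : Om r s i j ≠ 0 := mul_ne_zero (zpow_ne_zero _ hr) (zpow_ne_zero _ hs)
  ext x y
  simp only [matW, Matrix.diagonal_mul, Matrix.smul_apply, Matrix.mul_diagonal, smul_eq_mul]
  by_cases h : matE (K := K) j x y = 0
  · simp [h]
  · rw [← (weight_pos r s hn hr hs i j x y (matE_apply_ne j x y h)).2]
    field_simp

theorem matW'_matF (hn : 2 ≤ n) (hr : r ≠ 0) (hs : s ≠ 0) (i j : Fin (n + 1)) :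
    matW s r i * matF r s j = Om r s i j • (matF r s j * matW s r i) := by
  ext x y
  simp only [matW, Matrix.diagonal_mul, Matrix.smul_apply, Matrix.mul_diagonal, smul_eq_mul]
  by_cases h : matF r s j x y = 0
  · simp [h]
  · rw [← (weight_pos r s hn hr hs i j y x (matF_apply_ne r s j x y h)).2]
    ring

theorem matE_matF (hn : 2 ≤ n) (i j : Fin (n + 1)) (hij : i ≠ j) :
    matE i * matF r s j = 0 ∧ matF r s j * matE i = 0 := by
  have hi := i.2
  have hj := j.2
  have hne : (i : ℕ) ≠ j := fun h => hij (Fin.ext h)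
  unfold matE matF
  constructor <;> split_ifs <;>
  simp only [sub_mul, mul_sub, smul_mul_assoc, mul_smul_comm, E_mul_E] <;>
  first
    | omega
    | (repeat rw [if_neg (by omega)]) <;> simp

theorem matE_sq (hn : 2 ≤ n) (i : Fin (n + 1)) : matE (K := K) i * matE i = 0 := by
  have hi := i.2
  unfold matE
  split_ifs <;>
  simp only [sub_mul, mul_sub, smul_mul_assoc, mul_smul_comm, E_mul_E] <;>
  (repeat rw [if_neg (by omega)]) <;> simp

theorem matF_sq (hn : 2 ≤ n) (i : Fin (n + 1)) : matF r s i * matF r s i = 0 := by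
  have hi := i.2
  unfold matF
  split_ifs <;>
  simp only [sub_mul, mul_sub, smul_mul_assoc, mul_smul_comm, E_mul_E] <;>
  (repeat rw [if_neg (by omega)]) <;> simp

theorem matE_mul_zero (hn : 2 ≤ n) (i j : Fin (n + 1)) (hij : i ≠ j) (hc : cartan i j = 0) :
    matE (K := K) i * matE j = 0 ∧ matE (K := K) j * matE i = 0 := by
  have hi := i.2
  have hj := j.2
  have hne : (i : ℕ) ≠ j := fun h => hij (Fin.ext h)
  have h : (i : ℕ) + 1 ≠ j ∧ (j : ℕ) + 1 ≠ i := by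
    rw [cartan_eq hn, if_neg hne] at hc
    split_ifs at hc <;> omega
  unfold matE
  constructor <;> split_ifs <;>
  simp only [sub_mul, mul_sub, smul_mul_assoc, mul_smul_comm, E_mul_E] <;>
  first
    | omega
    | (repeat rw [if_neg (by omega)]) <;> simp

theorem matF_mul_zero (hn : 2 ≤ n) (i j : Fin (n + 1)) (hij : i ≠ j) (hc : cartan i j = 0) :
    matF r s i * matF r s j = 0 ∧ matF r s j * matF r s i = 0 := by
  have hi := i.2
  have hj := j.2
  have hne : (i : ℕ) ≠ j := fun h => hij (Fin.ext h)
  have h : (i : ℕ) + 1 ≠ j ∧ (j : ℕ) + 1 ≠ i := by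
    rw [cartan_eq hn, if_neg hne] at hc
    split_ifs at hc <;> omega
  unfold matF
  constructor <;> split_ifs <;>
  simp only [sub_mul, mul_sub, smul_mul_assoc, mul_smul_comm, E_mul_E] <;>
  first
    | omega
    | (repeat rw [if_neg (by omega)]) <;> simp

theorem PosE_triple (hn : 2 ≤ n) {i j : Fin (n + 1)} (hij : i ≠ j) (hc : cartan i j = -1)
    {k l m o : ℕ} (h1 : PosE i k l) (h2 : PosE j l m) (h3 : PosE i m o) : False := by
  have hi := i.2
  have hj := j.2
  have hne : (i : ℕ) ≠ j := fun h => hij (Fin.ext h)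
  have h : ((i : ℕ) + 1 = j ∧ ((i : ℕ) = 0 ∨ (j : ℕ) ≠ n)) ∨
      ((j : ℕ) + 1 = i ∧ (j : ℕ) ≠ 0) := by
    rw [cartan_eq hn, if_neg hne] at hc
    split_ifs at hc <;> omega
  unfold PosE at h1 h2 h3
  omega

theorem mul_mul_eq_zero_of_apply {ι : Type*} [Fintype ι] (A B C : Matrix ι ι K)
    (h : ∀ x a b y, A x a ≠ 0 → B a b ≠ 0 → C b y ≠ 0 → False) : A * B * C = 0 := by
  ext x y
  rw [Matrix.mul_apply]
  refine Finset.sum_eq_zero fun b _ => ?_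
  rw [Matrix.mul_apply, Finset.sum_mul]
  refine Finset.sum_eq_zero fun a _ => ?_
  by_contra h0
  exact h x a b y (fun h' => h0 (by simp [h'])) (fun h' => h0 (by simp [h']))
    (fun h' => h0 (by simp [h']))

theorem matE_triple (hn : 2 ≤ n) (i j : Fin (n + 1)) (hij : i ≠ j) (hc : cartan i j = -1) :
    matE (K := K) i * matE j * matE i = 0 :=
  mul_mul_eq_zero_of_apply _ _ _ fun _ _ _ _ h1 h2 h3 =>
    PosE_triple hn hij hc (matE_apply_ne _ _ _ h1) (matE_apply_ne _ _ _ h2) (matE_apply_ne _ _ _ h3)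

theorem matF_triple (hn : 2 ≤ n) (i j : Fin (n + 1)) (hij : i ≠ j) (hc : cartan i j = -1) :
    matF r s i * matF r s j * matF r s i = 0 :=
  mul_mul_eq_zero_of_apply _ _ _ fun _ _ _ _ h1 h2 h3 =>
    PosE_triple hn hij hc (matF_apply_ne r s _ _ _ h3) (matF_apply_ne r s _ _ _ h2)
      (matF_apply_ne r s _ _ _ h1)

set_option maxHeartbeats 1000000 in
theorem matE_matF_comm (hn : 2 ≤ n) (h : Good r s) (i : Fin (n + 1)) :
    matE i * matF r s i - matF r s i * matE i =
      ((if (i : ℕ) = 0 then r * s else 1) * (r ^ d i - s ^ d i)⁻¹) •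
        (matW r s i - matW s r i) := by
  have hi := i.2
  have hr := h.r_ne
  have hs := h.s_ne
  have h1 : r - s ≠ 0 := sub_ne_zero.2 (by simpa using h.pow_ne 1 one_pos)
  have h2 : r ^ 2 - s ^ 2 ≠ 0 := sub_ne_zero.2 (h.pow_ne 2 two_pos)
  rw [d_eq hn]
  unfold matE matF
  simp only [matW]
  rw [Matrix.diagonal_sub]
  by_cases hi0 : (i : ℕ) = 0
  · simp only [hi0, if_true, true_or, zpow_ofNat, E_mul_E, true_and]
    rw [if_pos (by omega), if_pos (by omega)]
    ext x y
    by_cases hxy : x = y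
    · subst hxy
      have hx := x.2
      simp only [E, Matrix.sub_apply, Matrix.of_apply, Matrix.smul_apply, Matrix.diagonal_apply_eq,
        weight, hi0, if_true, smul_eq_mul, and_self]
      split_ifs <;> first | omega | (field_simp; try ring)
    · have : (x : ℕ) ≠ y := fun h => hxy (Fin.ext h)
      simp only [E, Matrix.sub_apply, Matrix.of_apply, Matrix.smul_apply,
        Matrix.diagonal_apply_ne _ hxy]
      rw [if_neg (by omega), if_neg (by omega)]
      simp
  · by_cases hin : (i : ℕ) = n
    · have hn0 : n ≠ 0 := by omega
      simp only [hin, hn0, if_true, if_false, false_or, zpow_ofNat, E_mul_E, mul_smul_comm,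
        smul_mul_assoc, true_and]
      rw [if_pos (by omega), if_pos (by omega)]
      ext x y
      by_cases hxy : x = y
      · subst hxy
        have hx := x.2
        simp only [E, Matrix.sub_apply, Matrix.of_apply, Matrix.smul_apply,
          Matrix.diagonal_apply_eq, weight, hin, hn0, if_true, if_false, smul_eq_mul, and_self]
        split_ifs <;> first | omega | (field_simp; try ring)
      · have : (x : ℕ) ≠ y := fun h => hxy (Fin.ext h)
        simp only [E, Matrix.sub_apply, Matrix.of_apply, Matrix.smul_apply,
          Matrix.diagonal_apply_ne _ hxy]
        rw [if_neg (by omega), if_neg (by omega)]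
        simp
    · simp only [hin, hi0, if_false, or_self, zpow_one, sub_mul, mul_sub, mul_smul_comm,
        smul_mul_assoc]
      have a1 : E K n i (i + 1) * E K n (i + 1) i = E K n i i := by
        rw [E_mul_E, if_pos (by omega)]
      have a2 : E K n i (i + 1) * E K n (2 * n + 1 - i) (2 * n + 1 - (i + 1)) = 0 := by
        rw [E_mul_E, if_neg (by omega)]
      have a3 : E K n (2 * n + 1 - (i + 1)) (2 * n + 1 - i) * E K n (i + 1) i = 0 := by
        rw [E_mul_E, if_neg (by omega)]
      have a4 : E K n (2 * n + 1 - (i + 1)) (2 * n + 1 - i) *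
          E K n (2 * n + 1 - i) (2 * n + 1 - (i + 1)) =
          E K n (2 * n + 1 - (i + 1)) (2 * n + 1 - (i + 1)) := by
        rw [E_mul_E, if_pos (by omega)]
      have b1 : E K n (i + 1) i * E K n i (i + 1) = E K n (i + 1) (i + 1) := by
        rw [E_mul_E, if_pos (by omega)]
      have b2 : E K n (2 * n + 1 - i) (2 * n + 1 - (i + 1)) * E K n i (i + 1) = 0 := by
        rw [E_mul_E, if_neg (by omega)]
      have b3 : E K n (i + 1) i * E K n (2 * n + 1 - (i + 1)) (2 * n + 1 - i) = 0 := by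
        rw [E_mul_E, if_neg (by omega)]
      have b4 : E K n (2 * n + 1 - i) (2 * n + 1 - (i + 1)) *
          E K n (2 * n + 1 - (i + 1)) (2 * n + 1 - i) = E K n (2 * n + 1 - i) (2 * n + 1 - i) := by
        rw [E_mul_E, if_pos (by omega)]
      simp only [a1, a2, a3, a4, b1, b2, b3, b4]
      ext x y
      by_cases hxy : x = y
      · subst hxy
        have hx := x.2
        simp only [E, Matrix.sub_apply, Matrix.of_apply, Matrix.smul_apply,
          Matrix.diagonal_apply_eq, weight, hin, hi0, if_false, smul_eq_mul, and_self,
          Matrix.zero_apply]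
        split_ifs <;> first | omega | (field_simp; try ring)
      · have : (x : ℕ) ≠ y := fun h => hxy (Fin.ext h)
        simp only [E, Matrix.sub_apply, Matrix.of_apply, Matrix.smul_apply,
          Matrix.diagonal_apply_ne _ hxy, Matrix.zero_apply]
        rw [if_neg (by omega), if_neg (by omega), if_neg (by omega), if_neg (by omega)]
        simp

theorem matW_thetaProd (hn : 2 ≤ n) (hr : r ≠ 0) (hs : s ≠ 0) :
    matW r s (0 : Fin (n + 1)) * thetaProd (matW r s) = 1 := by
  have h1 : ∀ i : Fin (n + 1), matW r s i =
      Matrix.diagonalAlgHom K (weight r s i) := fun i => rfl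
  rw [show matW r s = fun i : Fin (n + 1) => matW r s i from rfl]
  simp only [h1]
  rw [← map_thetaProd, ← map_mul]
  rw [← map_one (Matrix.diagonalAlgHom (n := Fin (2 * n)) (α := K) K)]
  congr 1
  funext x
  simp only [thetaProd, List.prod_ofFn, Pi.mul_apply, Finset.prod_apply, Pi.pow_apply, Pi.one_apply]
  exact weight_theta r s hn hr hs x

theorem matW_inv (hr : r ≠ 0) (hs : s ≠ 0) (i : Fin (n + 1)) :
    matW r s i * Matrix.diagonal (fun x => (weight r s i x)⁻¹) = 1 ∧
      Matrix.diagonal (fun x => (weight r s i x)⁻¹) * matW r s i = 1 := by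
  constructor <;>
  · rw [matW, Matrix.diagonal_mul_diagonal, ← Matrix.diagonal_one]
    congr 1
    funext x
    simp [weight_ne r s hr hs i x]

variable {A : Type*} [Ring A] [Algebra K A]

/-- The eigenvalue of `γ` and of `γ'` in the evaluation representation with parameters `a`, `b`. -/
def cConst (a b : K) : K := r * s * (a * b)

/-- The images of the generators in the evaluation representation with parameters `a`, `b`
and spectral parameter `u`; here `φ` maps matrices of size `2n` to the algebra `A` in which
the representation takes its values. -/
def evalGen (a b : K) (φ : Matrix (Fin (2 * n)) (Fin (2 * n)) K →ₐ[K] A) (u : Aˣ) : Gen n → A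
  | .e i => if i = 0 then a • (φ (matE 0) * (u : A)) else φ (matE i)
  | .f i => if i = 0 then b • (φ (matF r s 0) * (↑u⁻¹ : A)) else φ (matF r s i)
  | .ω i => (if i = 0 then cConst r s a b else 1) • φ (Matrix.diagonal (weight r s i))
  | .ωinv i =>
      (if i = 0 then cConst r s a b else 1)⁻¹ • φ (Matrix.diagonal fun x => (weight r s i x)⁻¹)
  | .ω' i => (if i = 0 then cConst r s a b else 1) • φ (Matrix.diagonal (weight s r i))
  | .ω'inv i =>
      (if i = 0 then cConst r s a b else 1)⁻¹ • φ (Matrix.diagonal fun x => (weight s r i x)⁻¹)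
  | .γ => cConst r s a b • 1
  | .γinv => (cConst r s a b)⁻¹ • 1
  | .γ' => cConst r s a b • 1
  | .γ'inv => (cConst r s a b)⁻¹ • 1

variable {r s}

theorem serreE_zero (hn : 2 ≤ n) (h : Good r s) (x : Fin (n + 1) → A) {i j : Fin (n + 1)}
    (hij : i ≠ j) (h2 : x i * x i = 0) (h1 : cartan i j = -1 → x i * x j * x i = 0)
    (h0 : cartan i j = 0 → x i * x j = 0 ∧ x j * x i = 0) : serreE r s x i j = 0 := by
  have h2' : ∀ y, x i * (x i * y) = 0 := fun y => by rw [← mul_assoc, h2, zero_mul]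
  rcases serreE_eq hn h x hij with ⟨hc, E0⟩ | ⟨hc, E0⟩ | ⟨hc, E0⟩ <;> rw [E0]
  · simp [tcomm, h0 hc]
  · have h1' := h1 hc
    rw [mul_assoc] at h1'
    simp [tcomm, mul_sub, sub_mul, mul_assoc, h2, h2', h1']
  · simp [tcomm, mul_sub, sub_mul, mul_assoc, h2, h2']

theorem serreF_zero (hn : 2 ≤ n) (h : Good r s) (x : Fin (n + 1) → A) {i j : Fin (n + 1)}
    (hij : i ≠ j) (h2 : x i * x i = 0) (h1 : cartan i j = -1 → x i * x j * x i = 0)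
    (h0 : cartan i j = 0 → x i * x j = 0 ∧ x j * x i = 0) : serreF r s x i j = 0 := by
  apply MulOpposite.op_injective
  rw [op_serreF, MulOpposite.op_zero]
  refine serreE_zero hn h _ hij ?_ (fun hc => ?_) (fun hc => ?_)
  · rw [← MulOpposite.op_mul, h2, MulOpposite.op_zero]
  · rw [← MulOpposite.op_mul, ← MulOpposite.op_mul, ← mul_assoc, h1 hc, MulOpposite.op_zero]
  · rw [← MulOpposite.op_mul, ← MulOpposite.op_mul, (h0 hc).1, (h0 hc).2, MulOpposite.op_zero]
    exact ⟨rfl, rfl⟩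

theorem evalGen_rel (hn : 2 ≤ n) (h : Good r s) (a b : Kˣ)
    (φ : Matrix (Fin (2 * n)) (Fin (2 * n)) K →ₐ[K] A) (u : Aˣ)
    (hu : ∀ M, (u : A) * φ M = φ M * u) (p q : A)
    (hpq : Rel r s (evalGen r s (a : K) b φ u) p q) : p = q := by
  have hr := h.r_ne
  have hs := h.s_ne
  have hc : cConst r s (a : K) b ≠ 0 := by simp [cConst, hr, hs]
  have hui : ∀ M, (↑u⁻¹ : A) * φ M = φ M * ↑u⁻¹ := fun M =>
    ((show Commute (u : A) (φ M) from hu M).units_inv_left).eq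
  let c : Fin (n + 1) → K := fun i => if i = 0 then cConst r s (a : K) b else 1
  have hci : ∀ i : Fin (n + 1), (if i = 0 then cConst r s (a : K) b else 1) ≠ 0 := fun i => by
    split_ifs <;> simp [hc]
  let y : Fin (n + 1) → A := fun i => if i = 0 then (a : K) • (u : A) else 1
  let z : Fin (n + 1) → A := fun i => if i = 0 then (b : K) • (↑u⁻¹ : A) else 1
  have hy : ∀ i M, y i * φ M = φ M * y i := fun i M => by
    dsimp only [y]; split_ifs <;> simp [hu]
  have hz : ∀ i M, z i * φ M = φ M * z i := fun i M => by
    dsimp only [z]; split_ifs <;> simp [hui]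
  have hyz : ∀ i j, z i * y j = y j * z i := fun i j => by
    dsimp only [y, z]; split_ifs <;> simp [smul_smul, mul_comm]
  have he : ∀ i, evalGen r s (a : K) b φ u (.e i) = φ (matE i) * y i := fun i => by
    dsimp only [evalGen, y]; split_ifs with h <;> simp [h]
  have hf : ∀ i, evalGen r s (a : K) b φ u (.f i) = φ (matF r s i) * z i := fun i => by
    dsimp only [evalGen, z]; split_ifs with h <;> simp [h]
  have hω : ∀ i, evalGen r s (a : K) b φ u (.ω i) = c i • φ (matW r s i) := fun i => rfl
  have hω' : ∀ i, evalGen r s (a : K) b φ u (.ω' i) = c i • φ (matW s r i) := fun i => rfl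
  have hdd : ∀ v w : Fin (2 * n) → K, φ (Matrix.diagonal v) * φ (Matrix.diagonal w) =
      φ (Matrix.diagonal w) * φ (Matrix.diagonal v) := fun v w => by
    rw [← map_mul, ← map_mul, Matrix.diagonal_mul_diagonal, Matrix.diagonal_mul_diagonal]
    simp only [mul_comm]
  have hee : ∀ i j, φ (matE i) * y i * (φ (matE j) * y j) = φ (matE i * matE j) * (y i * y j) :=
    fun i j => by rw [mul_assoc, ← mul_assoc (y i), hy, map_mul]; simp only [mul_assoc]
  have hff : ∀ i j, φ (matF r s i) * z i * (φ (matF r s j) * z j) =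
      φ (matF r s i * matF r s j) * (z i * z j) :=
    fun i j => by rw [mul_assoc, ← mul_assoc (z i), hz, map_mul]; simp only [mul_assoc]
  have hef : ∀ i j, φ (matE i) * y i * (φ (matF r s j) * z j) =
      φ (matE i * matF r s j) * (y i * z j) :=
    fun i j => by rw [mul_assoc, ← mul_assoc (y i), hy, map_mul]; simp only [mul_assoc]
  have hfe : ∀ i j, φ (matF r s j) * z j * (φ (matE i) * y i) =
      φ (matF r s j * matE i) * (y i * z j) :=
    fun i j => by rw [mul_assoc, ← mul_assoc (z j), hz, map_mul, ← hyz]; simp only [mul_assoc]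
  have hγ : ∀ g : A, (cConst r s (a : K) b • (1 : A)) * g = g * (cConst r s (a : K) b • (1 : A)) :=
    fun g => by simp
  have hth : ∀ v : Fin (n + 1) → Matrix (Fin (2 * n)) (Fin (2 * n)) K, v 0 * thetaProd v = 1 →
      cConst r s (a : K) b • (1 : A) =
        (c 0 • φ (v 0)) * thetaProd fun i => c i • φ (v i) := fun v hv => by
    have : (thetaProd fun i => c i • φ (v i)) = thetaProd fun i => φ (v i) := by
      simp [thetaProd, c]
    rw [this, ← map_thetaProd, smul_mul_assoc, ← map_mul, hv, map_one]
    simp [c]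
  have hgen : ∀ (W M : Matrix (Fin (2 * n)) (Fin (2 * n)) K) (o c : K) (y : A),
      (∀ M, y * φ M = φ M * y) → W * M = o • (M * W) →
        (c • φ W) * (φ M * y) = o • ((φ M * y) * (c • φ W)) := fun W M o c y hy h => by
    rw [smul_mul_assoc, ← mul_assoc, ← map_mul, h, map_smul, smul_mul_assoc, mul_smul_comm,
      mul_assoc, hy, ← mul_assoc, ← map_mul, smul_comm]
  cases hpq with
  | ω_ω i j =>
    simp only [hω, smul_mul_assoc, mul_smul_comm, matW]
    rw [hdd, smul_comm]
  | ω_ω' i j =>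
    simp only [hω, hω', smul_mul_assoc, mul_smul_comm, matW]
    rw [hdd, smul_comm]
  | ω'_ω' i j =>
    simp only [hω', smul_mul_assoc, mul_smul_comm, matW]
    rw [hdd, smul_comm]
  | ω_inv i =>
    simp only [evalGen, smul_mul_assoc, mul_smul_comm, smul_smul, ← map_mul]
    rw [show Matrix.diagonal (weight r s i) = matW r s i from rfl, (matW_inv r s hr hs i).1,
      inv_mul_cancel₀ (hci i), map_one, one_smul]
  | inv_ω i =>
    simp only [evalGen, smul_mul_assoc, mul_smul_comm, smul_smul, ← map_mul]
    rw [show Matrix.diagonal (weight r s i) = matW r s i from rfl, (matW_inv r s hr hs i).2,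
      mul_inv_cancel₀ (hci i), map_one, one_smul]
  | ω'_inv i =>
    simp only [evalGen, smul_mul_assoc, mul_smul_comm, smul_smul, ← map_mul]
    rw [show Matrix.diagonal (weight s r i) = matW s r i from rfl, (matW_inv s r hs hr i).1,
      inv_mul_cancel₀ (hci i), map_one, one_smul]
  | inv_ω' i =>
    simp only [evalGen, smul_mul_assoc, mul_smul_comm, smul_smul, ← map_mul]
    rw [show Matrix.diagonal (weight s r i) = matW s r i from rfl, (matW_inv s r hs hr i).2,
      mul_inv_cancel₀ (hci i), map_one, one_smul]
  | γ_inv => simp [evalGen, smul_smul, hc]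
  | inv_γ => simp [evalGen, smul_smul, hc]
  | γ'_inv => simp [evalGen, smul_smul, hc]
  | inv_γ' => simp [evalGen, smul_smul, hc]
  | γ_eq => exact hth (matW r s) (matW_thetaProd r s hn hr hs)
  | γ'_eq => exact hth (matW s r) (matW_thetaProd s r hn hs hr)
  | γ_central g => exact hγ _
  | γ'_central g => exact hγ _
  | ω_e i j =>
    rw [hω, he]
    exact hgen _ _ _ _ _ (hy j) (matW_matE r s hn hr hs i j)
  | ω_f i j =>
    rw [hω, hf]
    exact hgen _ _ _ _ _ (hz j) (matW_matF r s hn hr hs i j)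
  | ω'_e i j =>
    rw [hω', he]
    exact hgen _ _ _ _ _ (hy j) (matW'_matE r s hn hr hs i j)
  | ω'_f i j =>
    rw [hω', hf]
    exact hgen _ _ _ _ _ (hz j) (matW'_matF r s hn hr hs i j)
  | e_f i =>
    rw [he, hf, hef, hfe, ← sub_mul, ← map_sub, matE_matF_comm r s hn h, hω, hω', ← smul_sub,
      ← map_sub, map_smul, smul_mul_assoc]
    have : y i * z i = (if i = 0 then (a : K) * b else 1) • (1 : A) := by
      dsimp only [y, z]; split_ifs <;> simp [smul_smul, mul_comm]
    rw [this, mul_smul_comm, mul_one, smul_smul, smul_smul]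
    congr 1
    dsimp only [c, cConst]
    by_cases hi : i = 0
    · simp only [hi, if_true, Fin.val_zero]; ring
    · have hi' : (i : ℕ) ≠ 0 := fun h => hi (Fin.ext h)
      simp only [hi, hi', if_false]; ring
  | e_f_ne i j hij =>
    rw [he, hf, hef, hfe, (matE_matF r s hn i j hij).1, (matE_matF r s hn i j hij).2]
    simp
  | serre_e i j hij =>
    simp only [he]
    refine serreE_zero hn h _ hij ?_ (fun hc => ?_) (fun hc => ?_)
    · rw [hee, matE_sq hn, map_zero, zero_mul]
    · rw [hee, mul_assoc, ← mul_assoc (y i * y j), mul_assoc (y i), hy, ← mul_assoc (y i), hy,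
        ← mul_assoc, ← mul_assoc, ← mul_assoc, ← map_mul, matE_triple hn i j hij hc]
      simp
    · rw [hee, hee, (matE_mul_zero hn i j hij hc).1, (matE_mul_zero hn i j hij hc).2]
      simp
  | serre_f i j hij =>
    simp only [hf]
    refine serreF_zero hn h _ hij ?_ (fun hc => ?_) (fun hc => ?_)
    · rw [hff, matF_sq r s hn, map_zero, zero_mul]
    · rw [hff, mul_assoc, ← mul_assoc (z i * z j), mul_assoc (z i), hz, ← mul_assoc (z i), hz,
        ← mul_assoc, ← mul_assoc, ← mul_assoc, ← map_mul, matF_triple r s hn i j hij hc]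
      simp
    · rw [hff, hff, (matF_mul_zero r s hn i j hij hc).1, (matF_mul_zero r s hn i j hij hc).2]
      simp

end VectorRep

/-! ## The coproduct and the evaluation representations -/

section Representations

variable {K : Type*} [Field K] {r s : K} {n : ℕ}

/-- The coproduct of `U'_{r,s}(ŝp_{2n})`. -/
def comul' (hn : 2 ≤ n) (h : Good r s) : UAff' r s n →ₐ[K] UAff' r s n ⊗[K] UAff' r s n :=
  UAff'.lift (comulGen (UAff'.gen r s n)) (comulGen_rel hn h _ UAff'.rel)

/-- The coproduct of `U_{r,s}(ŝp_{2n})`. -/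
def comul (hn : 2 ≤ n) (h : Good r s) : UAff r s n →ₐ[K] UAff r s n ⊗[K] UAff r s n :=
  UAff.lift (comulGenD (UAff.gen r s n)) (comulGenD_rel hn h _ UAff.rel)

/-- The vector space `V = K^{2n}`. -/
abbrev V (K : Type*) (n : ℕ) : Type _ := Fin (2 * n) → K

/-- The evaluation representation `ρ_u^{a,b}` of `U'_{r,s}(ŝp_{2n})` on `V(u) = V`, for a nonzero
scalar `u`. -/
noncomputable def evalRep' (hn : 2 ≤ n) (h : Good r s) (a b u : Kˣ) :
    UAff' r s n →ₐ[K] Module.End K (V K n) :=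
  UAff'.lift (evalGen r s (a : K) b (Matrix.toLinAlgEquiv' : _ ≃ₐ[K] Module.End K (V K n)).toAlgHom
    (Units.map (algebraMap K (Module.End K (V K n))).toMonoidHom u))
    (evalGen_rel hn h a b _ _ fun _ => Algebra.commutes _ _)

/-- The Laurent polynomials in the spectral parameter, which is the variable `T`. -/
abbrev P (K : Type*) [Field K] : Type _ := LaurentPolynomial K

/-- The operator `v u^k ↦ v u^{k+1}` on `V(u) = V ⊗ K[u, u⁻¹]`. -/
noncomputable def mulU (K : Type*) [Field K] (n : ℕ) : (Module.End K (V K n ⊗[K] P K))ˣ where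
  val := LinearMap.lTensor (V K n) (LinearMap.mulLeft K (LaurentPolynomial.T 1))
  inv := LinearMap.lTensor (V K n) (LinearMap.mulLeft K (LaurentPolynomial.T (-1)))
  val_inv := by
    rw [Module.End.mul_eq_comp, ← LinearMap.lTensor_comp, ← LinearMap.mulLeft_mul,
      ← LaurentPolynomial.T_add]
    simp [Module.End.one_eq_id]
  inv_val := by
    rw [Module.End.mul_eq_comp, ← LinearMap.lTensor_comp, ← LinearMap.mulLeft_mul,
      ← LaurentPolynomial.T_add]
    simp [Module.End.one_eq_id]

/-- The map `u^k ↦ q^k u^k` on `K[u, u⁻¹]`. -/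
noncomputable def scaleU (q : Kˣ) : P K →ₐ[K] P K :=
  AddMonoidAlgebra.lift K (P K) ℤ
    { toFun := fun m => ((q ^ m.toAdd : Kˣ) : K) • LaurentPolynomial.T m.toAdd
      map_one' := by simp
      map_mul' := fun x y => by
        rw [toAdd_mul, zpow_add, LaurentPolynomial.T_add, Units.val_mul, smul_mul_smul_comm] }

theorem scaleU_T (q : Kˣ) (k : ℤ) :
    scaleU q (LaurentPolynomial.T k) = ((q ^ k : Kˣ) : K) • LaurentPolynomial.T k := by
  rw [scaleU, LaurentPolynomial.T, AddMonoidAlgebra.lift_single, one_smul]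
  rfl

/-- A matrix, acting on the first factor of `V(u) = V ⊗ K[u, u⁻¹]`. -/
noncomputable def matAct (K : Type*) [Field K] (n : ℕ) :
    Matrix (Fin (2 * n)) (Fin (2 * n)) K →ₐ[K] Module.End K (V K n ⊗[K] P K) :=
  (Module.End.rTensorAlgHom K (V K n) (P K)).comp
    (Matrix.toLinAlgEquiv' : _ ≃ₐ[K] Module.End K (V K n)).toAlgHom

/-- The operator `v u^k ↦ q^k v u^k` on `V(u) = V ⊗ K[u, u⁻¹]`. -/
noncomputable def degOp (n : ℕ) (q : Kˣ) : Module.End K (V K n ⊗[K] P K) :=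
  LinearMap.lTensor (V K n) (scaleU q).toLinearMap

/-- The images of the generators of `U_{r,s}(ŝp_{2n})` in the evaluation representation on
`V(u) = V ⊗ K[u, u⁻¹]`: `D` acts by `v u^k ↦ r_0^k v u^k` and `D'` by `v u^k ↦ s_0^k v u^k`. -/
noncomputable def evalGenD (h : Good r s) (n : ℕ) (a b : K) :
    GenD n → Module.End K (V K n ⊗[K] P K)
  | .base g => evalGen r s a b (matAct K n) (mulU K n) g
  | .D => degOp n (Units.mk0 r h.r_ne ^ d (0 : Fin (n + 1)))
  | .Dinv => degOp n (Units.mk0 r h.r_ne ^ d (0 : Fin (n + 1)))⁻¹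
  | .D' => degOp n (Units.mk0 s h.s_ne ^ d (0 : Fin (n + 1)))
  | .D'inv => degOp n (Units.mk0 s h.s_ne ^ d (0 : Fin (n + 1)))⁻¹

theorem degOp_matAct (q : Kˣ) (M : Matrix (Fin (2 * n)) (Fin (2 * n)) K) :
    degOp n q * matAct K n M = matAct K n M * degOp n q := by
  apply TensorProduct.ext'
  intro x y
  rfl

theorem mulU_matAct (M : Matrix (Fin (2 * n)) (Fin (2 * n)) K) :
    (mulU K n : Module.End K (V K n ⊗[K] P K)) * matAct K n M = matAct K n M * mulU K n := by
  apply TensorProduct.ext'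
  intro x y
  rfl

theorem degOp_mul (q q' : Kˣ) : degOp n q * degOp n q' = degOp n (q * q') := by
  rw [degOp, degOp, degOp, Module.End.mul_eq_comp, ← LinearMap.lTensor_comp]
  congr 1
  rw [← AlgHom.comp_toLinearMap]
  congr 1
  refine AddMonoidAlgebra.algHom_ext (fun k : ℤ => ?_) (Subsingleton.elim _ _)
  change scaleU q (scaleU q' (LaurentPolynomial.T k)) = scaleU (q * q') (LaurentPolynomial.T k)
  simp only [scaleU_T, map_smul, smul_smul, mul_zpow, Units.val_mul, mul_comm]

theorem degOp_one : degOp n (1 : Kˣ) = 1 := by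
  have : scaleU (1 : Kˣ) = AlgHom.id K (P K) := by
    refine AddMonoidAlgebra.algHom_ext (fun k : ℤ => ?_) (Subsingleton.elim _ _)
    change scaleU 1 (LaurentPolynomial.T k) = LaurentPolynomial.T k
    simp only [scaleU_T, one_zpow, Units.val_one, one_smul]
  rw [degOp, this]
  exact LinearMap.lTensor_id _ _

theorem degOp_mulU (q : Kˣ) : degOp n q * (mulU K n : Module.End K (V K n ⊗[K] P K)) =
    (q : K) • ((mulU K n : Module.End K (V K n ⊗[K] P K)) * degOp n q) := by
  apply TensorProduct.ext'
  intro x y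
  simp only [degOp, mulU, Module.End.mul_apply, LinearMap.smul_apply, LinearMap.lTensor_tmul,
    LinearMap.mulLeft_apply, AlgHom.toLinearMap_apply, map_mul, scaleU_T, zpow_one,
    smul_mul_assoc, TensorProduct.tmul_smul]

theorem degOp_mulU_inv (q : Kˣ) :
    degOp n q * (↑(mulU K n)⁻¹ : Module.End K (V K n ⊗[K] P K)) =
    (q : K)⁻¹ • ((↑(mulU K n)⁻¹ : Module.End K (V K n ⊗[K] P K)) * degOp n q) := by
  have h : (↑(mulU K n)⁻¹ : Module.End K (V K n ⊗[K] P K)) =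
    LinearMap.lTensor (V K n) (LinearMap.mulLeft K (LaurentPolynomial.T (-1))) := rfl
  rw [h]
  apply TensorProduct.ext'
  intro x y
  simp only [degOp, mulU, Module.End.mul_apply, LinearMap.smul_apply, LinearMap.lTensor_tmul,
    LinearMap.mulLeft_apply, AlgHom.toLinearMap_apply, map_mul, scaleU_T, zpow_neg, zpow_one,
    smul_mul_assoc, TensorProduct.tmul_smul, Units.val_inv_eq_inv_val]

theorem evalGenD_rel (hn : 2 ≤ n) (h : Good r s) (a b : Kˣ) (p q : Module.End K (V K n ⊗[K] P K))
    (hpq : RelD r s (evalGenD h n (a : K) b) p q) : p = q := by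
  have hinv : ∀ q : Kˣ, degOp n q * degOp n q⁻¹ = 1 := fun q => by
    rw [degOp_mul, mul_inv_cancel, degOp_one]
  have hinv' : ∀ q : Kˣ, degOp n q⁻¹ * degOp n q = 1 := fun q => by
    rw [degOp_mul, inv_mul_cancel, degOp_one]
  have he : ∀ (q : Kˣ) (i : Fin (n + 1)), degOp n (q ^ d (0 : Fin (n + 1))) *
      evalGen r s (a : K) b (matAct K n) (mulU K n) (.e i) * degOp n (q ^ d (0 : Fin (n + 1)))⁻¹ =
      (if i = 0 then (q : K) ^ d i else 1) •
        evalGen r s (a : K) b (matAct K n) (mulU K n) (.e i) := fun q i => by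
    dsimp only [evalGen]
    split_ifs with hi
    · subst hi
      rw [mul_smul_comm, ← mul_assoc, degOp_matAct, mul_assoc (matAct K n _), degOp_mulU,
        mul_smul_comm, smul_mul_assoc, smul_mul_assoc, mul_assoc, mul_assoc, hinv, mul_one,
        smul_comm, Units.val_zpow_eq_zpow_val]
    · rw [degOp_matAct, mul_assoc, hinv, mul_one, one_smul]
  have hf : ∀ (q : Kˣ) (i : Fin (n + 1)), degOp n (q ^ d (0 : Fin (n + 1))) *
      evalGen r s (a : K) b (matAct K n) (mulU K n) (.f i) * degOp n (q ^ d (0 : Fin (n + 1)))⁻¹ =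
      (if i = 0 then ((q : K) ^ d i)⁻¹ else 1) •
        evalGen r s (a : K) b (matAct K n) (mulU K n) (.f i) := fun q i => by
    dsimp only [evalGen]
    split_ifs with hi
    · subst hi
      rw [mul_smul_comm, ← mul_assoc, degOp_matAct, mul_assoc (matAct K n _), degOp_mulU_inv,
        mul_smul_comm, smul_mul_assoc, smul_mul_assoc, mul_assoc, mul_assoc, hinv, mul_one,
        smul_comm, Units.val_zpow_eq_zpow_val]
    · rw [degOp_matAct, mul_assoc, hinv, mul_one, one_smul]
  cases hpq with
  | base hb => exact evalGen_rel hn h a b _ _ mulU_matAct _ _ hb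
  | D_inv => exact hinv _
  | inv_D => exact hinv' _
  | D'_inv => exact hinv _
  | inv_D' => exact hinv' _
  | D_D' => simp only [evalGenD, degOp_mul, mul_comm]
  | D_ω i => simp only [evalGenD, evalGen, mul_smul_comm, smul_mul_assoc, degOp_matAct]
  | D_ω' i => simp only [evalGenD, evalGen, mul_smul_comm, smul_mul_assoc, degOp_matAct]
  | D'_ω i => simp only [evalGenD, evalGen, mul_smul_comm, smul_mul_assoc, degOp_matAct]
  | D'_ω' i => simp only [evalGenD, evalGen, mul_smul_comm, smul_mul_assoc, degOp_matAct]
  | D_e i => exact he _ i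
  | D_f i => exact hf _ i
  | D'_e i => exact he _ i
  | D'_f i => exact hf _ i
  | γ_central g => simp only [evalGenD, evalGen, mul_smul_comm, smul_mul_assoc, one_mul, mul_one]
  | γ'_central g => simp only [evalGenD, evalGen, mul_smul_comm, smul_mul_assoc, one_mul, mul_one]

/-- The evaluation representation `ρ_u^{a,b}` of `U_{r,s}(ŝp_{2n})` on `V(u) = V ⊗ K[u, u⁻¹]`, for
an indeterminate `u`. -/
noncomputable def evalRep (hn : 2 ≤ n) (h : Good r s) (a b : Kˣ) :
    UAff r s n →ₐ[K] Module.End K (V K n ⊗[K] P K) :=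
  UAff.lift (evalGenD h n (a : K) b) (evalGenD_rel hn h a b)

/-- The action of `x ∈ U'_{r,s}(ŝp_{2n})` on `V(u) ⊗ V(v)`, for nonzero scalars `u`, `v`. -/
noncomputable def tensorRep' (hn : 2 ≤ n) (h : Good r s) (a b u v : Kˣ) :
    UAff' r s n →ₐ[K] Module.End K (V K n ⊗[K] V K n) :=
  (Module.endTensorEndAlgHom.comp
    (Algebra.TensorProduct.map (evalRep' hn h a b u) (evalRep' hn h a b v))).comp (comul' hn h)

/-- The action of `x ∈ U_{r,s}(ŝp_{2n})` on `V(u) ⊗ V(v)`, for indeterminates `u`, `v`; the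
variable of the first (second) Laurent polynomial factor is the spectral parameter of the first
(second) tensor factor. -/
noncomputable def tensorRep (hn : 2 ≤ n) (h : Good r s) (a b : Kˣ) :
    UAff r s n →ₐ[K] Module.End K ((V K n ⊗[K] P K) ⊗[K] (V K n ⊗[K] P K)) :=
  (Module.endTensorEndAlgHom.comp
    (Algebra.TensorProduct.map (evalRep hn h a b) (evalRep hn h a b))).comp (comul hn h)

end Representations

/-! ## The affine `R`-matrix -/

section RMatrix

open Polynomial

variable {K : Type*} [Field K] (r s : K) (n : ℕ)

/-- `ξ = r^{-n-1} s^{n+1}`. -/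
def xi : K := r ^ (-(n : ℤ) - 1) * s ^ ((n : ℤ) + 1)

variable {n}

/-- The coefficient `t_i`: `t_i = s^{i-n-1}` for `i ≤ n` and `t_i = -r^{n-i}` for `i > n`.
The index `i ∈ {1, …, 2n}` is the element of `Fin (2 * n)` with value `i - 1`. -/
def tCoeff (i : Fin (2 * n)) : K :=
  if (i : ℕ) + 1 ≤ n then s ^ ((i : ℤ) + 1 - n - 1) else -r ^ ((n : ℤ) - ((i : ℤ) + 1))

/-- The sign `σ_i`. -/
def sgn (i : Fin (2 * n)) : ℤ := if (i : ℕ) + 1 ≤ n then 1 else -1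

/-- The coefficient `a_{ij}(z)` for `j ≠ i, i'`, as a polynomial in `z`; here `rh` and `sh` stand for
`r^{1/2}` and `s^{1/2}`, and `i'` is `i.rev`. -/
noncomputable def aCoeff (rh sh : K) (i j : Fin (2 * n)) : K[X] :=
  C (rh⁻¹ * sh) * (X - 1) * (X - C (xi r s n)) *
    C (if (i < j ∧ i < j.rev) ∨ (j < i ∧ j.rev < i) then (rh * sh) ^ (-(sgn i * sgn j))
      else (rh * sh) ^ (sgn i * sgn j))

/-- The coefficient `b_{ij}(z)`, as a polynomial in `z`. -/
noncomputable def bCoeff (i j : Fin (2 * n)) : K[X] :=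
  if j = i then (C (r⁻¹ * s) * X - C (xi r s n)) * (X - 1)
  else if i < j then
    C (r⁻¹ * s - 1) * (C (xi r s n * tCoeff r s i * (tCoeff r s j)⁻¹) * (X - 1) -
      if i = j.rev then X - C (xi r s n) else 0)
  else
    C (r⁻¹ * s - 1) * X * (C (tCoeff r s i * (tCoeff r s j)⁻¹) * (X - 1) -
      if i = j.rev then X - C (xi r s n) else 0)

/-- The `R`-matrix `R̂(z)`, as an element of an algebra `A` in which `EE i j k l` plays the role of
`E_{ij} ⊗ E_{kl}` and `z` the role of the spectral parameter. -/
noncomputable def RhatIn (rh sh : K) {A : Type*} [Semiring A] [Algebra K A]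
    (EE : Fin (2 * n) → Fin (2 * n) → Fin (2 * n) → Fin (2 * n) → A) (z : A) : A :=
  aeval z ((X - C (r⁻¹ * s)) * (X - C (xi r s n))) * ∑ i, EE i i i i
  + ∑ i, ∑ j, (if j ≠ i ∧ j ≠ i.rev then aeval z (aCoeff r s rh sh i j) * EE i j j i else 0)
  + aeval z (C (1 - r⁻¹ * s) * (X - C (xi r s n))) *
      ∑ i, ∑ j, (if j < i ∧ j ≠ i.rev then EE i i j j else 0)
  + aeval z (C (1 - r⁻¹ * s) * X * (X - C (xi r s n))) *
      ∑ i, ∑ j, (if i < j ∧ j ≠ i.rev then EE i i j j else 0)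
  + ∑ i, ∑ j, aeval z (bCoeff r s i j) * EE i.rev j i j.rev

/-- The matrix unit `E_{ij}` as an endomorphism of `V`. -/
noncomputable def unitV (i j : Fin (2 * n)) : Module.End K (V K n) :=
  Matrix.toLin' (Matrix.single i j 1)

/-- The operator `R̂(z)` on `V ⊗ V` for a scalar `z`. -/
noncomputable def Rhat (rh sh : K) (z : K) : Module.End K (V K n ⊗[K] V K n) :=
  RhatIn r s rh sh (fun i j k l => TensorProduct.map (unitV i j) (unitV k l))
    (algebraMap K (Module.End K (V K n ⊗[K] V K n)) z)

/-- The map `V(u) ⊗ V(v) → V(v) ⊗ V(u)`, `(x ⊗ f(u)) ⊗ (y ⊗ g(v)) ↦ (x ⊗ g(v)) ⊗ (y ⊗ f(u))`, which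
leaves the vectors of `V` in place. -/
noncomputable def swapP (K : Type*) [Field K] (n : ℕ) :
    Module.End K ((V K n ⊗[K] P K) ⊗[K] (V K n ⊗[K] P K)) :=
  (TensorProduct.tensorTensorTensorComm K (V K n) (V K n) (P K) (P K)).toLinearMap ∘ₗ
    TensorProduct.map LinearMap.id (TensorProduct.comm K (P K) (P K)).toLinearMap ∘ₗ
    (TensorProduct.tensorTensorTensorComm K (V K n) (P K) (V K n) (P K)).toLinearMap

/-- The operator `R̂(u/v) : V(u) ⊗ V(v) → V(v) ⊗ V(u)` for indeterminates `u`, `v`. -/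
noncomputable def RhatUV (rh sh : K) :
    Module.End K ((V K n ⊗[K] P K) ⊗[K] (V K n ⊗[K] P K)) :=
  swapP K n * RhatIn r s rh sh (A := Module.End K ((V K n ⊗[K] P K) ⊗[K] (V K n ⊗[K] P K)))
    (fun i j k l => TensorProduct.map
      (LinearMap.rTensor (P K) (unitV i j)) (LinearMap.rTensor (P K) (unitV k l)))
    (TensorProduct.map (mulU K n : Module.End K (V K n ⊗[K] P K))
      (↑(mulU K n)⁻¹ : Module.End K (V K n ⊗[K] P K)))

end RMatrix

section YangBaxter

variable {K : Type*} [Field K] {n : ℕ}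

/-- The flip `x ⊗ y ↦ y ⊗ x` on `V ⊗ V`. -/
noncomputable def flip (K : Type*) [Field K] (n : ℕ) : Module.End K (V K n ⊗[K] V K n) :=
  (TensorProduct.comm K (V K n) (V K n)).toLinearMap

/-- `F_{12} = F ⊗ Id` on `(V ⊗ V) ⊗ V`. -/
noncomputable def op12 (F : Module.End K (V K n ⊗[K] V K n)) :
    Module.End K ((V K n ⊗[K] V K n) ⊗[K] V K n) :=
  LinearMap.rTensor (V K n) F

/-- `F_{23} = Id ⊗ F` on `(V ⊗ V) ⊗ V = V ⊗ (V ⊗ V)`. -/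
noncomputable def op23 (F : Module.End K (V K n ⊗[K] V K n)) :
    Module.End K ((V K n ⊗[K] V K n) ⊗[K] V K n) :=
  (TensorProduct.assoc K (V K n) (V K n) (V K n)).symm.toLinearMap ∘ₗ
    LinearMap.lTensor (V K n) F ∘ₗ (TensorProduct.assoc K (V K n) (V K n) (V K n)).toLinearMap

/-- `F_{13} = (Id ⊗ τ) F_{12} (Id ⊗ τ)` for the flip `τ`. -/
noncomputable def op13 (F : Module.End K (V K n ⊗[K] V K n)) :
    Module.End K ((V K n ⊗[K] V K n) ⊗[K] V K n) :=
  op23 (flip K n) * op12 F * op23 (flip K n)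

/-- The operator `R(z) = R̂(z) ∘ τ`. -/
noncomputable def Rmat (r s rh sh : K) (z : K) : Module.End K (V K n ⊗[K] V K n) :=
  Rhat r s rh sh z * flip K n

end YangBaxter

end TwoParamC

/-! Everything rests on the entries of R̂(z) in the basis v_a ⊗ v_b. Weight conservation leaves few
of them: the (a,b),(c,d) entry vanishes unless {a,b} = {c,d} or both pairs are dual, a + b = c + d =
2n+1 (`RNat_of_not_support`).

(a) Since ab = (rs)⁻¹ the scalar c is 1, so ω_0 carries no additional factor. With z = u/v and a
common spectral factor removed, the claim for e_i, i ≠ 0, is that R̂(z) commutes with e_i ⊗ 1 + ω_i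
⊗ e_i, and for e_0 it is R̂(z)(z e_0 ⊗ 1 + ω_0 ⊗ e_0) = (e_0 ⊗ 1 + z ω_0 ⊗ e_0) R̂(z). Entry by
entry these are finite case checks (`RNat_mid`, `RNat_last`, `RNat_zero`). The f_i need no second
check: the transpose of R̂(z) is R̂(z) for the parameters (s⁻¹, r⁻¹) (`RNat_transpose`), and f_i is
a multiple of ω'_i e_iᵀ (`matF_eq`), so transposing the relations for e_i yields those for f_i. All
of this is polynomial in z. Being valid for every scalar of the infinite field K, it is valid for
any z in any algebra in which z commutes with the pairs of matrices (`RhatVia_mul`); this covers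
scalar and indeterminate parameters together (`RhatVia_mul_pairGen`). For indeterminates one also
has to exchange the two Laurent variables and observe that u/v has degree 0 for D and D'.

(b) Put u/v = xX and v/w = yX and let Z be the difference of the two sides of the braid relation, a
polynomial in X with coefficients in End(V ⊗ V ⊗ V). Both sides intertwine the threefold coproducts,
so Z does as well. Let T be a coefficient of Z all of whose predecessors vanish. Comparing
coefficients, T commutes with the actions of e_i and f_i for i ≠ 0, while only one summand of the
coproduct of e_0 survives on each side: T(ω_0 ⊗ ω_0 ⊗ e_0) = (e_0 ⊗ 1 ⊗ 1)T, and similarly for f_0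
(`coeff_mul_eq_of_intertwines`). On v_1 ⊗ v_1 ⊗ v_1 both sides of the braid relation act by the same
product of eigenvalues, so T kills this vector. From it these degenerate operators reach all of V ⊗
V ⊗ V, hence T = 0 (`eq_zero_of_intertwines`). So Z = 0 (`defect_eq_zero`), and X = 1 gives the
braid relation (`Rhat_braid`). Moving flips through it gives the Yang–Baxter equation
(`yangBaxter_of_braid`). -/

namespace TwoParamC

/-! ### Entries of R̂(z), indexed by natural numbers -/

section Entries

variable {K : Type*} [Field K] (r s : K) (n : ℕ)

/-- The coefficient `t_k` for a natural number `k`. -/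
def tNat (k : ℕ) : K := if k ≤ n then s ^ ((k : ℤ) - n - 1) else -r ^ ((n : ℤ) - k)

/-- The two-valued factor of `a_{ij}(z)`. -/
def aNat (i j : ℕ) : K :=
  if (i ≤ n ∧ j ≤ n ∧ i < j) ∨ (n < i ∧ n < j ∧ j < i) ∨ (i ≤ n ∧ n < j ∧ 2 * n + 1 < i + j) ∨
    (n < i ∧ j ≤ n ∧ i + j < 2 * n + 1) then r⁻¹ else s

/-- The value of `b_{ij}(z)`. -/
def bNat (z : K) (i j : ℕ) : K :=
  if j = i then (r⁻¹ * s * z - xi r s n) * (z - 1)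
  else if i < j then
    (r⁻¹ * s - 1) * (xi r s n * tNat r s n i * (tNat r s n j)⁻¹ * (z - 1) -
      if i + j = 2 * n + 1 then z - xi r s n else 0)
  else
    (r⁻¹ * s - 1) * z * (tNat r s n i * (tNat r s n j)⁻¹ * (z - 1) -
      if i + j = 2 * n + 1 then z - xi r s n else 0)

/-- The coefficient of `E_{ac} ⊗ E_{bd}` in `R̂(z)`. -/
def RNat (z : K) (a b c d : ℕ) : K :=
  if a + b = 2 * n + 1 then (if c + d = 2 * n + 1 then bNat r s n z b c else 0)
  else if a = b then (if c = a ∧ d = a then (z - r⁻¹ * s) * (z - xi r s n) else 0)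
  else if c = b ∧ d = a then (z - 1) * (z - xi r s n) * aNat r s n a b
  else if c = a ∧ d = b then (1 - r⁻¹ * s) * (z - xi r s n) * (if a < b then z else 1)
  else 0

variable {r s n}

/-- Weight conservation: v_k and v_{2n+1-k} have opposite weights, so two products of basis vectors
have equal weight only if they agree up to order or both have weight zero. -/
theorem RNat_of_not_support (z : K) {a b c d : ℕ} (h : ¬ (a = c ∧ b = d ∨ a = d ∧ b = c ∨
    a + b = 2 * n + 1 ∧ c + d = 2 * n + 1)) : RNat r s n z a b c d = 0 := by
  unfold RNat
  split_ifs <;> first | rfl | omega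

theorem tNat_ne (hr : r ≠ 0) (hs : s ≠ 0) (k : ℕ) : tNat r s n k ≠ 0 := by
  unfold tNat
  split_ifs
  · exact zpow_ne_zero _ hs
  · exact neg_ne_zero.2 (zpow_ne_zero _ hr)

/-- In each half of the index range the t_k form a geometric progression. Neighbouring values thus
become multiples of one another, and only ratios enter b_{ij}(z). -/
theorem tNat_succ_of_lt (hs : s ≠ 0) {k : ℕ} (hk : k < n) :
    tNat r s n (k + 1) = s * tNat r s n k := by
  unfold tNat
  rw [if_pos (by omega), if_pos (by omega), ← zpow_one_add₀ hs]
  congr 1; push_cast; ring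

theorem tNat_succ_of_gt (hr : r ≠ 0) {k : ℕ} (hk : n < k) :
    tNat r s n (k + 1) = r⁻¹ * tNat r s n k := by
  unfold tNat
  rw [if_neg (by omega), if_neg (by omega), mul_neg, mul_comm, ← zpow_sub_one₀ hr]
  congr 2; push_cast; ring

/-- The eigenvalue of `ω_i` on the `k`-th basis vector, for `1 ≤ i < n`. -/
def wMid (r s : K) (n i k : ℕ) : K :=
  if k = i then r
  else if k = i + 1 then s
  else if k = 2 * n + 1 - i then r⁻¹
  else if k = 2 * n + 1 - (i + 1) then s⁻¹
  else 1

/-- `e_i` maps the `k`-th basis vector to `etaMid n i k` times the preceding one, for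
`1 ≤ i < n`. -/
def etaMid (K : Type*) [Field K] (n i k : ℕ) : K :=
  if k = i + 1 then 1 else if k = 2 * n + 1 - i then -1 else 0

end Entries

end TwoParamC

namespace TwoParamC

/-! ### Commutation with e_i for 1 ≤ i < n -/

section MiddleNodes

variable {K : Type*} [Field K] {r s : K} {n : ℕ}

-- This and the next three lemmas treat the instances of `RNat_mid` in which a term on the left has
-- a nonzero coefficient of e_i (`left` for the first tensor factor, `right` for the second) and a
-- row index equal to its column index, in the same or in the opposite order (`swap`). The column
-- indices are written with a successor so that e_i lowers them without truncated subtraction.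
set_option maxHeartbeats 4000000 in
theorem RNat_mid_left (hr : r ≠ 0) (hs : s ≠ 0) (z : K) {i : ℕ} (hi : 1 ≤ i) (hin : i < n)
    (c d : ℕ) (hc : i = c ∨ 2 * n - i = c) :
    RNat r s n z c (d + 1) c (d + 1) * etaMid K n i (c + 1) +
      wMid r s n i (c + 1) * (RNat r s n z c (d + 1) (c + 1) d * etaMid K n i (d + 1)) =
    RNat r s n z (c + 1) (d + 1) (c + 1) (d + 1) * etaMid K n i (c + 1) +
      wMid r s n i c * (RNat r s n z c ((d + 1) + 1) (c + 1) (d + 1) * etaMid K n i ((d + 1) + 1)) := by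
  have hT := fun k => tNat_ne (n := n) hr hs k
  -- All conditions depend only on where the free index lies relative to i, i+1, their duals 2n+1-i
  -- and 2n-i, and the middle n. Each of these positions leaves a rational identity in r, s, z, ξ
  -- and the t_k.
  rcases hc with rfl | rfl <;>
  rcases (by omega : d + 1 < i ∨ d + 1 = i ∨ d + 1 = i + 1 ∨ (i + 1 < d + 1 ∧ d + 1 ≤ n) ∨ (n < d + 1 ∧ d + 1 < 2 * n - i) ∨
      d + 1 = 2 * n - i ∨ d + 1 = 2 * n - i + 1 ∨ (2 * n - i + 1 < d + 1 ∧ 2 ≤ d + 1))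
    with h | h | h | h | h | h | h | h <;>
  unfold RNat etaMid wMid <;>
  simp (disch := omega) only [↓if_pos, ↓if_neg, aNat, bNat, mul_zero, zero_mul, add_zero, zero_add,
    mul_one, sub_zero, tNat_succ_of_lt hs, tNat_succ_of_gt hr] <;>
  first | ring1 | (field_simp [hT]; done) | (field_simp [hT]; ring1)

set_option maxHeartbeats 4000000 in
theorem RNat_mid_left_swap (hr : r ≠ 0) (hs : s ≠ 0) (z : K) {i : ℕ} (hi : 1 ≤ i) (hin : i < n)
    (c d : ℕ) (hc : i = c ∨ 2 * n - i = c) :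
    RNat r s n z (d + 1) c c (d + 1) * etaMid K n i (c + 1) +
      wMid r s n i (c + 1) * (RNat r s n z (d + 1) c (c + 1) d * etaMid K n i (d + 1)) =
    RNat r s n z ((d + 1) + 1) c (c + 1) (d + 1) * etaMid K n i ((d + 1) + 1) +
      wMid r s n i (d + 1) * (RNat r s n z (d + 1) (c + 1) (c + 1) (d + 1) * etaMid K n i (c + 1)) := by
  have hT := fun k => tNat_ne (n := n) hr hs k
  rcases hc with rfl | rfl <;>
  rcases (by omega : d + 1 < i ∨ d + 1 = i ∨ d + 1 = i + 1 ∨ (i + 1 < d + 1 ∧ d + 1 ≤ n) ∨ (n < d + 1 ∧ d + 1 < 2 * n - i) ∨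
      d + 1 = 2 * n - i ∨ d + 1 = 2 * n - i + 1 ∨ (2 * n - i + 1 < d + 1 ∧ 2 ≤ d + 1))
    with h | h | h | h | h | h | h | h <;>
  unfold RNat etaMid wMid <;>
  simp (disch := omega) only [↓if_pos, ↓if_neg, aNat, bNat, mul_zero, zero_mul, add_zero, zero_add,
    mul_one, sub_zero, tNat_succ_of_lt hs, tNat_succ_of_gt hr] <;>
  first | ring1 | (field_simp [hT]; done) | (field_simp [hT]; ring1)

set_option maxHeartbeats 4000000 in
theorem RNat_mid_right (hr : r ≠ 0) (hs : s ≠ 0) (z : K) {i : ℕ} (hi : 1 ≤ i) (hin : i < n)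
    (c d : ℕ) (hd : i = d ∨ 2 * n - i = d) :
    RNat r s n z (c + 1) d c (d + 1) * etaMid K n i (c + 1) +
      wMid r s n i (c + 1) * (RNat r s n z (c + 1) d (c + 1) d * etaMid K n i (d + 1)) =
    RNat r s n z ((c + 1) + 1) d (c + 1) (d + 1) * etaMid K n i ((c + 1) + 1) +
      wMid r s n i (c + 1) * (RNat r s n z (c + 1) (d + 1) (c + 1) (d + 1) * etaMid K n i (d + 1)) := by
  have hT := fun k => tNat_ne (n := n) hr hs k
  rcases hd with rfl | rfl <;>
  rcases (by omega : c + 1 < i ∨ c + 1 = i ∨ c + 1 = i + 1 ∨ (i + 1 < c + 1 ∧ c + 1 ≤ n) ∨ (n < c + 1 ∧ c + 1 < 2 * n - i) ∨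
      c + 1 = 2 * n - i ∨ c + 1 = 2 * n - i + 1 ∨ (2 * n - i + 1 < c + 1 ∧ 2 ≤ c + 1))
    with h | h | h | h | h | h | h | h <;>
  unfold RNat etaMid wMid <;>
  simp (disch := omega) only [↓if_pos, ↓if_neg, aNat, bNat, mul_zero, zero_mul, add_zero, zero_add,
    mul_one, sub_zero, tNat_succ_of_lt hs, tNat_succ_of_gt hr] <;>
  first | ring1 | (field_simp [hT]; done) | (field_simp [hT]; ring1)

set_option maxHeartbeats 4000000 in
theorem RNat_mid_right_swap (hr : r ≠ 0) (hs : s ≠ 0) (z : K) {i : ℕ} (hi : 1 ≤ i) (hin : i < n)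
    (c d : ℕ) (hd : i = d ∨ 2 * n - i = d) :
    RNat r s n z d (c + 1) c (d + 1) * etaMid K n i (c + 1) +
      wMid r s n i (c + 1) * (RNat r s n z d (c + 1) (c + 1) d * etaMid K n i (d + 1)) =
    RNat r s n z (d + 1) (c + 1) (c + 1) (d + 1) * etaMid K n i (d + 1) +
      wMid r s n i d * (RNat r s n z d ((c + 1) + 1) (c + 1) (d + 1) * etaMid K n i ((c + 1) + 1)) := by
  have hT := fun k => tNat_ne (n := n) hr hs k
  rcases hd with rfl | rfl <;>
  rcases (by omega : c + 1 < i ∨ c + 1 = i ∨ c + 1 = i + 1 ∨ (i + 1 < c + 1 ∧ c + 1 ≤ n) ∨ (n < c + 1 ∧ c + 1 < 2 * n - i) ∨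
      c + 1 = 2 * n - i ∨ c + 1 = 2 * n - i + 1 ∨ (2 * n - i + 1 < c + 1 ∧ 2 ≤ c + 1))
    with h | h | h | h | h | h | h | h <;>
  unfold RNat etaMid wMid <;>
  simp (disch := omega) only [↓if_pos, ↓if_neg, aNat, bNat, mul_zero, zero_mul, add_zero, zero_add,
    mul_one, sub_zero, tNat_succ_of_lt hs, tNat_succ_of_gt hr] <;>
  first | ring1 | (field_simp [hT]; done) | (field_simp [hT]; ring1)

-- Here e_i brings the column into a dual pair while the row is an arbitrary dual pair, so whole
-- columns of the block b_{ij}(z) are compared. The next lemma is the counterpart with the roles of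
-- rows and columns exchanged.
set_option maxHeartbeats 4000000 in
theorem RNat_mid_dual_col (hr : r ≠ 0) (hs : s ≠ 0) (z : K) {i : ℕ} (hi : 1 ≤ i) (hin : i < n)
    (a b c d : ℕ) (hab : a + b = 2 * n + 1)
    (hcd : i = c ∧ 2 * n - i = d ∨ 2 * n - i = c ∧ i = d) :
    RNat r s n z a b c (d + 1) * etaMid K n i (c + 1) +
      wMid r s n i (c + 1) * (RNat r s n z a b (c + 1) d * etaMid K n i (d + 1)) =
    RNat r s n z (a + 1) b (c + 1) (d + 1) * etaMid K n i (a + 1) +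
      wMid r s n i a * (RNat r s n z a (b + 1) (c + 1) (d + 1) * etaMid K n i (b + 1)) := by
  have hT := fun k => tNat_ne (n := n) hr hs k
  -- Once a is located, b = 2n+1-a is one of these indices, though under another expression. The
  -- implications bring the values t_b to a common form so that they cancel.
  have h1 : b = i → tNat r s n b = tNat r s n i := congrArg _
  have h2 : b = i + 1 → tNat r s n b = tNat r s n (i + 1) := congrArg _
  have h3 : b = 2 * n - i → tNat r s n b = tNat r s n (2 * n - i) := congrArg _
  have h4 : b = 2 * n - i + 1 → tNat r s n b = tNat r s n (2 * n - i + 1) := congrArg _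
  rcases hcd with ⟨rfl, rfl⟩ | ⟨rfl, rfl⟩ <;>
  rcases (by omega : a < i ∨ a = i ∨ a = i + 1 ∨ (i + 1 < a ∧ a ≤ n) ∨ (n < a ∧ a < 2 * n - i) ∨
      a = 2 * n - i ∨ a = 2 * n - i + 1 ∨ (2 * n - i + 1 < a ∧ 2 ≤ a))
    with h | h | h | h | h | h | h | h <;>
  unfold RNat etaMid wMid <;>
  simp (disch := omega) only [↓if_pos, ↓if_neg, aNat, bNat, mul_zero, zero_mul, add_zero, zero_add,
    mul_one, sub_zero, tNat_succ_of_lt hs, tNat_succ_of_gt hr, h1, h2, h3, h4] <;>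
  first | ring1 | (field_simp [hT]; done) | (field_simp [hT]; ring1)

set_option maxHeartbeats 4000000 in
theorem RNat_mid_dual_row (hr : r ≠ 0) (hs : s ≠ 0) (z : K) {i : ℕ} (hi : 1 ≤ i) (hin : i < n)
    (a b c d : ℕ) (hcd : c + 1 + (d + 1) = 2 * n + 1)
    (hab : i = a ∧ 2 * n - i = b ∨ 2 * n - i = a ∧ i = b) :
    RNat r s n z a b c (d + 1) * etaMid K n i (c + 1) +
      wMid r s n i (c + 1) * (RNat r s n z a b (c + 1) d * etaMid K n i (d + 1)) =
    RNat r s n z (a + 1) b (c + 1) (d + 1) * etaMid K n i (a + 1) +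
      wMid r s n i a * (RNat r s n z a (b + 1) (c + 1) (d + 1) * etaMid K n i (b + 1)) := by
  have hT := fun k => tNat_ne (n := n) hr hs k
  have h1 : i = c → tNat r s n i = tNat r s n c := congrArg _
  have h2 : i = c + 1 → tNat r s n i = tNat r s n (c + 1) := congrArg _
  have h3 : 2 * n - i = c → tNat r s n (2 * n - i) = tNat r s n c := congrArg _
  have h4 : 2 * n - i = c + 1 → tNat r s n (2 * n - i) = tNat r s n (c + 1) := congrArg _
  rcases hab with ⟨rfl, rfl⟩ | ⟨rfl, rfl⟩ <;>
  rcases (by omega : (c + 1) < i ∨ (c + 1) = i ∨ (c + 1) = i + 1 ∨ (i + 1 < (c + 1) ∧ (c + 1) ≤ n) ∨ (n < (c + 1) ∧ (c + 1) < 2 * n - i) ∨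
      (c + 1) = 2 * n - i ∨ (c + 1) = 2 * n - i + 1 ∨ (2 * n - i + 1 < (c + 1) ∧ 2 ≤ (c + 1)))
    with h | h | h | h | h | h | h | h <;>
  unfold RNat etaMid wMid <;>
  simp (disch := omega) only [↓if_pos, ↓if_neg, aNat, bNat, mul_zero, zero_mul, add_zero, zero_add,
    mul_one, sub_zero, tNat_succ_of_lt hs, tNat_succ_of_gt hr, h1, h2, h3, h4] <;>
  first | ring1 | (field_simp [hT]; done) | (field_simp [hT]; ring1)

theorem RNat_mul_etaMid_eq_zero (z : K) {a b c d i k : ℕ} (hin : i < n)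
    (h : (i = k ∨ 2 * n - i = k) → ¬ (a = c ∧ b = d ∨ a = d ∧ b = c ∨
      a + b = 2 * n + 1 ∧ c + d = 2 * n + 1)) :
    RNat r s n z a b c d * etaMid K n i (k + 1) = 0 := by
  by_cases hk : i = k ∨ 2 * n - i = k
  · rw [RNat_of_not_support z (h hk), zero_mul]
  · rw [etaMid, if_neg (by omega), if_neg (by omega), mul_zero]

/-- This is the (a, b), (c+1, d+1) entry of the commutation of R̂(z) with e_i ⊗ 1 + ω_i ⊗ e_i. The
four terms are the ways e_i can lower a column index or raise a row index. -/
theorem RNat_mid (hr : r ≠ 0) (hs : s ≠ 0) (z : K) {i : ℕ} (hi : 1 ≤ i) (hin : i < n)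
    (a b c d : ℕ) :
    RNat r s n z a b c (d + 1) * etaMid K n i (c + 1) +
      wMid r s n i (c + 1) * (RNat r s n z a b (c + 1) d * etaMid K n i (d + 1)) =
    RNat r s n z (a + 1) b (c + 1) (d + 1) * etaMid K n i (a + 1) +
      wMid r s n i a * (RNat r s n z a (b + 1) (c + 1) (d + 1) * etaMid K n i (b + 1)) := by
  by_cases h1 : (i = c ∨ 2 * n - i = c) ∧ a = c ∧ b = d + 1
  · obtain ⟨h, rfl, rfl⟩ := h1
    exact RNat_mid_left hr hs z hi hin _ _ h
  by_cases h2 : (i = c ∨ 2 * n - i = c) ∧ a = d + 1 ∧ b = c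
  · obtain ⟨h, rfl, rfl⟩ := h2
    exact RNat_mid_left_swap hr hs z hi hin _ _ h
  by_cases h3 : (i = d ∨ 2 * n - i = d) ∧ a = c + 1 ∧ b = d
  · obtain ⟨h, rfl, rfl⟩ := h3
    exact RNat_mid_right hr hs z hi hin _ _ h
  by_cases h4 : (i = d ∨ 2 * n - i = d) ∧ a = d ∧ b = c + 1
  · obtain ⟨h, rfl, rfl⟩ := h4
    exact RNat_mid_right_swap hr hs z hi hin _ _ h
  by_cases h5 : a + b = 2 * n + 1 ∧ (i = c ∧ 2 * n - i = d ∨ 2 * n - i = c ∧ i = d)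
  · exact RNat_mid_dual_col hr hs z hi hin _ _ _ _ h5.1 h5.2
  by_cases h6 : c + 1 + (d + 1) = 2 * n + 1 ∧ (i = a ∧ 2 * n - i = b ∨ 2 * n - i = a ∧ i = b)
  · exact RNat_mid_dual_row hr hs z hi hin _ _ _ _ h6.1 h6.2
  -- Outside the six families each of the four terms vanishes by itself: either e_i has coefficient
  -- zero at that index or the entry of R̂(z) violates weight conservation.
  have e1 : RNat r s n z a b c (d + 1) * etaMid K n i (c + 1) = 0 := by
    refine RNat_mul_etaMid_eq_zero z hin fun h => ?_
    rintro (h' | h' | ⟨h', h''⟩)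
    · exact h1 ⟨h, h'⟩
    · exact h2 ⟨h, h'⟩
    · exact h5 ⟨h', h.imp (fun h => ⟨h, by omega⟩) (fun h => ⟨h, by omega⟩)⟩
  have e2 : RNat r s n z a b (c + 1) d * etaMid K n i (d + 1) = 0 := by
    refine RNat_mul_etaMid_eq_zero z hin fun h => ?_
    rintro (h' | h' | ⟨h', h''⟩)
    · exact h3 ⟨h, h'⟩
    · exact h4 ⟨h, h'⟩
    · exact h5 ⟨h', h.symm.imp (fun h => ⟨by omega, h⟩) (fun h => ⟨by omega, h⟩)⟩
  have e3 : RNat r s n z (a + 1) b (c + 1) (d + 1) * etaMid K n i (a + 1) = 0 := by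
    refine RNat_mul_etaMid_eq_zero z hin fun h => ?_
    rintro (⟨h', h''⟩ | ⟨h', h''⟩ | ⟨h', h''⟩)
    · exact h1 ⟨h.imp (by omega) (by omega), by omega, h''⟩
    · exact h4 ⟨h.imp (by omega) (by omega), by omega, h''⟩
    · exact h6 ⟨h'', h.imp (fun h => ⟨h, by omega⟩) (fun h => ⟨h, by omega⟩)⟩
  have e4 : RNat r s n z a (b + 1) (c + 1) (d + 1) * etaMid K n i (b + 1) = 0 := by
    refine RNat_mul_etaMid_eq_zero z hin fun h => ?_
    rintro (⟨h', h''⟩ | ⟨h', h''⟩ | ⟨h', h''⟩)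
    · exact h3 ⟨h.imp (by omega) (by omega), h', by omega⟩
    · exact h2 ⟨h.imp (by omega) (by omega), h', by omega⟩
    · exact h6 ⟨h'', h.symm.imp (fun h => ⟨by omega, h⟩) (fun h => ⟨by omega, h⟩)⟩
  rw [e1, e2, e3, e4, mul_zero, mul_zero]

end MiddleNodes

end TwoParamC

namespace TwoParamC

/-! ### Commutation with e_n and with e_0 -/

section EndNodes

variable {K : Type*} [Field K] {r s : K} {n : ℕ}

/-- The eigenvalue of `ω_n` on the `k`-th basis vector. -/
def wLast (r s : K) (n k : ℕ) : K :=
  if k = n then r * s⁻¹ else if k = n + 1 then r⁻¹ * s else if k < n then r⁻¹ * s⁻¹ else r * s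

/-- `e_n` maps the `k`-th basis vector to `etaLast n k` times the preceding one. -/
def etaLast (K : Type*) [Field K] (n k : ℕ) : K := if k = n + 1 then 1 else 0

theorem tNat_self_succ (r : K) {s : K} (hs : s ≠ 0) :
    tNat r s n (n + 1) = -(r⁻¹ * s) * tNat r s n n := by
  unfold tNat
  rw [if_pos le_rfl, if_neg (by omega)]
  have e1 : ((n : ℤ) - (n + 1 : ℕ)) = -1 := by push_cast; ring
  have e2 : ((n : ℤ) - n - 1) = -1 := by ring
  rw [e1, e2, zpow_neg_one, zpow_neg_one, neg_mul, mul_assoc, mul_inv_cancel₀ hs, mul_one]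

/-- All values of t next to the middle are expressed through t_n, where the two progressions meet.
The implications also apply when x is only known to equal n or n-1 by a hypothesis. -/
theorem tNat_near (r : K) {s : K} (hs : s ≠ 0) (x : ℕ) :
    (x + 1 = n → tNat r s n x = s⁻¹ * tNat r s n n) ∧ (x = n → tNat r s n x = tNat r s n n) ∧
    (x = n → tNat r s n (x + 1) = -(r⁻¹ * s) * tNat r s n n) ∧
    (x + 1 = n → tNat r s n (x + 1 + 1) = -(r⁻¹ * s) * tNat r s n n) := by
  refine ⟨?_, congrArg _, ?_, ?_⟩ <;> rintro rfl
  · rw [tNat_succ_of_lt hs (Nat.lt_succ_self x), inv_mul_cancel_left₀ hs]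
  · exact tNat_self_succ r hs
  · exact tNat_self_succ r hs

set_option maxHeartbeats 1000000 in
theorem RNat_last_left (hr : r ≠ 0) (hs : s ≠ 0) (z : K)
    (d : ℕ) :
    RNat r s n z n (d + 1) n (d + 1) * etaLast K n (n + 1) +
      wLast r s n (n + 1) * (RNat r s n z n (d + 1) (n + 1) d * etaLast K n (d + 1)) =
    RNat r s n z (n + 1) (d + 1) (n + 1) (d + 1) * etaLast K n (n + 1) +
      wLast r s n n * (RNat r s n z n ((d + 1) + 1) (n + 1) (d + 1) * etaLast K n ((d + 1) + 1)) := by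
  have hT := fun k => tNat_ne (n := n) hr hs k
  obtain ⟨f1, f2, f3, f4⟩ := tNat_near (n := n) r hs d
  rcases (by omega : d + 1 < n ∨ d + 1 = n ∨ d + 1 = n + 1 ∨ n + 1 < d + 1) with h | h | h | h <;>
  unfold RNat etaLast wLast <;>
  simp (disch := omega) only [↓if_pos, ↓if_neg, aNat, bNat, mul_zero, zero_mul, add_zero, zero_add,
    mul_one, sub_zero, tNat_succ_of_lt hs, tNat_succ_of_gt hr, tNat_self_succ r hs, f1, f2, f3, f4] <;>
  first | ring1 | (field_simp [hT]; done) | (field_simp [hT]; ring1)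

set_option maxHeartbeats 1000000 in
theorem RNat_last_left_swap (hr : r ≠ 0) (hs : s ≠ 0) (z : K)
    (d : ℕ) :
    RNat r s n z (d + 1) n n (d + 1) * etaLast K n (n + 1) +
      wLast r s n (n + 1) * (RNat r s n z (d + 1) n (n + 1) d * etaLast K n (d + 1)) =
    RNat r s n z ((d + 1) + 1) n (n + 1) (d + 1) * etaLast K n ((d + 1) + 1) +
      wLast r s n (d + 1) * (RNat r s n z (d + 1) (n + 1) (n + 1) (d + 1) * etaLast K n (n + 1)) := by
  have hT := fun k => tNat_ne (n := n) hr hs k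
  obtain ⟨f1, f2, f3, f4⟩ := tNat_near (n := n) r hs d
  rcases (by omega : d + 1 < n ∨ d + 1 = n ∨ d + 1 = n + 1 ∨ n + 1 < d + 1) with h | h | h | h <;>
  unfold RNat etaLast wLast <;>
  simp (disch := omega) only [↓if_pos, ↓if_neg, aNat, bNat, mul_zero, zero_mul, add_zero, zero_add,
    mul_one, sub_zero, tNat_succ_of_lt hs, tNat_succ_of_gt hr, tNat_self_succ r hs, f1, f2, f3, f4] <;>
  first | ring1 | (field_simp [hT]; done) | (field_simp [hT]; ring1)

set_option maxHeartbeats 1000000 in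
theorem RNat_last_right (hr : r ≠ 0) (hs : s ≠ 0) (z : K)
    (c : ℕ) :
    RNat r s n z (c + 1) n c (n + 1) * etaLast K n (c + 1) +
      wLast r s n (c + 1) * (RNat r s n z (c + 1) n (c + 1) n * etaLast K n (n + 1)) =
    RNat r s n z ((c + 1) + 1) n (c + 1) (n + 1) * etaLast K n ((c + 1) + 1) +
      wLast r s n (c + 1) * (RNat r s n z (c + 1) (n + 1) (c + 1) (n + 1) * etaLast K n (n + 1)) := by
  have hT := fun k => tNat_ne (n := n) hr hs k
  obtain ⟨f1, f2, f3, f4⟩ := tNat_near (n := n) r hs c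
  rcases (by omega : c + 1 < n ∨ c + 1 = n ∨ c + 1 = n + 1 ∨ n + 1 < c + 1) with h | h | h | h <;>
  unfold RNat etaLast wLast <;>
  simp (disch := omega) only [↓if_pos, ↓if_neg, aNat, bNat, mul_zero, zero_mul, add_zero, zero_add,
    mul_one, sub_zero, tNat_succ_of_lt hs, tNat_succ_of_gt hr, tNat_self_succ r hs, f1, f2, f3, f4] <;>
  first | ring1 | (field_simp [hT]; done) | (field_simp [hT]; ring1)

set_option maxHeartbeats 1000000 in
theorem RNat_last_right_swap (hr : r ≠ 0) (hs : s ≠ 0) (z : K)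
    (c : ℕ) :
    RNat r s n z n (c + 1) c (n + 1) * etaLast K n (c + 1) +
      wLast r s n (c + 1) * (RNat r s n z n (c + 1) (c + 1) n * etaLast K n (n + 1)) =
    RNat r s n z (n + 1) (c + 1) (c + 1) (n + 1) * etaLast K n (n + 1) +
      wLast r s n n * (RNat r s n z n ((c + 1) + 1) (c + 1) (n + 1) * etaLast K n ((c + 1) + 1)) := by
  have hT := fun k => tNat_ne (n := n) hr hs k
  obtain ⟨f1, f2, f3, f4⟩ := tNat_near (n := n) r hs c
  rcases (by omega : c + 1 < n ∨ c + 1 = n ∨ c + 1 = n + 1 ∨ n + 1 < c + 1) with h | h | h | h <;>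
  unfold RNat etaLast wLast <;>
  simp (disch := omega) only [↓if_pos, ↓if_neg, aNat, bNat, mul_zero, zero_mul, add_zero, zero_add,
    mul_one, sub_zero, tNat_succ_of_lt hs, tNat_succ_of_gt hr, tNat_self_succ r hs, f1, f2, f3, f4] <;>
  first | ring1 | (field_simp [hT]; done) | (field_simp [hT]; ring1)

set_option maxHeartbeats 1000000 in
theorem RNat_last_dual_col (hr : r ≠ 0) (hs : s ≠ 0) (z : K)
    (a b : ℕ) (hab : a + b = 2 * n + 1) :
    RNat r s n z a b n (n + 1) * etaLast K n (n + 1) +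
      wLast r s n (n + 1) * (RNat r s n z a b (n + 1) n * etaLast K n (n + 1)) =
    RNat r s n z (a + 1) b (n + 1) (n + 1) * etaLast K n (a + 1) +
      wLast r s n a * (RNat r s n z a (b + 1) (n + 1) (n + 1) * etaLast K n (b + 1)) := by
  have hT := fun k => tNat_ne (n := n) hr hs k
  have h1 : b = n → tNat r s n b = tNat r s n n := congrArg _
  have h2 : b = n + 1 → tNat r s n b = tNat r s n (n + 1) := congrArg _
  rcases (by omega : a < n ∨ a = n ∨ a = n + 1 ∨ n + 1 < a) with h | h | h | h <;>
  unfold RNat etaLast wLast <;>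
  simp (disch := omega) only [↓if_pos, ↓if_neg, aNat, bNat, mul_zero, zero_mul, add_zero, zero_add,
    mul_one, sub_zero, tNat_succ_of_lt hs, tNat_succ_of_gt hr, tNat_self_succ r hs, h1, h2] <;>
  first | ring1 | (field_simp [hT]; done) | (field_simp [hT]; ring1)

set_option maxHeartbeats 1000000 in
theorem RNat_last_dual_row (hr : r ≠ 0) (hs : s ≠ 0) (z : K)
    (c d : ℕ) (hcd : c + 1 + (d + 1) = 2 * n + 1) :
    RNat r s n z n n c (d + 1) * etaLast K n (c + 1) +
      wLast r s n (c + 1) * (RNat r s n z n n (c + 1) d * etaLast K n (d + 1)) =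
    RNat r s n z (n + 1) n (c + 1) (d + 1) * etaLast K n (n + 1) +
      wLast r s n n * (RNat r s n z n (n + 1) (c + 1) (d + 1) * etaLast K n (n + 1)) := by
  have hT := fun k => tNat_ne (n := n) hr hs k
  obtain ⟨f1, f2, f3, f4⟩ := tNat_near (n := n) r hs c
  rcases (by omega : c + 1 < n ∨ c + 1 = n ∨ c + 1 = n + 1 ∨ n + 1 < c + 1) with h | h | h | h <;>
  unfold RNat etaLast wLast <;>
  simp (disch := omega) only [↓if_pos, ↓if_neg, aNat, bNat, mul_zero, zero_mul, add_zero, zero_add,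
    mul_one, sub_zero, tNat_succ_of_lt hs, tNat_succ_of_gt hr, tNat_self_succ r hs, f1, f2, f3, f4] <;>
  first | ring1 | (field_simp [hT]; done) | (field_simp [hT]; ring1)

theorem RNat_mul_etaLast_eq_zero (z : K) {a b c d k : ℕ}
    (h : n = k → ¬ (a = c ∧ b = d ∨ a = d ∧ b = c ∨
      a + b = 2 * n + 1 ∧ c + d = 2 * n + 1)) :
    RNat r s n z a b c d * etaLast K n (k + 1) = 0 := by
  by_cases hk : n = k
  · rw [RNat_of_not_support z (h hk), zero_mul]
  · rw [etaLast, if_neg (by omega), mul_zero]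

/-- The argument of `RNat_mid` again; since e_n only maps v_{n+1} to v_n, there is one active index
in each family. -/
theorem RNat_last (hr : r ≠ 0) (hs : s ≠ 0) (z : K) (a b c d : ℕ) :
    RNat r s n z a b c (d + 1) * etaLast K n (c + 1) +
      wLast r s n (c + 1) * (RNat r s n z a b (c + 1) d * etaLast K n (d + 1)) =
    RNat r s n z (a + 1) b (c + 1) (d + 1) * etaLast K n (a + 1) +
      wLast r s n a * (RNat r s n z a (b + 1) (c + 1) (d + 1) * etaLast K n (b + 1)) := by
  by_cases h1 : n = c ∧ a = c ∧ b = d + 1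
  · obtain ⟨rfl, rfl, rfl⟩ := h1
    exact RNat_last_left hr hs z _
  by_cases h2 : n = c ∧ a = d + 1 ∧ b = c
  · obtain ⟨rfl, rfl, rfl⟩ := h2
    exact RNat_last_left_swap hr hs z _
  by_cases h3 : n = d ∧ a = c + 1 ∧ b = d
  · obtain ⟨rfl, rfl, rfl⟩ := h3
    exact RNat_last_right hr hs z _
  by_cases h4 : n = d ∧ a = d ∧ b = c + 1
  · obtain ⟨rfl, rfl, rfl⟩ := h4
    exact RNat_last_right_swap hr hs z _
  by_cases h5 : n = c ∧ n = d ∧ a + b = 2 * n + 1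
  · obtain ⟨rfl, rfl, h⟩ := h5
    exact RNat_last_dual_col hr hs z _ _ h
  by_cases h6 : n = a ∧ n = b ∧ c + 1 + (d + 1) = 2 * n + 1
  · obtain ⟨rfl, rfl, h⟩ := h6
    exact RNat_last_dual_row hr hs z _ _ h
  have e1 : RNat r s n z a b c (d + 1) * etaLast K n (c + 1) = 0 := by
    refine RNat_mul_etaLast_eq_zero z fun h => ?_
    rintro (h' | h' | ⟨h', h''⟩)
    · exact h1 ⟨h, h'⟩
    · exact h2 ⟨h, h'⟩
    · exact h5 ⟨h, by omega, h'⟩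
  have e2 : RNat r s n z a b (c + 1) d * etaLast K n (d + 1) = 0 := by
    refine RNat_mul_etaLast_eq_zero z fun h => ?_
    rintro (h' | h' | ⟨h', h''⟩)
    · exact h3 ⟨h, h'⟩
    · exact h4 ⟨h, h'⟩
    · exact h5 ⟨by omega, h, h'⟩
  have e3 : RNat r s n z (a + 1) b (c + 1) (d + 1) * etaLast K n (a + 1) = 0 := by
    refine RNat_mul_etaLast_eq_zero z fun h => ?_
    rintro (⟨h', h''⟩ | ⟨h', h''⟩ | ⟨h', h''⟩)
    · exact h1 ⟨by omega, by omega, h''⟩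
    · exact h4 ⟨by omega, by omega, h''⟩
    · exact h6 ⟨h, by omega, h''⟩
  have e4 : RNat r s n z a (b + 1) (c + 1) (d + 1) * etaLast K n (b + 1) = 0 := by
    refine RNat_mul_etaLast_eq_zero z fun h => ?_
    rintro (⟨h', h''⟩ | ⟨h', h''⟩ | ⟨h', h''⟩)
    · exact h3 ⟨by omega, h', by omega⟩
    · exact h2 ⟨by omega, h', by omega⟩
    · exact h6 ⟨by omega, h, h''⟩
  rw [e1, e2, e3, e4, mul_zero, mul_zero]

/-- The eigenvalue of `ω_0` on the `k`-th basis vector, for `c = 1`. -/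
def wZero (r s : K) (n k : ℕ) : K :=
  if k = 1 then r⁻¹ * s else if k = 2 * n then r * s⁻¹ else if k ≤ n then r⁻¹ * s⁻¹ else r * s

/-- The only place where the value of ξ matters for the intertwining identities. The checks for e_1,
…, e_n treat ξ as an unknown; e_0 joins the two ends of the basis and ties ξ to t_{2n}/t_1. -/
theorem tNat_two_mul (hr : r ≠ 0) (hs : s ≠ 0) (hn : 2 ≤ n) :
    tNat r s n (2 * n) = -(xi r s n * r * s⁻¹) * tNat r s n 1 := by
  unfold tNat xi
  rw [if_neg (by omega), if_pos (by omega), neg_mul, ← zpow_neg_one s,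
    show ∀ a b c d e : K, a * b * c * d * e = (a * c) * (b * d * e) from fun _ _ _ _ _ => by ring,
    ← zpow_add_one₀ hr, ← zpow_add₀ hs, ← zpow_add₀ hs]
  have e1 : ((n : ℤ) - (2 * n : ℕ)) = -(n : ℤ) - 1 + 1 := by push_cast; ring
  have e2 : ((n : ℤ) + 1 + -1 + ((1 : ℕ) - n - 1)) = 0 := by push_cast; ring
  rw [e1, e2, zpow_zero, mul_one]


-- The six families for e_0 follow. Conditions such as `1 = 1` are what the substitutions in
-- `RNat_zero` leave behind, so the statements are kept in that form.
set_option maxHeartbeats 1000000 in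
theorem RNat_zero_left (hr : r ≠ 0) (hs : s ≠ 0) (z : K) (hn : 2 ≤ n)
    {d : ℕ} (h1 : 1 ≤ d) (h2 : d ≤ 2 * n) :
    z * (RNat r s n z (2 * n) d (2 * n) d * if 1 = 1 then 1 else 0) +
      wZero r s n 1 * (RNat r s n z (2 * n) d 1 (2 * n) * if d = 1 then 1 else 0) =
    RNat r s n z 1 d 1 d * (if (2 * n) = 2 * n then 1 else 0) +
      z * (wZero r s n (2 * n) * (RNat r s n z (2 * n) 1 1 d * if d = 2 * n then 1 else 0)) := by
  have hT := fun k => tNat_ne (n := n) hr hs k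
  have hx : xi r s n ≠ 0 := mul_ne_zero (zpow_ne_zero _ hr) (zpow_ne_zero _ hs)
  have e1 : d = 1 → tNat r s n d = tNat r s n 1 := congrArg _
  have e2 : d = 2 * n → tNat r s n d = tNat r s n (2 * n) := congrArg _
  rcases (by omega : d = 1 ∨ (1 < d ∧ d ≤ n) ∨ (n < d ∧ d < 2 * n) ∨ d = 2 * n) with h | h | h | h <;>
  unfold RNat wZero <;>
  simp (disch := omega) only [↓if_pos, ↓if_neg, aNat, bNat, mul_zero, zero_mul, add_zero, zero_add,
    mul_one, sub_zero, tNat_two_mul hr hs hn, e1, e2] <;>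
  first | ring1 | (field_simp [hT]; done) | (field_simp [hT]; ring1)

set_option maxHeartbeats 1000000 in
theorem RNat_zero_left_swap (hr : r ≠ 0) (hs : s ≠ 0) (z : K) (hn : 2 ≤ n)
    {d : ℕ} (h1 : 1 ≤ d) (h2 : d ≤ 2 * n) :
    z * (RNat r s n z d (2 * n) (2 * n) d * if 1 = 1 then 1 else 0) +
      wZero r s n 1 * (RNat r s n z d (2 * n) 1 (2 * n) * if d = 1 then 1 else 0) =
    RNat r s n z 1 (2 * n) 1 d * (if d = 2 * n then 1 else 0) +
      z * (wZero r s n d * (RNat r s n z d 1 1 d * if (2 * n) = 2 * n then 1 else 0)) := by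
  have hT := fun k => tNat_ne (n := n) hr hs k
  have hx : xi r s n ≠ 0 := mul_ne_zero (zpow_ne_zero _ hr) (zpow_ne_zero _ hs)
  have e1 : d = 1 → tNat r s n d = tNat r s n 1 := congrArg _
  have e2 : d = 2 * n → tNat r s n d = tNat r s n (2 * n) := congrArg _
  rcases (by omega : d = 1 ∨ (1 < d ∧ d ≤ n) ∨ (n < d ∧ d < 2 * n) ∨ d = 2 * n) with h | h | h | h <;>
  unfold RNat wZero <;>
  simp (disch := omega) only [↓if_pos, ↓if_neg, aNat, bNat, mul_zero, zero_mul, add_zero, zero_add,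
    mul_one, sub_zero, tNat_two_mul hr hs hn, e1, e2] <;>
  first | ring1 | (field_simp [hT]; done) | (field_simp [hT]; ring1)

set_option maxHeartbeats 1000000 in
theorem RNat_zero_right (hr : r ≠ 0) (hs : s ≠ 0) (z : K) (hn : 2 ≤ n)
    {c : ℕ} (h1 : 1 ≤ c) (h2 : c ≤ 2 * n) :
    z * (RNat r s n z c (2 * n) (2 * n) 1 * if c = 1 then 1 else 0) +
      wZero r s n c * (RNat r s n z c (2 * n) c (2 * n) * if 1 = 1 then 1 else 0) =
    RNat r s n z 1 (2 * n) c 1 * (if c = 2 * n then 1 else 0) +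
      z * (wZero r s n c * (RNat r s n z c 1 c 1 * if (2 * n) = 2 * n then 1 else 0)) := by
  have hT := fun k => tNat_ne (n := n) hr hs k
  have hx : xi r s n ≠ 0 := mul_ne_zero (zpow_ne_zero _ hr) (zpow_ne_zero _ hs)
  have e1 : c = 1 → tNat r s n c = tNat r s n 1 := congrArg _
  have e2 : c = 2 * n → tNat r s n c = tNat r s n (2 * n) := congrArg _
  rcases (by omega : c = 1 ∨ (1 < c ∧ c ≤ n) ∨ (n < c ∧ c < 2 * n) ∨ c = 2 * n) with h | h | h | h <;>
  unfold RNat wZero <;>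
  simp (disch := omega) only [↓if_pos, ↓if_neg, aNat, bNat, mul_zero, zero_mul, add_zero, zero_add,
    mul_one, sub_zero, tNat_two_mul hr hs hn, e1, e2] <;>
  first | ring1 | (field_simp [hT]; done) | (field_simp [hT]; ring1)

set_option maxHeartbeats 1000000 in
theorem RNat_zero_right_swap (hr : r ≠ 0) (hs : s ≠ 0) (z : K) (hn : 2 ≤ n)
    {c : ℕ} (h1 : 1 ≤ c) (h2 : c ≤ 2 * n) :
    z * (RNat r s n z (2 * n) c (2 * n) 1 * if c = 1 then 1 else 0) +
      wZero r s n c * (RNat r s n z (2 * n) c c (2 * n) * if 1 = 1 then 1 else 0) =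
    RNat r s n z 1 c c 1 * (if (2 * n) = 2 * n then 1 else 0) +
      z * (wZero r s n (2 * n) * (RNat r s n z (2 * n) 1 c 1 * if c = 2 * n then 1 else 0)) := by
  have hT := fun k => tNat_ne (n := n) hr hs k
  have hx : xi r s n ≠ 0 := mul_ne_zero (zpow_ne_zero _ hr) (zpow_ne_zero _ hs)
  have e1 : c = 1 → tNat r s n c = tNat r s n 1 := congrArg _
  have e2 : c = 2 * n → tNat r s n c = tNat r s n (2 * n) := congrArg _
  rcases (by omega : c = 1 ∨ (1 < c ∧ c ≤ n) ∨ (n < c ∧ c < 2 * n) ∨ c = 2 * n) with h | h | h | h <;>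
  unfold RNat wZero <;>
  simp (disch := omega) only [↓if_pos, ↓if_neg, aNat, bNat, mul_zero, zero_mul, add_zero, zero_add,
    mul_one, sub_zero, tNat_two_mul hr hs hn, e1, e2] <;>
  first | ring1 | (field_simp [hT]; done) | (field_simp [hT]; ring1)

set_option maxHeartbeats 1000000 in
theorem RNat_zero_dual_col (hr : r ≠ 0) (hs : s ≠ 0) (z : K) (hn : 2 ≤ n)
    {a b : ℕ} (h1 : 1 ≤ a) (h2 : a ≤ 2 * n) (hab : a + b = 2 * n + 1) :
    z * (RNat r s n z a b (2 * n) 1 * if 1 = 1 then 1 else 0) +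
      wZero r s n 1 * (RNat r s n z a b 1 (2 * n) * if 1 = 1 then 1 else 0) =
    RNat r s n z 1 b 1 1 * (if a = 2 * n then 1 else 0) +
      z * (wZero r s n a * (RNat r s n z a 1 1 1 * if b = 2 * n then 1 else 0)) := by
  have hT := fun k => tNat_ne (n := n) hr hs k
  have hx : xi r s n ≠ 0 := mul_ne_zero (zpow_ne_zero _ hr) (zpow_ne_zero _ hs)
  have e1 : b = 1 → tNat r s n b = tNat r s n 1 := congrArg _
  have e2 : b = 2 * n → tNat r s n b = tNat r s n (2 * n) := congrArg _
  rcases (by omega : a = 1 ∨ (1 < a ∧ a ≤ n) ∨ (n < a ∧ a < 2 * n) ∨ a = 2 * n) with h | h | h | h <;>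
  unfold RNat wZero <;>
  simp (disch := omega) only [↓if_pos, ↓if_neg, aNat, bNat, mul_zero, zero_mul, add_zero, zero_add,
    mul_one, sub_zero, tNat_two_mul hr hs hn, e1, e2] <;>
  first | ring1 | (field_simp [hT]; done) | (field_simp [hT]; ring1)

set_option maxHeartbeats 1000000 in
theorem RNat_zero_dual_row (hr : r ≠ 0) (hs : s ≠ 0) (z : K) (hn : 2 ≤ n)
    {c d : ℕ} (h1 : 1 ≤ c) (h2 : c ≤ 2 * n) (hcd : c + d = 2 * n + 1) :
    z * (RNat r s n z (2 * n) (2 * n) (2 * n) d * if c = 1 then 1 else 0) +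
      wZero r s n c * (RNat r s n z (2 * n) (2 * n) c (2 * n) * if d = 1 then 1 else 0) =
    RNat r s n z 1 (2 * n) c d * (if (2 * n) = 2 * n then 1 else 0) +
      z * (wZero r s n (2 * n) * (RNat r s n z (2 * n) 1 c d * if (2 * n) = 2 * n then 1 else 0)) := by
  have hT := fun k => tNat_ne (n := n) hr hs k
  have hx : xi r s n ≠ 0 := mul_ne_zero (zpow_ne_zero _ hr) (zpow_ne_zero _ hs)
  have e1 : c = 1 → tNat r s n c = tNat r s n 1 := congrArg _
  have e2 : c = 2 * n → tNat r s n c = tNat r s n (2 * n) := congrArg _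
  rcases (by omega : c = 1 ∨ (1 < c ∧ c ≤ n) ∨ (n < c ∧ c < 2 * n) ∨ c = 2 * n) with h | h | h | h <;>
  unfold RNat wZero <;>
  simp (disch := omega) only [↓if_pos, ↓if_neg, aNat, bNat, mul_zero, zero_mul, add_zero, zero_add,
    mul_one, sub_zero, tNat_two_mul hr hs hn, e1, e2] <;>
  first | ring1 | (field_simp [hT]; done) | (field_simp [hT]; ring1)

theorem RNat_mul_ite_eq_zero (z : K) {a b c d : ℕ} {p : Prop} [Decidable p]
    (h : p → ¬ (a = c ∧ b = d ∨ a = d ∧ b = c ∨ a + b = 2 * n + 1 ∧ c + d = 2 * n + 1)) :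
    (RNat r s n z a b c d * if p then 1 else 0) = 0 := by
  split_ifs with hp
  · rw [RNat_of_not_support z (h hp), zero_mul]
  · rw [mul_zero]

/-- This is the (a, b), (c, d) entry of the relation for e_0. The factor z sits on the first summand
of the coproduct on one side and on the second on the other, because R̂ exchanges the spectral
parameters. -/
theorem RNat_zero (hr : r ≠ 0) (hs : s ≠ 0) (z : K) (hn : 2 ≤ n) {a b c d : ℕ}
    (ha : 1 ≤ a) (ha' : a ≤ 2 * n) (hc : 1 ≤ c) (hc' : c ≤ 2 * n) (hd : 1 ≤ d) (hd' : d ≤ 2 * n) :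
    z * (RNat r s n z a b (2 * n) d * if c = 1 then 1 else 0) +
      wZero r s n c * (RNat r s n z a b c (2 * n) * if d = 1 then 1 else 0) =
    RNat r s n z 1 b c d * (if a = 2 * n then 1 else 0) +
      z * (wZero r s n a * (RNat r s n z a 1 c d * if b = 2 * n then 1 else 0)) := by
  by_cases h1 : c = 1 ∧ a = 2 * n ∧ b = d
  · obtain ⟨rfl, rfl, rfl⟩ := h1
    exact RNat_zero_left hr hs z hn hd hd'
  by_cases h2 : c = 1 ∧ a = d ∧ b = 2 * n
  · obtain ⟨rfl, rfl, rfl⟩ := h2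
    exact RNat_zero_left_swap hr hs z hn ha ha'
  by_cases h3 : d = 1 ∧ a = c ∧ b = 2 * n
  · obtain ⟨rfl, rfl, rfl⟩ := h3
    exact RNat_zero_right hr hs z hn ha ha'
  by_cases h4 : d = 1 ∧ a = 2 * n ∧ b = c
  · obtain ⟨rfl, rfl, rfl⟩ := h4
    exact RNat_zero_right_swap hr hs z hn hc hc'
  by_cases h5 : c = 1 ∧ d = 1 ∧ a + b = 2 * n + 1
  · obtain ⟨rfl, rfl, h⟩ := h5
    exact RNat_zero_dual_col hr hs z hn ha ha' h
  by_cases h6 : a = 2 * n ∧ b = 2 * n ∧ c + d = 2 * n + 1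
  · obtain ⟨rfl, rfl, h⟩ := h6
    exact RNat_zero_dual_row hr hs z hn hc hc' h
  have e1 : (RNat r s n z a b (2 * n) d * if c = 1 then 1 else 0) = 0 := by
    refine RNat_mul_ite_eq_zero z fun h => ?_
    rintro (h' | h' | ⟨h', h''⟩)
    · exact h1 ⟨h, h'⟩
    · exact h2 ⟨h, h'⟩
    · exact h5 ⟨h, by omega, h'⟩
  have e2 : (RNat r s n z a b c (2 * n) * if d = 1 then 1 else 0) = 0 := by
    refine RNat_mul_ite_eq_zero z fun h => ?_
    rintro (h' | h' | ⟨h', h''⟩)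
    · exact h3 ⟨h, h'⟩
    · exact h4 ⟨h, h'⟩
    · exact h5 ⟨by omega, h, h'⟩
  have e3 : (RNat r s n z 1 b c d * if a = 2 * n then 1 else 0) = 0 := by
    refine RNat_mul_ite_eq_zero z fun h => ?_
    rintro (⟨h', h''⟩ | ⟨h', h''⟩ | ⟨h', h''⟩)
    · exact h1 ⟨h'.symm, h, h''⟩
    · exact h4 ⟨h'.symm, h, h''⟩
    · exact h6 ⟨h, by omega, h''⟩
  have e4 : (RNat r s n z a 1 c d * if b = 2 * n then 1 else 0) = 0 := by
    refine RNat_mul_ite_eq_zero z fun h => ?_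
    rintro (⟨h', h''⟩ | ⟨h', h''⟩ | ⟨h', h''⟩)
    · exact h3 ⟨h''.symm, h', h⟩
    · exact h2 ⟨h''.symm, h', h⟩
    · exact h6 ⟨by omega, h, h''⟩
  rw [e1, e2, e3, e4, mul_zero, mul_zero, mul_zero, mul_zero]

end EndNodes

end TwoParamC

namespace TwoParamC

open Matrix Kronecker

/-! ### The matrix of R̂(z), its transpose, and the relations for e_i -/

section RMatrixEntries

variable {K : Type*} [Field K] {r s : K} {n : ℕ}

/-- The substitution (r, s) → (s⁻¹, r⁻¹) composed with k → 2n+1-k inverts t up to sign; the sign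
cancels in the ratios t_i/t_j. -/
theorem tNat_rev (k : ℕ) (h : k ≤ 2 * n) :
    tNat s⁻¹ r⁻¹ n (2 * n + 1 - k) = -(tNat r s n k)⁻¹ := by
  unfold tNat
  by_cases h' : k ≤ n
  · rw [if_neg (by omega), if_pos h', _root_.inv_zpow]
    congr 3
    omega
  · rw [if_pos (by omega), if_neg h', _root_.inv_zpow, inv_neg, neg_neg]
    congr 2
    omega

theorem xi_inv (r s : K) (n : ℕ) : xi s⁻¹ r⁻¹ n = xi r s n := by
  unfold xi
  rw [_root_.inv_zpow, _root_.inv_zpow, ← _root_.zpow_neg, ← _root_.zpow_neg, mul_comm]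
  congr 2 <;> ring

/-- The substitution (r, s) → (s⁻¹, r⁻¹) fixes r⁻¹s and ξ and exchanges the two values r⁻¹ and s of
`aNat`. Transposition preserves the diagonal entries, reverses the index order of the exchange
terms, and replaces b_{ij} by the coefficient at the dual pair in reverse order, which `tNat_rev`
matches. It is what makes a separate check for the f_i superfluous. -/
theorem RNat_transpose (z : K) {a b c d : ℕ} (hb' : b ≤ 2 * n) (hc' : c ≤ 2 * n) :
    RNat s⁻¹ r⁻¹ n z c d a b = RNat r s n z a b c d := by
  by_cases h : a + b = 2 * n + 1 ∧ c + d = 2 * n + 1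
  · have e1 : a = 2 * n + 1 - b := by omega
    have e2 : d = 2 * n + 1 - c := by omega
    have t1 := tNat_rev (r := r) (s := s) b hb'
    have t2 := tNat_rev (r := r) (s := s) c hc'
    rw [← e1] at t1
    rw [← e2] at t2
    -- Passing to duals reverses the order, so the case distinctions of `bNat` at (d, a) and at (b,
    -- c) coincide.
    have i1 : (a = d) = (c = b) := propext (by omega)
    have i2 : (d < a) = (b < c) := propext (by omega)
    have i3 : (d + a = 2 * n + 1) = (b + c = 2 * n + 1) := propext (by omega)
    unfold RNat bNat
    simp only [if_pos h.1, if_pos h.2, t1, t2, xi_inv, i1, i2, i3, inv_inv, inv_neg]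
    split_ifs <;> ring
  by_cases h1 : a = c ∧ b = d
  · obtain ⟨rfl, rfl⟩ := h1
    unfold RNat
    rw [xi_inv, inv_inv, mul_comm s]
    split_ifs <;> first | rfl | omega
  by_cases h2 : a = d ∧ b = c
  · obtain ⟨rfl, rfl⟩ := h2
    unfold RNat aNat
    rw [xi_inv, inv_inv, mul_comm s]
    split_ifs <;> first | rfl | omega
  · rw [RNat_of_not_support z (by omega), RNat_of_not_support z (by omega)]

/-- `e_i`, `1 ≤ i ≤ n`, maps the `k`-th basis vector to `etaNat K n i k` times the preceding
one. -/
def etaNat (K : Type*) [Field K] (n i k : ℕ) : K :=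
  if i = n then etaLast K n k else etaMid K n i k

theorem matE_apply (i : Fin (n + 1)) (hi : i ≠ 0) (x y : Fin (2 * n)) :
    matE (K := K) i x y = if (x : ℕ) + 1 = y then etaNat K n i (y + 1) else 0 := by
  have hi' : (i : ℕ) ≠ 0 := fun h => hi (Fin.ext h)
  have := i.2
  have := x.2
  have := y.2
  unfold matE etaNat etaMid etaLast E
  rw [if_neg hi']
  by_cases hn : (i : ℕ) = n
  · simp only [if_pos hn, Matrix.of_apply]
    split_ifs <;> first | rfl | omega
  · simp only [if_neg hn, Matrix.of_apply, Matrix.sub_apply]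
    split_ifs <;> first | omega | simp

theorem weight_pos_node (r s : K) (i : Fin (n + 1)) (hi : i ≠ 0) (x : Fin (2 * n)) :
    weight r s i x = if (i : ℕ) = n then wLast r s n (x + 1) else wMid r s n i (x + 1) := by
  have hi' : (i : ℕ) ≠ 0 := fun h => hi (Fin.ext h)
  unfold weight wLast wMid
  simp only [if_neg hi']

theorem weight_zero_node (r s : K) (x : Fin (2 * n)) :
    weight r s (0 : Fin (n + 1)) x = wZero r s n (x + 1) := by
  unfold weight wZero
  simp

theorem matE_zero_apply (x y : Fin (2 * n)) :
    matE (K := K) (0 : Fin (n + 1)) x y = if (x : ℕ) + 1 = 2 * n ∧ (y : ℕ) + 1 = 1 then 1 else 0 := by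
  simp [matE, E]

theorem sum_mul_matE (i : Fin (n + 1)) (hi : i ≠ 0) (f : ℕ → K) (y : Fin (2 * n)) :
    ∑ x : Fin (2 * n), f (x + 1) * matE i x y = f y * etaNat K n i (y + 1) := by
  have hi' : (i : ℕ) ≠ 0 := fun h => hi (Fin.ext h)
  simp only [matE_apply i hi]
  have hy := y.2
  rcases Nat.eq_zero_or_pos (y : ℕ) with h | h
  -- At v_1 the preceding index 0 does not belong to a basis vector. The formula persists because
  -- the coefficient of e_i at v_1 is zero, whatever value f takes at 0.
  · rw [Finset.sum_eq_zero fun x _ => by rw [if_neg (by omega), mul_zero]]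
    have : etaNat K n i (y + 1) = 0 := by
      unfold etaNat etaLast etaMid
      split_ifs <;> first | rfl | omega
    rw [this, mul_zero]
  · rw [Finset.sum_eq_single (⟨y - 1, by omega⟩ : Fin (2 * n))]
    · rw [if_pos (by simp only; omega)]
      congr 2
      simp only
      omega
    · intro x _ hx
      rw [if_neg (fun h' => hx (Fin.ext (by simp only; omega))), mul_zero]
    · simp

theorem sum_matE_mul (i : Fin (n + 1)) (hi : i ≠ 0) (f : ℕ → K) (x : Fin (2 * n)) :
    ∑ y : Fin (2 * n), matE i x y * f (y + 1) = etaNat K n i (x + 1 + 1) * f (x + 1 + 1) := by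
  have hi' : (i : ℕ) ≠ 0 := fun h => hi (Fin.ext h)
  have hi2 := i.2
  simp only [matE_apply i hi]
  have hx := x.2
  by_cases h : (x : ℕ) + 1 = 2 * n
  · rw [Finset.sum_eq_zero fun y _ => by rw [if_neg (by omega), zero_mul]]
    have : etaNat K n i (x + 1 + 1) = 0 := by
      unfold etaNat etaLast etaMid
      split_ifs <;> first | rfl | omega
    rw [this, zero_mul]
  · rw [Finset.sum_eq_single (⟨x + 1, by omega⟩ : Fin (2 * n))]
    · rw [if_pos (by simp only)]
    · intro y _ hy
      rw [if_neg (fun h' => hy (Fin.ext (by simp only; omega))), zero_mul]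
    · simp

theorem sum_mul_matE_zero (hn : 2 ≤ n) (f : ℕ → K) (y : Fin (2 * n)) :
    ∑ x : Fin (2 * n), f (x + 1) * matE (0 : Fin (n + 1)) x y =
      f (2 * n) * if (y : ℕ) + 1 = 1 then 1 else 0 := by
  simp only [matE_zero_apply]
  rw [Finset.sum_eq_single (⟨2 * n - 1, by omega⟩ : Fin (2 * n))]
  · have : 2 * n - 1 + 1 = 2 * n := by omega
    simp [this]
  · intro x _ hx
    rw [if_neg (fun h' => hx (Fin.ext (by simp only; omega))), mul_zero]
  · simp

theorem sum_matE_zero_mul (hn : 2 ≤ n) (f : ℕ → K) (x : Fin (2 * n)) :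
    ∑ y : Fin (2 * n), matE (0 : Fin (n + 1)) x y * f (y + 1) =
      f 1 * if (x : ℕ) + 1 = 2 * n then 1 else 0 := by
  simp only [matE_zero_apply]
  rw [Finset.sum_eq_single (⟨0, by omega⟩ : Fin (2 * n))]
  · simp [mul_comm]
  · intro y _ hy
    rw [if_neg (fun h' => hy (Fin.ext (by simp only; omega))), zero_mul]
  · simp

/-- The matrix of `R̂(z)`. -/
def RMat (r s : K) (n : ℕ) (z : K) : Matrix (Fin (2 * n) × Fin (2 * n)) (Fin (2 * n) × Fin (2 * n)) K :=
  Matrix.of fun p q => RNat r s n z (p.1 + 1) (p.2 + 1) (q.1 + 1) (q.2 + 1)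

variable {ι : Type*} [Fintype ι] [DecidableEq ι]

theorem mul_kronecker_one_apply (R : Matrix (ι × ι) (ι × ι) K) (A : Matrix ι ι K) (a b c d : ι) :
    (R * (A ⊗ₖ (1 : Matrix ι ι K))) (a, b) (c, d) = ∑ x, R (a, b) (x, d) * A x c := by
  simp only [Matrix.mul_apply, Fintype.sum_prod_type, kroneckerMap_apply, Matrix.one_apply,
    mul_ite, mul_one, mul_zero, Finset.sum_ite_eq', Finset.mem_univ, if_true]

theorem mul_diagonal_kronecker_apply (R : Matrix (ι × ι) (ι × ι) K) (w : ι → K) (A : Matrix ι ι K)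
    (a b c d : ι) :
    (R * (Matrix.diagonal w ⊗ₖ A)) (a, b) (c, d) = w c * ∑ x, R (a, b) (c, x) * A x d := by
  simp only [Matrix.mul_apply, Fintype.sum_prod_type, kroneckerMap_apply, Matrix.diagonal_apply]
  rw [Finset.sum_eq_single c]
  · rw [Finset.mul_sum]
    refine Finset.sum_congr rfl fun x _ => ?_
    rw [if_pos rfl]
    ring
  · intro x _ hx
    refine Finset.sum_eq_zero fun y _ => ?_
    rw [if_neg hx, zero_mul, mul_zero]
  · simp

theorem kronecker_one_mul_apply (R : Matrix (ι × ι) (ι × ι) K) (A : Matrix ι ι K) (a b c d : ι) :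
    ((A ⊗ₖ (1 : Matrix ι ι K)) * R) (a, b) (c, d) = ∑ x, A a x * R (x, b) (c, d) := by
  simp only [Matrix.mul_apply, Fintype.sum_prod_type, kroneckerMap_apply, Matrix.one_apply,
    mul_ite, mul_one, mul_zero, ite_mul, zero_mul, Finset.sum_ite_eq, Finset.mem_univ, if_true]

theorem diagonal_kronecker_mul_apply (R : Matrix (ι × ι) (ι × ι) K) (w : ι → K) (A : Matrix ι ι K)
    (a b c d : ι) :
    ((Matrix.diagonal w ⊗ₖ A) * R) (a, b) (c, d) = w a * ∑ x, A b x * R (a, x) (c, d) := by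
  simp only [Matrix.mul_apply, Fintype.sum_prod_type, kroneckerMap_apply, Matrix.diagonal_apply]
  rw [Finset.sum_eq_single a]
  · rw [Finset.mul_sum]
    refine Finset.sum_congr rfl fun x _ => ?_
    rw [if_pos rfl]
    ring
  · intro x _ hx
    refine Finset.sum_eq_zero fun y _ => ?_
    rw [if_neg (Ne.symm hx), zero_mul, zero_mul]
  · simp

theorem RMat_mul_e (hr : r ≠ 0) (hs : s ≠ 0) (z : K) (i : Fin (n + 1)) (hi : i ≠ 0) :
    RMat r s n z * (matE i ⊗ₖ 1 + Matrix.diagonal (weight r s i) ⊗ₖ matE i) =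
      (matE i ⊗ₖ 1 + Matrix.diagonal (weight r s i) ⊗ₖ matE i) * RMat r s n z := by
  have hi' : (i : ℕ) ≠ 0 := fun h => hi (Fin.ext h)
  have hi2 := i.2
  ext ⟨a, b⟩ ⟨c, d⟩
  rw [mul_add, add_mul, Matrix.add_apply, Matrix.add_apply, mul_kronecker_one_apply,
    mul_diagonal_kronecker_apply, kronecker_one_mul_apply, diagonal_kronecker_mul_apply]
  simp only [RMat, Matrix.of_apply]
  rw [sum_mul_matE i hi fun x => RNat r s n z (a + 1) (b + 1) x (d + 1),
    sum_mul_matE i hi fun x => RNat r s n z (a + 1) (b + 1) (c + 1) x,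
    sum_matE_mul i hi fun x => RNat r s n z x (b + 1) (c + 1) (d + 1),
    sum_matE_mul i hi fun x => RNat r s n z (a + 1) x (c + 1) (d + 1),
    weight_pos_node r s i hi, weight_pos_node r s i hi]
  rw [mul_comm (etaNat K n i _) (RNat _ _ _ _ _ _ _ _), mul_comm (etaNat K n i _) (RNat _ _ _ _ _ _ _ _)]
  unfold etaNat
  by_cases hn : (i : ℕ) = n
  · simp only [if_pos hn]
    exact RNat_last hr hs z _ _ _ _
  · simp only [if_neg hn]
    exact RNat_mid hr hs z (by omega) (by omega) _ _ _ _

/-- On V(u) ⊗ V(v) the operator e_0 carries u in the first summand and v in the second, and on V(v)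
⊗ V(u) conversely; removing the common factor v leaves z = u/v in the two places seen here. -/
theorem RMat_mul_e_zero (hn : 2 ≤ n) (hr : r ≠ 0) (hs : s ≠ 0) (z : K) :
    RMat r s n z * (z • matE (0 : Fin (n + 1)) ⊗ₖ 1 +
        Matrix.diagonal (weight r s (0 : Fin (n + 1))) ⊗ₖ matE (0 : Fin (n + 1))) =
      (matE (0 : Fin (n + 1)) ⊗ₖ 1 +
        z • Matrix.diagonal (weight r s (0 : Fin (n + 1))) ⊗ₖ matE (0 : Fin (n + 1))) *
          RMat r s n z := by
  ext ⟨a, b⟩ ⟨c, d⟩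
  have := a.2
  have := b.2
  have := c.2
  have := d.2
  rw [mul_add, add_mul, Matrix.add_apply, Matrix.add_apply, Matrix.mul_smul, Matrix.smul_mul,
    Matrix.smul_apply, Matrix.smul_apply, mul_kronecker_one_apply,
    mul_diagonal_kronecker_apply, kronecker_one_mul_apply, diagonal_kronecker_mul_apply]
  simp only [RMat, Matrix.of_apply]
  rw [sum_mul_matE_zero hn fun x => RNat r s n z (a + 1) (b + 1) x (d + 1),
    sum_mul_matE_zero hn fun x => RNat r s n z (a + 1) (b + 1) (c + 1) x,
    sum_matE_zero_mul hn fun x => RNat r s n z x (b + 1) (c + 1) (d + 1),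
    sum_matE_zero_mul hn fun x => RNat r s n z (a + 1) x (c + 1) (d + 1),
    weight_zero_node, weight_zero_node]
  exact RNat_zero hr hs z hn (by omega) (by omega) (by omega) (by omega) (by omega) (by omega)

theorem RMat_transpose (z : K) : (RMat r s n z)ᵀ = RMat s⁻¹ r⁻¹ n z := by
  ext ⟨a, b⟩ ⟨c, d⟩
  have := a.2
  have := b.2
  have := c.2
  have := d.2
  exact (RNat_transpose z (by omega) (by omega)).symm

theorem weight_inv (r s : K) (i : Fin (n + 1)) (x : Fin (2 * n)) :
    weight s⁻¹ r⁻¹ i x = (weight s r i x)⁻¹ := by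
  rw [weight_eq, weight_eq, _root_.inv_zpow, _root_.inv_zpow, mul_inv]

theorem weight_dual (hr : r ≠ 0) (hs : s ≠ 0) (i : Fin (n + 1)) (x y : Fin (2 * n))
    (h : (x : ℕ) + 1 + (y + 1) = 2 * n + 1) : weight r s i x * weight r s i y = 1 := by
  have hi := i.2
  have hx := x.2
  have hy := y.2
  unfold weight
  dsimp only
  split_ifs <;> first | omega | field_simp

/-- Weight conservation once more: dual basis vectors have inverse eigenvalues, so all pairs of
weight zero have eigenvalue 1. Leaving p and q free covers ω_i, ω'_i and their inverses. -/
theorem RMat_mul_diagonal {p q : K} (hp : p ≠ 0) (hq : q ≠ 0) (z : K)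
    (i : Fin (n + 1)) :
    RMat r s n z * (Matrix.diagonal (weight p q i) ⊗ₖ Matrix.diagonal (weight p q i)) =
      (Matrix.diagonal (weight p q i) ⊗ₖ Matrix.diagonal (weight p q i)) * RMat r s n z := by
  rw [Matrix.diagonal_kronecker_diagonal]
  ext ⟨a, b⟩ ⟨c, d⟩
  rw [Matrix.mul_diagonal, Matrix.diagonal_mul, mul_comm]
  simp only [RMat, Matrix.of_apply]
  by_cases h1 : a = c ∧ b = d
  · rw [h1.1, h1.2]
  by_cases h2 : a = d ∧ b = c
  · rw [h2.1, h2.2, mul_comm (weight p q i d)]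
  by_cases h3 : (a : ℕ) + 1 + (b + 1) = 2 * n + 1 ∧ (c : ℕ) + 1 + (d + 1) = 2 * n + 1
  · rw [weight_dual hp hq i a b h3.1, weight_dual hp hq i c d h3.2]
  · rw [RNat_of_not_support z, mul_zero, mul_zero]
    rintro (h | h | h)
    · exact h1 ⟨Fin.ext (by omega), Fin.ext (by omega)⟩
    · exact h2 ⟨Fin.ext (by omega), Fin.ext (by omega)⟩
    · exact h3 h

/-- The scalar `g` with `f_i = g ω'_i (e_i)ᵀ`. -/
def fScale (r s : K) (i : Fin (n + 1)) : K :=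
  if i = 0 then r⁻¹ * s else if (i : ℕ) = n then (r * r)⁻¹ else r⁻¹

/-- For each node, ω'_i has one common eigenvalue on the image of e_iᵀ, up to the coefficients built
into f_i, so one scalar suffices. Through this identity the relations for f_i are transposes of
those for e_i. -/
theorem matF_eq (hn : 2 ≤ n) (hr : r ≠ 0) (hs : s ≠ 0) (i : Fin (n + 1)) :
    matF r s i = fScale r s i • (Matrix.diagonal (weight s r i) * (matE i)ᵀ) := by
  ext x y
  have hi := i.2
  have hx := x.2
  have hy := y.2
  rw [Matrix.smul_apply, Matrix.diagonal_mul, Matrix.transpose_apply, smul_eq_mul]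
  by_cases hi0 : i = 0
  · subst hi0
    rw [matE_zero_apply, weight_zero_node, fScale, if_pos rfl, matF, if_pos (Fin.val_zero _), E,
      Matrix.of_apply, wZero]
    split_ifs <;> first | omega | (simp; done) | (field_simp; done)
  have hi' : (i : ℕ) ≠ 0 := fun h => hi0 (Fin.ext h)
  by_cases hin : (i : ℕ) = n
  · simp only [matF, matE, weight, fScale, E, if_neg hi0, if_neg hi', if_pos hin, Matrix.of_apply,
      Matrix.smul_apply, smul_eq_mul]
    split_ifs <;> first | omega | (simp [hr, hs]; done) | (simp [hr, hs, mul_comm]; done) | (field_simp; done)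
  · simp only [matF, matE, weight, fScale, E, if_neg hi0, if_neg hi', if_neg hin, Matrix.of_apply,
      Matrix.smul_apply, Matrix.sub_apply, smul_eq_mul]
    split_ifs <;> first | omega | (simp [hr, hs]; done) | (simp [hr, hs, mul_comm]; done) | (field_simp; done)

end RMatrixEntries

end TwoParamC

namespace TwoParamC

open scoped TensorProduct

/-! ### The operator R̂(z) has the computed matrix -/

section UniversalRMatrix

variable {K : Type*} [Field K] {r s rh sh : K} {n : ℕ}

theorem map_RhatIn {A B : Type*} [Ring A] [Algebra K A] [Ring B] [Algebra K B] (ψ : A →ₐ[K] B)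
    (EE : Fin (2 * n) → Fin (2 * n) → Fin (2 * n) → Fin (2 * n) → A) (z : A) :
    ψ (RhatIn r s rh sh EE z) = RhatIn r s rh sh (fun i j k l => ψ (EE i j k l)) (ψ z) := by
  simp only [RhatIn, map_add, map_mul, map_sum, apply_ite ψ, map_zero, Polynomial.aeval_algHom_apply]

/-- The half-integral powers combine: r^{-1/2}s^{1/2}(rs)^{∓1/2} is r⁻¹ or s. From here on the
square roots enter only through this identification, and their choice is immaterial. -/
theorem aCoeff_eval (hrh : rh ^ 2 = r) (hsh : sh ^ 2 = s) (hr : r ≠ 0) (hs : s ≠ 0) (z : K)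
    (i j : Fin (2 * n)) (h : j ≠ i) (h' : j ≠ i.rev) :
    (aCoeff r s rh sh i j).eval z = (z - 1) * (z - xi r s n) * aNat r s n (i + 1) (j + 1) := by
  have hrh0 : rh ≠ 0 := by rintro rfl; simp at hrh; exact hr hrh.symm
  have hsh0 : sh ≠ 0 := by rintro rfl; simp at hsh; exact hs hsh.symm
  have h1 : (j : ℕ) ≠ i := fun e => h (Fin.ext e)
  have h2 : (j : ℕ) + i + 1 ≠ 2 * n := fun e => h' (Fin.ext (by rw [Fin.val_rev]; omega))
  have hi := i.2
  have hj := j.2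
  have er : rh⁻¹ * sh * (rh * sh)⁻¹ = r⁻¹ := by rw [← hrh]; field_simp
  have es : rh⁻¹ * sh * (rh * sh) = s := by rw [← hsh]; field_simp
  have key : rh⁻¹ * sh * (if (i < j ∧ i < j.rev) ∨ (j < i ∧ j.rev < i) then
      (rh * sh) ^ (-(sgn i * sgn j)) else (rh * sh) ^ (sgn i * sgn j)) =
        aNat r s n (i + 1) (j + 1) := by
    unfold aNat sgn
    simp only [Fin.lt_def, Fin.val_rev]
    split_ifs <;>
    first
      | omega
      | (norm_num; first | exact es | (rw [← mul_inv_rev]; exact er))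
  rw [← key]
  simp only [aCoeff, Polynomial.eval_mul, Polynomial.eval_sub, Polynomial.eval_C, Polynomial.eval_X,
    Polynomial.eval_one]
  ring

theorem bCoeff_eval (z : K) (i j : Fin (2 * n)) :
    (bCoeff r s i j).eval z = bNat r s n z (i + 1) (j + 1) := by
  have ht : ∀ k : Fin (2 * n), tCoeff r s k = tNat r s n (k + 1) := fun k => by
    unfold tCoeff tNat
    push_cast
    rfl
  have hi := i.2
  have hj := j.2
  have e1 : (i = j.rev) = ((i : ℕ) + 1 + (j + 1) = 2 * n + 1) := propext (by
    rw [Fin.ext_iff, Fin.val_rev]; omega)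
  have e2 : (i < j) = ((i : ℕ) + 1 < j + 1) := propext (by rw [Fin.lt_def]; omega)
  have e3 : (j = i) = ((j : ℕ) + 1 = i + 1) := propext (by rw [Fin.ext_iff]; omega)
  unfold bCoeff bNat
  simp only [ht, e1, e2, e3]
  split_ifs <;> simp

theorem sum_sum_eq_apply {M ι : Type*} [AddCommMonoid M] [Fintype ι] (F : ι → ι → M) (a b : ι)
    (h : ∀ i j, ¬ (i = a ∧ j = b) → F i j = 0) : ∑ i, ∑ j, F i j = F a b := by
  rw [Finset.sum_eq_single a, Finset.sum_eq_single b]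
  · exact fun j _ hj => h a j fun h => hj h.2
  · simp
  · exact fun i _ hi => Finset.sum_eq_zero fun j _ => h i j fun h => hi h.1
  · simp

set_option maxHeartbeats 1000000 in
theorem RhatIn_eq_RMat (hrh : rh ^ 2 = r) (hsh : sh ^ 2 = s) (hr : r ≠ 0) (hs : s ≠ 0) (z : K) :
    RhatIn r s rh sh (n := n)
      (fun i j k l => Matrix.single (i, k) (j, l) (1 : K)) (algebraMap K _ z) = RMat r s n z := by
  ext ⟨a, b⟩ ⟨c, d⟩
  have ha := a.2
  have hb := b.2
  have hc := c.2
  have hd := d.2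
  simp only [RhatIn, Polynomial.aeval_algebraMap_apply, Polynomial.coe_aeval_eq_eval,
    ← Algebra.smul_def, Matrix.add_apply, Matrix.smul_apply, Matrix.sum_apply, smul_eq_mul]
  -- In each sum a single pair of indices can hit the given entry. The row (a, b) fixes it in the
  -- first four sums; for E_{i'j} ⊗ E_{ij'} the second row index gives i = b and the first column
  -- index gives j = c.
  rw [sum_sum_eq_apply _ a b, sum_sum_eq_apply _ a b, sum_sum_eq_apply _ a b,
    sum_sum_eq_apply _ b c, Finset.sum_eq_single a]
  rotate_left
  · intro i _ hi
    rw [Matrix.single_apply, if_neg]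
    rintro ⟨h, _⟩
    exact hi (congrArg Prod.fst h)
  · simp
  · intro i j h
    rw [Matrix.single_apply, if_neg, mul_zero]
    rintro ⟨h1, h2⟩
    exact h ⟨congrArg Prod.snd h1, congrArg Prod.fst h2⟩
  · intro i j h
    split_ifs
    · rw [Matrix.single_apply, if_neg]
      rintro ⟨h1, h2⟩
      exact h ⟨congrArg Prod.fst h1, congrArg Prod.snd h1⟩
    · rfl
  · intro i j h
    split_ifs
    · rw [Matrix.single_apply, if_neg]
      rintro ⟨h1, h2⟩
      exact h ⟨congrArg Prod.fst h1, congrArg Prod.snd h1⟩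
    · rfl
  · intro i j h
    split_ifs
    · rw [Matrix.smul_apply, Matrix.single_apply, if_neg, smul_zero]
      rintro ⟨h1, h2⟩
      exact h ⟨congrArg Prod.fst h1, congrArg Prod.snd h1⟩
    · rfl
  have hrev (x y : Fin (2 * n)) : (x = y.rev) = ((y : ℕ) + 1 + (x + 1) = 2 * n + 1) :=
    propext (by rw [Fin.ext_iff, Fin.val_rev]; omega)
  have hrev' (x y : Fin (2 * n)) : (y.rev = x) = ((y : ℕ) + 1 + (x + 1) = 2 * n + 1) :=
    propext (by rw [Fin.ext_iff, Fin.val_rev]; omega)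
  have heq (x y : Fin (2 * n)) : (x = y) = ((x : ℕ) + 1 = y + 1) :=
    propext (by rw [Fin.ext_iff]; omega)
  have hlt (x y : Fin (2 * n)) : (x < y) = ((x : ℕ) + 1 < y + 1) :=
    propext (by rw [Fin.lt_def]; omega)
  rw [bCoeff_eval]
  simp only [RMat, Matrix.of_apply, RNat]
  -- The three cases b = a', b = a and neither are the branches of `RNat`; in each, the side
  -- conditions of the sums remove all but the matching terms.
  by_cases h1 : b = a.rev
  · rw [if_neg fun h => h.2 h1, if_neg fun h => h.2 h1, if_neg fun h => h.2 h1]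
    simp only [Matrix.single_apply, Prod.mk.injEq, hrev, hrev', heq, Matrix.zero_apply, true_and, and_true,
        mul_one, mul_zero, smul_eq_mul, Polynomial.eval_mul, Polynomial.eval_sub, Polynomial.eval_C,
        Polynomial.eval_X] at h1 ⊢
    split_ifs <;> first | omega | ring1
  by_cases h2 : b = a
  · rw [if_neg fun h => h.1 h2, if_neg (by rw [h2]; simp), if_neg (by rw [h2]; simp)]
    simp only [Matrix.single_apply, Prod.mk.injEq, hrev, hrev', heq, Matrix.zero_apply, true_and, and_true,
        mul_one, mul_zero, smul_eq_mul, Polynomial.eval_mul, Polynomial.eval_sub, Polynomial.eval_C,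
        Polynomial.eval_X] at h1 h2 ⊢
    split_ifs <;> first | omega | ring1
  · rw [if_pos ⟨h2, h1⟩, aCoeff_eval hrh hsh hr hs z a b h2 h1]
    by_cases h3 : b < a
    · rw [if_pos ⟨h3, h1⟩, if_neg fun h => lt_asymm h3 h.1]
      simp only [Matrix.single_apply, Prod.mk.injEq, hrev, hrev', heq, hlt, Matrix.zero_apply, true_and, and_true,
        mul_one, mul_zero, smul_eq_mul, Polynomial.eval_mul, Polynomial.eval_sub, Polynomial.eval_C,
        Polynomial.eval_X,
        Matrix.smul_apply] at h1 h2 h3 ⊢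
      split_ifs <;> first | omega | ring1
    · rw [if_neg fun h => h3 h.1, if_pos ⟨lt_of_le_of_ne (not_lt.1 h3) (Ne.symm h2), h1⟩]
      simp only [Matrix.single_apply, Prod.mk.injEq, hrev, hrev', heq, hlt, Matrix.zero_apply, true_and, and_true,
        mul_one, mul_zero, smul_eq_mul, Polynomial.eval_mul, Polynomial.eval_sub, Polynomial.eval_C,
        Polynomial.eval_X,
        Matrix.smul_apply] at h1 h2 h3 ⊢
      split_ifs <;> first | omega | ring1

end UniversalRMatrix

end TwoParamC

namespace TwoParamC

open scoped TensorProduct Kronecker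
open Polynomial

/-! ### Polynomial identities from their scalar values -/

section Specialization

variable {K : Type*} [Field K]

/-- B may be noncommutative with zero divisors, so roots cannot be counted in B. Applying a linear
functional to the coefficients gives a polynomial over the infinite field K, and functionals
separate the points of B. -/
theorem polynomial_eq_zero_of_eval {B : Type*} [Ring B] [Algebra K B] [Infinite K] (p : B[X])
    (h : ∀ c : K, p.eval (algebraMap K B c) = 0) : p = 0 := by
  ext k
  rw [coeff_zero, ← Module.forall_dual_apply_eq_zero_iff K]
  intro l
  set q : K[X] := ∑ k ∈ Finset.range (p.natDegree + 1), C (l (p.coeff k)) * X ^ k with hq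
  have hq0 : q = 0 := by
    refine Polynomial.funext fun c => ?_
    have h1 := congrArg l (h c)
    rw [eval_eq_sum_range, map_sum, map_zero] at h1
    rw [hq, eval_finsetSum, eval_zero, ← h1]
    refine Finset.sum_congr rfl fun k _ => ?_
    rw [← map_pow, ← Algebra.commutes, ← Algebra.smul_def, map_smul, smul_eq_mul, eval_mul, eval_C,
      eval_pow, eval_X, mul_comm]
  by_cases hk : k ∈ Finset.range (p.natDegree + 1)
  · have := congrArg (fun q => q.coeff k) hq0
    simpa [hq, finsetSum_coeff, coeff_C_mul, coeff_X_pow, hk] using this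
  · rw [coeff_eq_zero_of_natDegree_lt (by simpa using hk), map_zero]

end Specialization

/-! ### R̂(z) as a universal polynomial in z -/

section UniversalIntertwining

variable {K : Type*} [Field K] {r s rh sh : K} {n : ℕ}

/-- The Kronecker product, as an isomorphism onto matrices indexed by pairs. -/
noncomputable def kron (K : Type*) [Field K] (n : ℕ) :
    Matrix (Fin (2 * n)) (Fin (2 * n)) K ⊗[K] Matrix (Fin (2 * n)) (Fin (2 * n)) K ≃ₐ[K]
      Matrix (Fin (2 * n) × Fin (2 * n)) (Fin (2 * n) × Fin (2 * n)) K :=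
  (Matrix.kroneckerTMulAlgEquiv (Fin (2 * n)) (Fin (2 * n)) K K K K).trans
    (AlgEquiv.mapMatrix (Algebra.TensorProduct.lid K K))

theorem kron_tmul (A B : Matrix (Fin (2 * n)) (Fin (2 * n)) K) : kron K n (A ⊗ₜ B) = A ⊗ₖ B := by
  ext ⟨a, b⟩ ⟨c, d⟩
  simp [kron]

/-- `R̂(z)` in an algebra that receives a homomorphism from pairs of matrices. -/
noncomputable def RhatVia {A : Type*} [Ring A] [Algebra K A] (r s rh sh : K)
    (Φ : Matrix (Fin (2 * n)) (Fin (2 * n)) K ⊗[K] Matrix (Fin (2 * n)) (Fin (2 * n)) K →ₐ[K] A)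
    (z : A) : A :=
  RhatIn r s rh sh (fun i j k l => Φ (Matrix.single i j 1 ⊗ₜ Matrix.single k l 1)) z

theorem map_RhatVia {A B : Type*} [Ring A] [Algebra K A] [Ring B] [Algebra K B] (ψ : A →ₐ[K] B)
    (Φ : Matrix (Fin (2 * n)) (Fin (2 * n)) K ⊗[K] Matrix (Fin (2 * n)) (Fin (2 * n)) K →ₐ[K] A)
    (z : A) : ψ (RhatVia r s rh sh Φ z) = RhatVia r s rh sh (ψ.comp Φ) (ψ z) :=
  map_RhatIn ψ _ z

theorem kron_RhatVia (hrh : rh ^ 2 = r) (hsh : sh ^ 2 = s) (hr : r ≠ 0) (hs : s ≠ 0) (z : K) :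
    kron K n (RhatVia r s rh sh (AlgHom.id K _) (algebraMap K _ z)) = RMat r s n z := by
  rw [← RhatIn_eq_RMat hrh hsh hr hs]
  refine (map_RhatIn (kron K n).toAlgHom _ _).trans ?_
  congr 1
  · funext i j k l
    refine (kron_tmul _ _).trans ?_
    rw [Matrix.single_kronecker_single, one_mul]
  · exact (kron K n).commutes z

local notation "M₂" => Matrix (Fin (2 * n)) (Fin (2 * n)) K

variable (n) in
/-- The universal `R̂(z)`, a polynomial in `z` with coefficients in `End V ⊗ End V`. -/
noncomputable def RhatPoly (r s rh sh : K) : (M₂ ⊗[K] M₂)[X] :=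
  RhatVia r s rh sh (CAlgHom : M₂ ⊗[K] M₂ →ₐ[K] (M₂ ⊗[K] M₂)[X]) X

/-- Every instance of R̂ is a specialization of one polynomial with coefficients in pairs of
matrices. Evaluation is multiplicative only because z commutes with the image of those coefficients.
-/
theorem eval₂AlgHom_RhatPoly {A : Type*} [Ring A] [Algebra K A] (Φ : M₂ ⊗[K] M₂ →ₐ[K] A) (z : A)
    (hz : ∀ x, Commute (Φ x) z) :
    eval₂AlgHom Φ z hz (RhatPoly n r s rh sh) = RhatVia r s rh sh Φ z := by
  have hX : eval₂AlgHom Φ z hz X = z := eval₂_X _ _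
  refine (map_RhatVia (K := K) (n := n) (A := (M₂ ⊗[K] M₂)[X]) (B := A) (eval₂AlgHom Φ z hz) CAlgHom
    X).trans ?_
  rw [hX]
  congr 1
  exact AlgHom.ext fun x => eval₂_C _ _

variable (n) in
/-- Evaluation of a polynomial with coefficients in `End V ⊗ End V` at a scalar. -/
noncomputable def evalKron (c : K) :
    (M₂ ⊗[K] M₂)[X] →ₐ[K] Matrix (Fin (2 * n) × Fin (2 * n)) (Fin (2 * n) × Fin (2 * n)) K :=
  (kron K n).toAlgHom.comp (eval₂AlgHom (AlgHom.id K (M₂ ⊗[K] M₂)) (algebraMap K _ c)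
    (fun a => (Algebra.commutes c a).symm))

theorem evalKron_RhatPoly (hrh : rh ^ 2 = r) (hsh : sh ^ 2 = s) (hr : r ≠ 0) (hs : s ≠ 0) (c : K) :
    evalKron n c (RhatPoly n r s rh sh) = RMat r s n c := by
  rw [← kron_RhatVia hrh hsh hr hs, ← eval₂AlgHom_RhatPoly (AlgHom.id K (M₂ ⊗[K] M₂))
    (algebraMap K _ c) (fun a => (Algebra.commutes c a).symm)]
  rfl

theorem evalKron_X (c : K) : evalKron n c X = algebraMap K _ c := by
  have h : eval₂AlgHom (AlgHom.id K (M₂ ⊗[K] M₂)) (algebraMap K _ c)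
    (fun a => (Algebra.commutes c a).symm) X = algebraMap K _ c := eval₂_X _ _
  exact (congrArg (kron K n) h).trans ((kron K n).commutes c)

theorem evalKron_C (c : K) (x : M₂ ⊗[K] M₂) : evalKron n c (C x) = kron K n x :=
  congrArg (kron K n) (eval₂_C _ _)

theorem eq_of_evalKron [Infinite K] {p q : (M₂ ⊗[K] M₂)[X]}
    (h : ∀ c : K, evalKron n c p = evalKron n c q) : p = q := by
  rw [← sub_eq_zero]
  refine polynomial_eq_zero_of_eval (K := K) _ fun c => (kron K n).injective ?_
  rw [map_zero]
  refine Eq.trans ?_ (sub_eq_zero.2 (h c))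
  rw [← map_sub]
  rfl

/-- An intertwining property of `R̂(z)` that holds for all scalars `z` holds universally. -/
theorem RhatVia_mul [Infinite K] (hrh : rh ^ 2 = r) (hsh : sh ^ 2 = s) (hr : r ≠ 0) (hs : s ≠ 0)
    {x₀ x₁ y₀ y₁ : M₂ ⊗[K] M₂}
    (h : ∀ z : K, RMat r s n z * (z • kron K n x₁ + kron K n x₀) =
      (kron K n y₀ + z • kron K n y₁) * RMat r s n z)
    {A : Type*} [Ring A] [Algebra K A] (Φ : M₂ ⊗[K] M₂ →ₐ[K] A) (z : A)
    (hz : ∀ x, Commute (Φ x) z) :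
    RhatVia r s rh sh Φ z * (z * Φ x₁ + Φ x₀) = (Φ y₀ + z * Φ y₁) * RhatVia r s rh sh Φ z := by
  -- The identity is established with a free variable, by testing at scalars, and only then
  -- specialized to the given z.
  have key : RhatPoly n r s rh sh * (X * C x₁ + C x₀) =
      (C y₀ + X * C y₁) * RhatPoly n r s rh sh := by
    refine eq_of_evalKron fun c => ?_
    simp only [map_mul, map_add, evalKron_X, evalKron_C, evalKron_RhatPoly hrh hsh hr hs,
      ← Algebra.smul_def]
    exact h c
  have hX : eval₂AlgHom Φ z hz X = z := eval₂_X _ _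
  have hC : ∀ x, eval₂AlgHom Φ z hz (C x) = Φ x := fun x => eval₂_C _ _
  have hΨ := congrArg (eval₂AlgHom Φ z hz) key
  simpa only [map_mul, map_add, hX, hC, eval₂AlgHom_RhatPoly] using hΨ

/-- An eigenvector of all `R̂(z)`, `z` a scalar, is an eigenvector universally. -/
theorem RhatVia_mul_eigen [Infinite K] (hrh : rh ^ 2 = r) (hsh : sh ^ 2 = s) (hr : r ≠ 0)
    (hs : s ≠ 0) {x : M₂ ⊗[K] M₂} {p q : K}
    (h : ∀ z : K, RMat r s n z * kron K n x = ((z - p) * (z - q)) • kron K n x)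
    {A : Type*} [Ring A] [Algebra K A] (Φ : M₂ ⊗[K] M₂ →ₐ[K] A) (z : A)
    (hz : ∀ x, Commute (Φ x) z) :
    RhatVia r s rh sh Φ z * Φ x = (z + algebraMap K A (-p)) * (z + algebraMap K A (-q)) * Φ x := by
  have key : RhatPoly n r s rh sh * C x =
      (X + algebraMap K _ (-p)) * (X + algebraMap K _ (-q)) * C x := by
    refine eq_of_evalKron fun c => ?_
    simp only [map_mul, map_add, evalKron_X, evalKron_C, evalKron_RhatPoly hrh hsh hr hs,
      AlgHom.commutes]
    rw [h, ← map_add, ← map_add, ← map_mul, ← sub_eq_add_neg, ← sub_eq_add_neg, Algebra.smul_def]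
  have hX : eval₂AlgHom Φ z hz X = z := eval₂_X _ _
  have hC : ∀ x, eval₂AlgHom Φ z hz (C x) = Φ x := fun x => eval₂_C _ _
  have hΨ := congrArg (eval₂AlgHom Φ z hz) key
  simpa only [map_mul, map_add, hX, hC, AlgHom.commutes, eval₂AlgHom_RhatPoly] using hΨ

/-- `R̂(z)` commutes with everything that commutes with `z` and with pairs of matrices. -/
theorem RhatVia_commute {A : Type*} [Ring A] [Algebra K A] (S : A) (Φ : M₂ ⊗[K] M₂ →ₐ[K] A) (z : A)
    (hΦ : ∀ x, Commute (Φ x) S) (hz : Commute z S) : Commute (RhatVia r s rh sh Φ z) S := by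
  -- All ingredients of R̂(z) lie in the centralizer of S. Building R̂(z) inside that subalgebra and
  -- including it into A shows that it commutes with S, without expanding the sums.
  have hmem : ∀ {x}, Commute x S → x ∈ Subalgebra.centralizer K {S} := fun {x} hx =>
    (Subalgebra.mem_centralizer_iff K).2 fun g hg => by
      rw [Set.mem_singleton_iff.1 hg]
      exact hx.symm.eq
  have h := map_RhatVia (r := r) (s := s) (rh := rh) (sh := sh) (Subalgebra.centralizer K {S}).val
    (Φ.codRestrict _ fun x => hmem (hΦ x)) ⟨z, hmem hz⟩
  have h2 : (Subalgebra.centralizer K {S}).val.comp (Φ.codRestrict _ fun x => hmem (hΦ x)) = Φ := by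
    apply Algebra.TensorProduct.ext'
    intro x y
    rfl
  rw [h2] at h
  have h3 := (RhatVia r s rh sh (Φ.codRestrict (Subalgebra.centralizer K {S})
    fun x => hmem (hΦ x)) ⟨z, hmem hz⟩).2
  have h4 := (Subalgebra.mem_centralizer_iff K).1 h3 S rfl
  change _ * _ = _ * _
  refine Eq.trans ?_ (h4.symm.trans ?_)
  · exact congrArg (· * S) h.symm
  · exact congrArg (S * ·) h

end UniversalIntertwining

end TwoParamC

namespace TwoParamC

open scoped TensorProduct Kronecker
open Matrix

/-! ### The relations for f_i by transposition -/

section FMatrices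

variable {K : Type*} [Field K] {r s : K} {n : ℕ}

/-- Transpose the relation for e_i at the parameters (s⁻¹, r⁻¹), then multiply by ω'_i ⊗ ω'_i, which
commutes with R̂(z). -/
theorem RMat_mul_f (hn : 2 ≤ n) (hr : r ≠ 0) (hs : s ≠ 0) (z : K) (i : Fin (n + 1)) (hi : i ≠ 0) :
    RMat r s n z * (1 ⊗ₖ matF r s i + matF r s i ⊗ₖ diagonal (weight s r i)) =
      (1 ⊗ₖ matF r s i + matF r s i ⊗ₖ diagonal (weight s r i)) * RMat r s n z := by
  have h := congrArg Matrix.transpose (RMat_mul_e (inv_ne_zero hs) (inv_ne_zero hr) z i hi)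
  have hW := RMat_mul_diagonal (r := r) (s := s) hs hr z i
  set W := diagonal (weight s r i) with hWdef
  have hinv : W * diagonal (weight s⁻¹ r⁻¹ i) = 1 := by
    rw [hWdef, diagonal_mul_diagonal, ← diagonal_one]
    congr 1
    funext x
    rw [weight_inv, mul_inv_cancel₀ (weight_ne s r hs hr i x)]
  -- At (s⁻¹, r⁻¹) the matrix of ω_i is the inverse of W, that of ω'_i. The product therefore has
  -- exactly the shape of the coproduct of f_i.
  have key : (W ⊗ₖ W) * ((matE i)ᵀ ⊗ₖ 1 + diagonal (weight s⁻¹ r⁻¹ i) ⊗ₖ (matE i)ᵀ) =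
      (W * (matE i)ᵀ) ⊗ₖ W + 1 ⊗ₖ (W * (matE i)ᵀ) := by
    rw [mul_add, ← mul_kronecker_mul, ← mul_kronecker_mul, mul_one, hinv]
  rw [transpose_mul, transpose_mul, transpose_add, ← kroneckerMap_transpose,
    ← kroneckerMap_transpose, diagonal_transpose, transpose_one, RMat_transpose, inv_inv,
    inv_inv] at h
  have h2 := congrArg ((W ⊗ₖ W) * ·) h
  rw [← mul_assoc, ← mul_assoc, ← hW, mul_assoc (RMat r s n z), key] at h2
  rw [matF_eq hn hr hs, smul_kronecker, kronecker_smul, ← smul_add, Matrix.mul_smul,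
    Matrix.smul_mul, add_comm, ← hWdef, h2]

/-- As in `RMat_mul_f`. Transposition exchanges the two sides of the relation for e_0, which moves z
onto 1 ⊗ f_0 on the left: f_0 carries inverse spectral parameters. -/
theorem RMat_mul_f_zero (hn : 2 ≤ n) (hr : r ≠ 0) (hs : s ≠ 0) (z : K) :
    RMat r s n z * (z • 1 ⊗ₖ matF r s (0 : Fin (n + 1)) +
        matF r s 0 ⊗ₖ diagonal (weight s r (0 : Fin (n + 1)))) =
      (1 ⊗ₖ matF r s (0 : Fin (n + 1)) +
        z • matF r s 0 ⊗ₖ diagonal (weight s r (0 : Fin (n + 1)))) * RMat r s n z := by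
  have h := congrArg Matrix.transpose
    (RMat_mul_e_zero hn (inv_ne_zero hs) (inv_ne_zero hr) z)
  have hW := RMat_mul_diagonal (r := r) (s := s) hs hr z (0 : Fin (n + 1))
  set W := diagonal (weight s r (0 : Fin (n + 1))) with hWdef
  have hinv : W * diagonal (weight s⁻¹ r⁻¹ (0 : Fin (n + 1))) = 1 := by
    rw [hWdef, diagonal_mul_diagonal, ← diagonal_one]
    congr 1
    funext x
    rw [weight_inv, mul_inv_cancel₀ (weight_ne s r hs hr 0 x)]
  have key : ∀ p q : K, (W ⊗ₖ W) * (p • (matE 0)ᵀ ⊗ₖ 1 +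
      q • diagonal (weight s⁻¹ r⁻¹ (0 : Fin (n + 1))) ⊗ₖ (matE 0)ᵀ) =
      p • (W * (matE 0)ᵀ) ⊗ₖ W + q • 1 ⊗ₖ (W * (matE 0)ᵀ) := fun p q => by
    rw [mul_add, Matrix.mul_smul, Matrix.mul_smul, ← mul_kronecker_mul, ← mul_kronecker_mul,
      mul_one, hinv]
  rw [transpose_mul, transpose_mul, transpose_add, transpose_add, transpose_smul, transpose_smul,
    ← kroneckerMap_transpose, ← kroneckerMap_transpose, diagonal_transpose, transpose_one,
    RMat_transpose, inv_inv, inv_inv] at h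
  have h2 := congrArg ((W ⊗ₖ W) * ·) h
  have k1 := key z 1
  have k2 := key 1 z
  rw [one_smul] at k1 k2
  rw [one_smul] at k1 k2
  rw [← mul_assoc, ← mul_assoc, ← hW, mul_assoc (RMat r s n z), k1, k2] at h2
  rw [matF_eq hn hr hs, smul_kronecker, kronecker_smul, smul_comm z, smul_comm z, ← smul_add,
    ← smul_add, Matrix.mul_smul, Matrix.smul_mul, ← hWdef]
  exact congrArg _ ((congrArg _ (add_comm _ _)).trans
    (h2.symm.trans (congrArg (· * _) (add_comm _ _))))

end FMatrices

/-! ### The intertwining property on generators -/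

section UniversalGenerators

variable {K : Type*} [Field K] {r s rh sh : K} {n : ℕ} {A : Type*} [Ring A] [Algebra K A]

local notation "M₂" => Matrix (Fin (2 * n)) (Fin (2 * n)) K

theorem RhatVia_mul_of_kron [Infinite K] (hrh : rh ^ 2 = r) (hsh : sh ^ 2 = s) (hr : r ≠ 0)
    (hs : s ≠ 0) {x : M₂ ⊗[K] M₂}
    (h : ∀ z : K, RMat r s n z * kron K n x = kron K n x * RMat r s n z)
    (Φ : M₂ ⊗[K] M₂ →ₐ[K] A) (z : A) (hz : ∀ x, Commute (Φ x) z) :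
    RhatVia r s rh sh Φ z * Φ x = Φ x * RhatVia r s rh sh Φ z := by
  have := RhatVia_mul hrh hsh hr hs (x₀ := x) (x₁ := 0) (y₀ := x) (y₁ := 0)
    (fun z => by simpa using h z) Φ z hz
  simpa using this

theorem RhatVia_mul_e [Infinite K] (hrh : rh ^ 2 = r) (hsh : sh ^ 2 = s) (hr : r ≠ 0) (hs : s ≠ 0)
    (Φ : M₂ ⊗[K] M₂ →ₐ[K] A) (z : A) (hz : ∀ x, Commute (Φ x) z)
    (i : Fin (n + 1)) (hi : i ≠ 0) :
    RhatVia r s rh sh Φ z * Φ (matE i ⊗ₜ 1 + diagonal (weight r s i) ⊗ₜ matE i) =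
      Φ (matE i ⊗ₜ 1 + diagonal (weight r s i) ⊗ₜ matE i) * RhatVia r s rh sh Φ z := by
  refine RhatVia_mul_of_kron hrh hsh hr hs (fun z => ?_) Φ z hz
  rw [map_add, kron_tmul, kron_tmul]
  exact RMat_mul_e hr hs z i hi

theorem RhatVia_mul_f [Infinite K] (hn : 2 ≤ n) (hrh : rh ^ 2 = r) (hsh : sh ^ 2 = s) (hr : r ≠ 0)
    (hs : s ≠ 0) (Φ : M₂ ⊗[K] M₂ →ₐ[K] A) (z : A) (hz : ∀ x, Commute (Φ x) z)
    (i : Fin (n + 1)) (hi : i ≠ 0) :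
    RhatVia r s rh sh Φ z * Φ (1 ⊗ₜ matF r s i + matF r s i ⊗ₜ diagonal (weight s r i)) =
      Φ (1 ⊗ₜ matF r s i + matF r s i ⊗ₜ diagonal (weight s r i)) * RhatVia r s rh sh Φ z := by
  refine RhatVia_mul_of_kron hrh hsh hr hs (fun z => ?_) Φ z hz
  rw [map_add, kron_tmul, kron_tmul]
  exact RMat_mul_f hn hr hs z i hi

theorem RhatVia_mul_diagonal [Infinite K] (hrh : rh ^ 2 = r) (hsh : sh ^ 2 = s) (hr : r ≠ 0)
    (hs : s ≠ 0) (Φ : M₂ ⊗[K] M₂ →ₐ[K] A) (z : A)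
    (hz : ∀ x, Commute (Φ x) z) {p q : K} (hp : p ≠ 0) (hq : q ≠ 0) (i : Fin (n + 1)) :
    RhatVia r s rh sh Φ z * Φ (diagonal (weight p q i) ⊗ₜ diagonal (weight p q i)) =
      Φ (diagonal (weight p q i) ⊗ₜ diagonal (weight p q i)) * RhatVia r s rh sh Φ z := by
  refine RhatVia_mul_of_kron hrh hsh hr hs (fun z => ?_) Φ z hz
  rw [kron_tmul]
  exact RMat_mul_diagonal hp hq z i

theorem RhatVia_mul_e_zero [Infinite K] (hn : 2 ≤ n) (hrh : rh ^ 2 = r) (hsh : sh ^ 2 = s)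
    (hr : r ≠ 0) (hs : s ≠ 0) (Φ : M₂ ⊗[K] M₂ →ₐ[K] A) (z : A) (hz : ∀ x, Commute (Φ x) z) :
    RhatVia r s rh sh Φ z * (z * Φ (matE (0 : Fin (n + 1)) ⊗ₜ 1) +
        Φ (diagonal (weight r s (0 : Fin (n + 1))) ⊗ₜ matE (0 : Fin (n + 1)))) =
      (Φ (matE (0 : Fin (n + 1)) ⊗ₜ 1) +
        z * Φ (diagonal (weight r s (0 : Fin (n + 1))) ⊗ₜ matE (0 : Fin (n + 1)))) *
          RhatVia r s rh sh Φ z := by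
  refine RhatVia_mul hrh hsh hr hs (fun z => ?_) Φ z hz
  rw [kron_tmul, kron_tmul]
  exact RMat_mul_e_zero hn hr hs z

theorem RhatVia_mul_f_zero [Infinite K] (hn : 2 ≤ n) (hrh : rh ^ 2 = r) (hsh : sh ^ 2 = s)
    (hr : r ≠ 0) (hs : s ≠ 0) (Φ : M₂ ⊗[K] M₂ →ₐ[K] A) (z : A) (hz : ∀ x, Commute (Φ x) z) :
    RhatVia r s rh sh Φ z * (z * Φ (1 ⊗ₜ matF r s (0 : Fin (n + 1))) +
        Φ (matF r s (0 : Fin (n + 1)) ⊗ₜ diagonal (weight s r (0 : Fin (n + 1))))) =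
      (Φ (1 ⊗ₜ matF r s (0 : Fin (n + 1))) +
        z * Φ (matF r s (0 : Fin (n + 1)) ⊗ₜ diagonal (weight s r (0 : Fin (n + 1))))) *
          RhatVia r s rh sh Φ z := by
  refine RhatVia_mul hrh hsh hr hs (fun z => ?_) Φ z hz
  rw [kron_tmul, kron_tmul]
  exact RMat_mul_f_zero hn hr hs z

/-- The coproduct of a generator, in an algebra in which `x` and `y` stand for the actions on the
first and on the second factor. -/
def pairGen (x y : Gen n → A) : Gen n → A
  | .e i => x (.e i) + x (.ω i) * y (.e i)
  | .f i => y (.f i) + x (.f i) * y (.ω' i)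
  | .ω i => x (.ω i) * y (.ω i)
  | .ωinv i => x (.ωinv i) * y (.ωinv i)
  | .ω' i => x (.ω' i) * y (.ω' i)
  | .ω'inv i => x (.ω'inv i) * y (.ω'inv i)
  | .γ => x .γ * y .γ
  | .γinv => x .γinv * y .γinv
  | .γ' => x .γ' * y .γ'
  | .γ'inv => x .γ'inv * y .γ'inv

/-- `R̂(u/v)` intertwines the two tensor products of the evaluation representations with spectral
parameters `u` and `v`. -/
theorem RhatVia_mul_pairGen [Infinite K] (hn : 2 ≤ n) (hrh : rh ^ 2 = r) (hsh : sh ^ 2 = s)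
    (hr : r ≠ 0) (hs : s ≠ 0) {a b : K} (hab : a * b = (r * s)⁻¹) (Φ : M₂ ⊗[K] M₂ →ₐ[K] A)
    (u v : Aˣ) (hu : ∀ x, Commute (Φ x) u) (hv : ∀ x, Commute (Φ x) v)
    (huv : Commute (u : A) v) (g : Gen n) :
    RhatVia r s rh sh Φ (↑(u * v⁻¹) : A) *
        pairGen (evalGen r s a b (Φ.comp Algebra.TensorProduct.includeLeft) u)
          (evalGen r s a b (Φ.comp Algebra.TensorProduct.includeRight) v) g =
      pairGen (evalGen r s a b (Φ.comp Algebra.TensorProduct.includeLeft) v)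
          (evalGen r s a b (Φ.comp Algebra.TensorProduct.includeRight) u) g *
        RhatVia r s rh sh Φ (↑(u * v⁻¹) : A) := by
  -- The condition on ab enters here: another value of c would multiply the summand ω_0 ⊗ e_0 but
  -- not e_0 ⊗ 1.
  have hc : cConst r s a b = 1 := by
    rw [cConst, hab, mul_inv_cancel₀ (mul_ne_zero hr hs)]
  have hui : ∀ x, Commute (Φ x) (↑u⁻¹ : A) := fun x => (hu x).units_inv_right
  have hvi : ∀ x, Commute (Φ x) (↑v⁻¹ : A) := fun x => (hv x).units_inv_right
  have hz : ∀ x, Commute (Φ x) (↑(u * v⁻¹) : A) := fun x => by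
    rw [Units.val_mul]
    exact (hu x).mul_right (hvi x)
  have huv' : Commute (↑u⁻¹ : A) v := huv.units_inv_left
  have hzu : Commute (↑(u * v⁻¹) : A) (↑u⁻¹ : A) := by
    rw [Units.val_mul]
    exact ((Commute.refl (u : A)).units_inv_right).mul_left huv.units_inv_left.units_inv_right.symm
  have hzv : Commute (↑(u * v⁻¹) : A) (v : A) := by
    rw [Units.val_mul]
    exact huv.mul_left (Commute.refl (v : A)).units_inv_left
  have hRv := RhatVia_commute (r := r) (s := s) (rh := rh) (sh := sh) (v : A) Φ _ hv hzv
  have hRu := RhatVia_commute (r := r) (s := s) (rh := rh) (sh := sh) (↑u⁻¹ : A) Φ _ hui hzu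
  -- With u = zv one factors v out of the action of e_0, and with v⁻¹ = zu⁻¹ one factors u⁻¹ out of
  -- that of f_0. Both factors commute with R̂(z), and the relations in z alone remain.
  have hu' : (u : A) = (↑(u * v⁻¹) : A) * v := by
    rw [← Units.val_mul, inv_mul_cancel_right]
  have hv' : (↑v⁻¹ : A) = (↑(u * v⁻¹) : A) * (↑u⁻¹ : A) := by
    rw [hzu.eq, ← Units.val_mul, inv_mul_cancel_left]
  set z : A := (↑(u * v⁻¹) : A) with hzdef
  set R := RhatVia r s rh sh Φ z with hR
  have hl : ∀ x, Φ.comp Algebra.TensorProduct.includeLeft x = Φ (x ⊗ₜ 1) := fun x => rfl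
  have hrr : ∀ x, Φ.comp Algebra.TensorProduct.includeRight x = Φ (1 ⊗ₜ x) := fun x => rfl
  have hm : ∀ x y, Φ (x ⊗ₜ 1) * Φ (1 ⊗ₜ y) = Φ (x ⊗ₜ y) := fun x y => by
    rw [← map_mul, Algebra.TensorProduct.tmul_mul_tmul, one_mul, mul_one]
  have hd : ∀ p q : K, p ≠ 0 → q ≠ 0 → ∀ i : Fin (n + 1),
      R * (Φ (diagonal (weight p q i) ⊗ₜ 1) * Φ (1 ⊗ₜ diagonal (weight p q i))) =
      Φ (diagonal (weight p q i) ⊗ₜ 1) * Φ (1 ⊗ₜ diagonal (weight p q i)) * R := by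
    intro p q hp hq i
    rw [hm]
    exact RhatVia_mul_diagonal hrh hsh hr hs Φ z hz hp hq i
  -- Inverse eigenvalues are eigenvalues at inverse parameters, so the inverses of ω_i and ω'_i need
  -- no argument of their own.
  have hwi : ∀ (p q : K) (i : Fin (n + 1)),
      (fun x => (weight p q i x)⁻¹) = weight p⁻¹ q⁻¹ i := fun p q i => by
    funext x
    rw [weight_inv]
  cases g with
  | e i =>
    by_cases hi : i = 0
    · subst hi
      simp only [pairGen, evalGen, if_true, hc, one_smul, hl, hrr]
      have key := RhatVia_mul_e_zero hn hrh hsh hr hs Φ z hz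
      rw [← hR] at key
      have key2 := congrArg (· * (v : A)) key
      have e1 : Φ (matE (0 : Fin (n + 1)) ⊗ₜ 1) * (u : A) =
          z * Φ (matE (0 : Fin (n + 1)) ⊗ₜ 1) * v := by
        rw [hu', ← mul_assoc, (hz _).eq]
      have e2 : Φ (1 ⊗ₜ matE (0 : Fin (n + 1))) * (u : A) =
          z * (Φ (1 ⊗ₜ matE (0 : Fin (n + 1))) * v) := by
        rw [hu', ← mul_assoc, (hz _).eq, mul_assoc]
      rw [e1, e2, mul_smul_comm, ← smul_add, mul_smul_comm, mul_smul_comm, ← smul_add,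
        smul_mul_assoc]
      congr 1
      rw [← mul_assoc (Φ _) (Φ _) (v : A), hm, ← add_mul, ← mul_assoc, key2, mul_assoc, hRv.eq,
        ← mul_assoc, add_mul, add_mul, ← mul_assoc (Φ _) z, (hz _).eq, mul_assoc z,
        mul_assoc z, mul_assoc z, ← mul_assoc (Φ _) (Φ _) (v : A), hm, add_mul, mul_assoc z]
    · simp only [pairGen, evalGen, if_neg hi, one_smul, hl, hrr, hm]
      rw [← map_add]
      exact RhatVia_mul_e hrh hsh hr hs Φ z hz i hi
  | f i =>
    by_cases hi : i = 0
    · subst hi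
      simp only [pairGen, evalGen, if_true, hc, one_smul, hl, hrr]
      have key := RhatVia_mul_f_zero hn hrh hsh hr hs Φ z hz
      rw [← hR] at key
      have key2 := congrArg (· * (↑u⁻¹ : A)) key
      have e1 : Φ (1 ⊗ₜ matF r s (0 : Fin (n + 1))) * (↑v⁻¹ : A) =
          z * Φ (1 ⊗ₜ matF r s (0 : Fin (n + 1))) * (↑u⁻¹ : A) := by
        rw [hv', ← mul_assoc, (hz _).eq]
      have e2 : Φ (matF r s (0 : Fin (n + 1)) ⊗ₜ 1) * (↑v⁻¹ : A) =
          z * (Φ (matF r s (0 : Fin (n + 1)) ⊗ₜ 1) * (↑u⁻¹ : A)) := by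
        rw [hv', ← mul_assoc, (hz _).eq, mul_assoc]
      have e3 : Φ (matF r s (0 : Fin (n + 1)) ⊗ₜ 1) * (↑u⁻¹ : A) *
          Φ (1 ⊗ₜ diagonal (weight s r (0 : Fin (n + 1)))) =
          Φ (matF r s (0 : Fin (n + 1)) ⊗ₜ diagonal (weight s r (0 : Fin (n + 1)))) *
            (↑u⁻¹ : A) := by
        rw [mul_assoc, ← (hui _).eq, ← mul_assoc, hm]
      rw [e1, e2, smul_mul_assoc, ← smul_add, mul_smul_comm, smul_mul_assoc, ← smul_add,
        smul_mul_assoc]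
      congr 1
      rw [e3, ← add_mul, ← mul_assoc, key2, mul_assoc, hRu.eq, ← mul_assoc, add_mul, add_mul,
        mul_assoc z, mul_assoc z, mul_assoc z, e3, add_mul, mul_assoc z]
    · simp only [pairGen, evalGen, if_neg hi, one_smul, hl, hrr, hm]
      rw [← map_add]
      exact RhatVia_mul_f hn hrh hsh hr hs Φ z hz i hi
  | ω i => simpa only [pairGen, evalGen, hc, ite_self, one_smul, hl, hrr] using hd r s hr hs i
  | ωinv i =>
    simpa only [pairGen, evalGen, hc, ite_self, inv_one, one_smul, hwi, hl, hrr] using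
      hd r⁻¹ s⁻¹ (inv_ne_zero hr) (inv_ne_zero hs) i
  | ω' i => simpa only [pairGen, evalGen, hc, ite_self, one_smul, hl, hrr] using hd s r hs hr i
  | ω'inv i =>
    simpa only [pairGen, evalGen, hc, ite_self, inv_one, one_smul, hwi, hl, hrr] using
      hd s⁻¹ r⁻¹ (inv_ne_zero hs) (inv_ne_zero hr) i
  | γ => simp only [pairGen, evalGen, hc, one_smul, mul_one, one_mul]
  | γinv => simp only [pairGen, evalGen, hc, inv_one, one_smul, mul_one, one_mul]
  | γ' => simp only [pairGen, evalGen, hc, one_smul, mul_one, one_mul]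
  | γ'inv => simp only [pairGen, evalGen, hc, inv_one, one_smul, mul_one, one_mul]

end UniversalGenerators

end TwoParamC

namespace TwoParamC

open scoped TensorProduct

/-! ### From generators to the whole algebra -/

section Generators

variable {K : Type*} [Field K] {r s : K} {n : ℕ} {A B : Type*} [Ring A] [Algebra K A] [Ring B]
  [Algebra K B]

theorem UAff'.lift_gen (x : Gen n → A) (hx : ∀ p q, Rel r s x p q → p = q) (g : Gen n) :
    UAff'.lift x hx (UAff'.gen r s n g) = x g := by
  simp [UAff'.lift, UAff'.gen]

theorem UAff.lift_gen (x : GenD n → A) (hx : ∀ p q, RelD r s x p q → p = q) (g : GenD n) :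
    UAff.lift x hx (UAff.gen r s n g) = x g := by
  simp [UAff.lift, UAff.gen]

/-- The elements intertwined by R are closed under sums and products and contain the scalars, so
generators suffice. Both quotient algebras are images of free algebras, and no relation is needed.
-/
theorem mul_freeAlgebra_eq {X C : Type*} [Semiring C] [Algebra K C] (π : FreeAlgebra K X →ₐ[K] C)
    (hπ : Function.Surjective π) (T T' : C →ₐ[K] A) (R : A)
    (h : ∀ g, R * T (π (FreeAlgebra.ι K g)) = T' (π (FreeAlgebra.ι K g)) * R) (x : C) :
    R * T x = T' x * R := by
  obtain ⟨x, rfl⟩ := hπ x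
  induction x using FreeAlgebra.induction with
  | grade0 c => rw [AlgHom.commutes, AlgHom.commutes, AlgHom.commutes, Algebra.commutes]
  | grade1 g => exact h g
  | mul a b ha hb => rw [map_mul, map_mul, map_mul, ← mul_assoc, ha, mul_assoc, hb, mul_assoc]
  | add a b ha hb => rw [map_add, map_add, map_add, mul_add, add_mul, ha, hb]

/-- An operator that intertwines the generators of `U'` intertwines two representations. -/
theorem UAff'.mul_eq (T T' : UAff' r s n →ₐ[K] A) (R : A)
    (h : ∀ g, R * T (UAff'.gen r s n g) = T' (UAff'.gen r s n g) * R) (x : UAff' r s n) :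
    R * T x = T' x * R :=
  mul_freeAlgebra_eq (RingQuot.mkAlgHom K _) (RingQuot.mkAlgHom_surjective K _) T T' R h x

/-- An operator that intertwines the generators of `U` intertwines two representations. -/
theorem UAff.mul_eq (T T' : UAff r s n →ₐ[K] A) (R : A)
    (h : ∀ g, R * T (UAff.gen r s n g) = T' (UAff.gen r s n g) * R) (x : UAff r s n) :
    R * T x = T' x * R :=
  mul_freeAlgebra_eq (RingQuot.mkAlgHom K _) (RingQuot.mkAlgHom_surjective K _) T T' R h x

theorem map_pairGen (ψ : A →ₐ[K] B) (x y : Gen n → A) (g : Gen n) :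
    ψ (pairGen x y g) = pairGen (fun g => ψ (x g)) (fun g => ψ (y g)) g := by
  cases g <;> simp [pairGen]

theorem map_evalGen (ψ : A →ₐ[K] B) (a b : K) (φ : Matrix (Fin (2 * n)) (Fin (2 * n)) K →ₐ[K] A)
    (u : Aˣ) (g : Gen n) :
    ψ (evalGen r s a b φ u g) =
      evalGen r s a b (ψ.comp φ) (Units.map (ψ : A →* B) u) g := by
  cases g <;> simp only [evalGen] <;> (try split_ifs) <;> simp [map_smul, ← map_inv]

/-- T is kept arbitrary so that one statement serves pairs of endomorphisms of V as well as of V ⊗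
K[u, u⁻¹]. -/
theorem map_comulGen (x : Gen n → B) (g : Gen n) {C : Type*} [Ring C] [Algebra K C]
    (ρ₁ ρ₂ : B →ₐ[K] C) (T : C ⊗[K] C →ₐ[K] A) :
    T (Algebra.TensorProduct.map ρ₁ ρ₂ (comulGen x g)) =
      pairGen (fun g => T (ρ₁ (x g) ⊗ₜ 1)) (fun g => T (1 ⊗ₜ ρ₂ (x g))) g := by
  cases g <;> simp [comulGen, pairGen, ← map_mul]

theorem map_comulGen_evalGen (x : Gen n → B) (g : Gen n) {C : Type*} [Ring C] [Algebra K C]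
    (ρ₁ ρ₂ : B →ₐ[K] C) (T : C ⊗[K] C →ₐ[K] A) (a b : K)
    (φ : Matrix (Fin (2 * n)) (Fin (2 * n)) K →ₐ[K] C) (u v : Cˣ)
    (h₁ : ∀ g, ρ₁ (x g) = evalGen r s a b φ u g) (h₂ : ∀ g, ρ₂ (x g) = evalGen r s a b φ v g) :
    T (Algebra.TensorProduct.map ρ₁ ρ₂ (comulGen x g)) =
      pairGen
        (evalGen r s a b ((T.comp (Algebra.TensorProduct.map φ φ)).comp
          Algebra.TensorProduct.includeLeft)
          (Units.map (T.comp Algebra.TensorProduct.includeLeft : C →* A) u))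
        (evalGen r s a b ((T.comp (Algebra.TensorProduct.map φ φ)).comp
          Algebra.TensorProduct.includeRight)
          (Units.map (T.comp Algebra.TensorProduct.includeRight : C →* A) v)) g := by
  rw [map_comulGen]
  congr 1
  · funext g
    rw [h₁]
    refine (map_evalGen (T.comp Algebra.TensorProduct.includeLeft) a b φ u g).trans ?_
    congr 1
    refine AlgHom.ext fun m => ?_
    simp
  · funext g
    rw [h₂]
    refine (map_evalGen (T.comp Algebra.TensorProduct.includeRight) a b φ v g).trans ?_
    congr 1
    refine AlgHom.ext fun m => ?_
    simp

end Generators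

/-! ### Intertwining for scalar spectral parameters -/

section ScalarParameters

variable {K : Type*} [Field K] {r s rh sh : K} {n : ℕ}

/-- A scalar, as a unit of an algebra. -/
def scalarUnit (A : Type*) [Ring A] [Algebra K A] (u : Kˣ) : Aˣ :=
  Units.map (algebraMap K A).toMonoidHom u

theorem commute_scalarUnit {A : Type*} [Ring A] [Algebra K A] (u : Kˣ) (x : A) :
    Commute x (scalarUnit A u : A) :=
  (Algebra.commutes (u : K) x).symm

theorem algebraMap_div_units {A : Type*} [Ring A] [Algebra K A] (u v : Kˣ) :
    algebraMap K A (u / v : K) = ↑(scalarUnit A u * (scalarUnit A v)⁻¹) := by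
  rw [scalarUnit, scalarUnit, ← map_inv, ← map_mul, div_eq_mul_inv, ← Units.val_inv_eq_inv_val,
    ← Units.val_mul]
  rfl

theorem RhatVia_mul_pairGen_scalar [Infinite K] {A : Type*} [Ring A] [Algebra K A] (hn : 2 ≤ n)
    (h : Good r s) (hrh : rh ^ 2 = r) (hsh : sh ^ 2 = s) {a b : Kˣ}
    (hab : (a * b : K) = (r * s)⁻¹)
    (Φ : Matrix (Fin (2 * n)) (Fin (2 * n)) K ⊗[K] Matrix (Fin (2 * n)) (Fin (2 * n)) K →ₐ[K] A)
    (u v : Kˣ) (g : Gen n) :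
    RhatVia r s rh sh Φ (algebraMap K A (u / v : K)) *
        pairGen (evalGen r s a b (Φ.comp Algebra.TensorProduct.includeLeft) (scalarUnit A u))
          (evalGen r s a b (Φ.comp Algebra.TensorProduct.includeRight) (scalarUnit A v)) g =
      pairGen (evalGen r s a b (Φ.comp Algebra.TensorProduct.includeLeft) (scalarUnit A v))
          (evalGen r s a b (Φ.comp Algebra.TensorProduct.includeRight) (scalarUnit A u)) g *
        RhatVia r s rh sh Φ (algebraMap K A (u / v : K)) := by
  rw [algebraMap_div_units]
  exact RhatVia_mul_pairGen hn hrh hsh h.r_ne h.s_ne hab Φ _ _ (fun _ => commute_scalarUnit u _)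
    (fun _ => commute_scalarUnit v _) (commute_scalarUnit v _) g

theorem map_scalarUnit {A B : Type*} [Ring A] [Algebra K A] [Ring B] [Algebra K B] (ψ : A →ₐ[K] B)
    (u : Kˣ) : Units.map (ψ : A →* B) (scalarUnit A u) = scalarUnit B u := by
  ext1
  exact ψ.commutes _

/-- `R̂(u/v)` intertwines two tensor products of evaluation representations with scalar spectral
parameters. -/
theorem RhatVia_mul_comul' [Infinite K] {A C : Type*} [Ring A] [Algebra K A] [Ring C] [Algebra K C]
    (hn : 2 ≤ n) (h : Good r s) (hrh : rh ^ 2 = r) (hsh : sh ^ 2 = s) {a b : Kˣ}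
    (hab : (a * b : K) = (r * s)⁻¹) (T : C ⊗[K] C →ₐ[K] A)
    (φ : Matrix (Fin (2 * n)) (Fin (2 * n)) K →ₐ[K] C) (ρ : Kˣ → UAff' r s n →ₐ[K] C)
    (hρ : ∀ u g, ρ u (UAff'.gen r s n g) = evalGen r s (a : K) b φ (scalarUnit C u) g)
    (u v : Kˣ) (x : UAff' r s n) :
    RhatVia r s rh sh (T.comp (Algebra.TensorProduct.map φ φ)) (algebraMap K A (u / v : K)) *
        T (Algebra.TensorProduct.map (ρ u) (ρ v) (comul' hn h x)) =
      T (Algebra.TensorProduct.map (ρ v) (ρ u) (comul' hn h x)) *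
        RhatVia r s rh sh (T.comp (Algebra.TensorProduct.map φ φ)) (algebraMap K A (u / v : K)) := by
  refine UAff'.mul_eq
    ((T.comp (Algebra.TensorProduct.map (ρ u) (ρ v))).comp (comul' hn h))
    ((T.comp (Algebra.TensorProduct.map (ρ v) (ρ u))).comp (comul' hn h)) _ (fun g => ?_) x
  have hc : comul' hn h (UAff'.gen r s n g) = comulGen (UAff'.gen r s n) g :=
    UAff'.lift_gen _ _ g
  simp only [AlgHom.comp_apply]
  rw [hc, map_comulGen_evalGen _ g _ _ T a b φ _ _ (hρ u) (hρ v),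
    map_comulGen_evalGen _ g _ _ T a b φ _ _ (hρ v) (hρ u), map_scalarUnit, map_scalarUnit,
    map_scalarUnit, map_scalarUnit]
  exact RhatVia_mul_pairGen_scalar hn h hrh hsh hab _ u v g

/-- Pairs of endomorphisms of `V`, acting on `V ⊗ V`. -/
noncomputable def endTensorV (K : Type*) [Field K] (n : ℕ) :
    Module.End K (V K n) ⊗[K] Module.End K (V K n) →ₐ[K] Module.End K (V K n ⊗[K] V K n) :=
  Module.endTensorEndAlgHom

/-- Pairs of matrices, acting on `V ⊗ V`. -/
noncomputable def pairAct (K : Type*) [Field K] (n : ℕ) :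
    Matrix (Fin (2 * n)) (Fin (2 * n)) K ⊗[K] Matrix (Fin (2 * n)) (Fin (2 * n)) K →ₐ[K]
      Module.End K (V K n ⊗[K] V K n) :=
  (endTensorV K n).comp (Algebra.TensorProduct.map
    (Matrix.toLinAlgEquiv' : _ ≃ₐ[K] Module.End K (V K n)).toAlgHom
    (Matrix.toLinAlgEquiv' : _ ≃ₐ[K] Module.End K (V K n)).toAlgHom)

theorem Rhat_eq_RhatVia (z : K) :
    Rhat r s rh sh z = RhatVia r s rh sh (pairAct K n) (algebraMap K _ z) := rfl

theorem tensorRep'_apply (hn : 2 ≤ n) (h : Good r s) (a b u v : Kˣ) (x : UAff' r s n) :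
    tensorRep' hn h a b u v x = endTensorV K n
      (Algebra.TensorProduct.map (evalRep' hn h a b u) (evalRep' hn h a b v) (comul' hn h x)) := rfl

theorem evalRep'_gen (hn : 2 ≤ n) (h : Good r s) (a b u : Kˣ) (g : Gen n) :
    evalRep' hn h a b u (UAff'.gen r s n g) =
      evalGen r s (a : K) b (Matrix.toLinAlgEquiv' : _ ≃ₐ[K] Module.End K (V K n)).toAlgHom
        (scalarUnit _ u) g :=
  UAff'.lift_gen _ _ _

theorem Rhat_mul_tensorRep' [Infinite K] (hn : 2 ≤ n) (h : Good r s) (hrh : rh ^ 2 = r)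
    (hsh : sh ^ 2 = s) {a b : Kˣ} (hab : (a * b : K) = (r * s)⁻¹) (u v : Kˣ) (x : UAff' r s n) :
    Rhat r s rh sh (u / v : K) * tensorRep' hn h a b u v x =
      tensorRep' hn h a b v u x * Rhat r s rh sh (u / v : K) := by
  rw [Rhat_eq_RhatVia, tensorRep'_apply, tensorRep'_apply]
  have key := RhatVia_mul_comul' (A := Module.End K (V K n ⊗[K] V K n)) (C := Module.End K (V K n))
    hn h hrh hsh hab (endTensorV K n) (Matrix.toLinAlgEquiv' : _ ≃ₐ[K] Module.End K (V K n)).toAlgHom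
    (evalRep' hn h a b) (evalRep'_gen hn h a b) u v x
  exact key

end ScalarParameters

end TwoParamC

namespace TwoParamC

open scoped TensorProduct

/-! ### Intertwining for indeterminate spectral parameters -/

section IndeterminateParameters

variable {K : Type*} [Field K] {r s rh sh : K} {n : ℕ}

set_option maxSynthPendingDepth 10 in
noncomputable instance instRingEndTensor (K : Type*) [Field K] (n : ℕ) :
    Ring (Module.End K ((V K n ⊗[K] P K) ⊗[K] (V K n ⊗[K] P K))) :=
  inferInstance

/-- Pairs of endomorphisms of `V(u)` and `V(v)`, acting on `V(u) ⊗ V(v)`. -/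
noncomputable def endTensorP (K : Type*) [Field K] (n : ℕ) :
    Module.End K (V K n ⊗[K] P K) ⊗[K] Module.End K (V K n ⊗[K] P K) →ₐ[K]
      Module.End K ((V K n ⊗[K] P K) ⊗[K] (V K n ⊗[K] P K)) :=
  Module.endTensorEndAlgHom

/-- Pairs of matrices, acting on `V(u) ⊗ V(v)` for indeterminates `u`, `v`. -/
noncomputable def pairActP (K : Type*) [Field K] (n : ℕ) :
    Matrix (Fin (2 * n)) (Fin (2 * n)) K ⊗[K] Matrix (Fin (2 * n)) (Fin (2 * n)) K →ₐ[K]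
      Module.End K ((V K n ⊗[K] P K) ⊗[K] (V K n ⊗[K] P K)) :=
  (endTensorP K n).comp (Algebra.TensorProduct.map (matAct K n) (matAct K n))

/-- Multiplication by the first spectral parameter on `V(u) ⊗ V(v)`. -/
noncomputable def mulU₁ (K : Type*) [Field K] (n : ℕ) :
    (Module.End K ((V K n ⊗[K] P K) ⊗[K] (V K n ⊗[K] P K)))ˣ :=
  Units.map (((endTensorP K n).comp Algebra.TensorProduct.includeLeft :
    Module.End K (V K n ⊗[K] P K) →ₐ[K]
      Module.End K ((V K n ⊗[K] P K) ⊗[K] (V K n ⊗[K] P K))) : _ →* _) (mulU K n)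

/-- Multiplication by the second spectral parameter on `V(u) ⊗ V(v)`. -/
noncomputable def mulU₂ (K : Type*) [Field K] (n : ℕ) :
    (Module.End K ((V K n ⊗[K] P K) ⊗[K] (V K n ⊗[K] P K)))ˣ :=
  Units.map (((endTensorP K n).comp Algebra.TensorProduct.includeRight :
    Module.End K (V K n ⊗[K] P K) →ₐ[K]
      Module.End K ((V K n ⊗[K] P K) ⊗[K] (V K n ⊗[K] P K))) : _ →* _) (mulU K n)

theorem mulU₁_mul_mulU₂_inv : (↑(mulU₁ K n * (mulU₂ K n)⁻¹) :
    Module.End K ((V K n ⊗[K] P K) ⊗[K] (V K n ⊗[K] P K))) =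
    TensorProduct.map (mulU K n : Module.End K (V K n ⊗[K] P K))
      (↑(mulU K n)⁻¹ : Module.End K (V K n ⊗[K] P K)) := by
  apply TensorProduct.ext'
  intro x y
  rfl

/-- Separates the operator into R̂(u/v) on V(u) ⊗ V(v), to which the universal result applies, and
the exchange of the Laurent variables. -/
theorem RhatUV_eq_RhatVia : RhatUV (n := n) r s rh sh =
    swapP K n * RhatVia r s rh sh (pairActP K n) (↑(mulU₁ K n * (mulU₂ K n)⁻¹)) := by
  rw [mulU₁_mul_mulU₂_inv]
  rfl

theorem swapP_swapP : swapP K n * swapP K n = 1 := by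
  apply TensorProduct.ext_fourfold'
  intro x f y g
  rfl

/-- The operator `swapP`, as a unit. -/
noncomputable def swapUnit (K : Type*) [Field K] (n : ℕ) :
    (Module.End K ((V K n ⊗[K] P K) ⊗[K] (V K n ⊗[K] P K)))ˣ :=
  ⟨swapP K n, swapP K n, swapP_swapP, swapP_swapP⟩

theorem swapP_mul_pairActP (x : Matrix (Fin (2 * n)) (Fin (2 * n)) K ⊗[K]
    Matrix (Fin (2 * n)) (Fin (2 * n)) K) :
    swapP K n * pairActP K n x = pairActP K n x * swapP K n := by
  induction x with
  | zero => simp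
  | add x y hx hy => rw [map_add, mul_add, add_mul, hx, hy]
  | tmul x y =>
    apply TensorProduct.ext_fourfold'
    intro x f y g
    rfl

theorem swapP_mul_mulU₁ : swapP K n * (mulU₁ K n : Module.End K ((V K n ⊗[K] P K) ⊗[K] (V K n ⊗[K] P K))) =
    (mulU₂ K n : Module.End K ((V K n ⊗[K] P K) ⊗[K] (V K n ⊗[K] P K))) * swapP K n := by
  apply TensorProduct.ext_fourfold'
  intro x f y g
  rfl

theorem swapP_mul_mulU₂ : swapP K n * (mulU₂ K n : Module.End K ((V K n ⊗[K] P K) ⊗[K] (V K n ⊗[K] P K))) =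
    (mulU₁ K n : Module.End K ((V K n ⊗[K] P K) ⊗[K] (V K n ⊗[K] P K))) * swapP K n := by
  apply TensorProduct.ext_fourfold'
  intro x f y g
  rfl

theorem pairActP_commute_mulU₁ (x : Matrix (Fin (2 * n)) (Fin (2 * n)) K ⊗[K]
    Matrix (Fin (2 * n)) (Fin (2 * n)) K) :
    Commute (pairActP K n x) (mulU₁ K n : Module.End K ((V K n ⊗[K] P K) ⊗[K] (V K n ⊗[K] P K))) := by
  change _ * _ = _ * _
  induction x with
  | zero => simp
  | add x y hx hy => rw [map_add, mul_add, add_mul, hx, hy]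
  | tmul x y =>
    apply TensorProduct.ext_fourfold'
    intro x f y g
    rfl

theorem pairActP_commute_mulU₂ (x : Matrix (Fin (2 * n)) (Fin (2 * n)) K ⊗[K]
    Matrix (Fin (2 * n)) (Fin (2 * n)) K) :
    Commute (pairActP K n x) (mulU₂ K n : Module.End K ((V K n ⊗[K] P K) ⊗[K] (V K n ⊗[K] P K))) := by
  change _ * _ = _ * _
  induction x with
  | zero => simp
  | add x y hx hy => rw [map_add, mul_add, add_mul, hx, hy]
  | tmul x y =>
    apply TensorProduct.ext_fourfold'
    intro x f y g
    rfl

theorem mulU₁_commute_mulU₂ : Commute (mulU₁ K n : Module.End K ((V K n ⊗[K] P K) ⊗[K] (V K n ⊗[K] P K))) (mulU₂ K n :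
    Module.End K ((V K n ⊗[K] P K) ⊗[K] (V K n ⊗[K] P K))) := by
  apply TensorProduct.ext_fourfold'
  intro x f y g
  rfl

/-- Conjugation by `swapP` fixes the matrices and exchanges the two spectral parameters. It hence
turns the pair with exchanged parameters back into the original one. -/
theorem swapP_mul_pairGen (a b : K) (g : Gen n) :
    swapP K n * pairGen
        (evalGen r s a b ((pairActP K n).comp Algebra.TensorProduct.includeLeft) (mulU₂ K n))
        (evalGen r s a b ((pairActP K n).comp Algebra.TensorProduct.includeRight) (mulU₁ K n)) g =
      pairGen
        (evalGen r s a b ((pairActP K n).comp Algebra.TensorProduct.includeLeft) (mulU₁ K n))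
        (evalGen r s a b ((pairActP K n).comp Algebra.TensorProduct.includeRight) (mulU₂ K n)) g *
      swapP K n := by
  -- The conjugation is an algebra automorphism, so its effect on each generator is read off from
  -- its effect on the matrices and the two parameters.
  set ψ := (MulSemiringAction.toAlgEquiv K (Module.End K ((V K n ⊗[K] P K) ⊗[K] (V K n ⊗[K] P K)))
    (ConjAct.toConjAct (swapUnit K n))).toAlgHom
  have hψ : ∀ x, ψ x = swapP K n * x * swapP K n := fun x => rfl
  have h1 := map_pairGen ψ
    (evalGen r s a b ((pairActP K n).comp Algebra.TensorProduct.includeLeft) (mulU₂ K n))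
    (evalGen r s a b ((pairActP K n).comp Algebra.TensorProduct.includeRight) (mulU₁ K n)) g
  have hΦ : ∀ x, ψ (pairActP K n x) = pairActP K n x := fun x => by
    rw [hψ, swapP_mul_pairActP, mul_assoc, swapP_swapP, mul_one]
  have hu : Units.map (ψ : _ →* _) (mulU₂ K n) = mulU₁ K n := by
    ext1
    refine (hψ _).trans ?_
    rw [swapP_mul_mulU₂, mul_assoc, swapP_swapP, mul_one]
  have hv : Units.map (ψ : _ →* _) (mulU₁ K n) = mulU₂ K n := by
    ext1
    refine (hψ _).trans ?_
    rw [swapP_mul_mulU₁, mul_assoc, swapP_swapP, mul_one]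
  simp only [map_evalGen] at h1
  rw [hu, hv] at h1
  have hL : ψ.comp ((pairActP K n).comp Algebra.TensorProduct.includeLeft) =
      (pairActP K n).comp Algebra.TensorProduct.includeLeft := AlgHom.ext fun x => hΦ _
  have hR : ψ.comp ((pairActP K n).comp Algebra.TensorProduct.includeRight) =
      (pairActP K n).comp Algebra.TensorProduct.includeRight := AlgHom.ext fun x => hΦ _
  rw [hL, hR, hψ] at h1
  rw [← h1, mul_assoc, swapP_swapP, mul_one]

/-- Scaling both variables by q leaves u/v unchanged, and R̂ involves the variables only through
u/v. This gives the relations for D, D' and their inverses. -/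
theorem RhatUV_mul_degOp (q : Kˣ) :
    RhatUV r s rh sh * TensorProduct.map (degOp n q) (degOp n q) =
      TensorProduct.map (degOp n q) (degOp n q) * RhatUV r s rh sh := by
  have hsw : swapP K n * TensorProduct.map (degOp n q) (degOp n q) =
      TensorProduct.map (degOp n q) (degOp n q) * swapP K n := by
    apply TensorProduct.ext_fourfold'
    intro x f y g
    rfl
  have hΦ : ∀ x, Commute (pairActP K n x) (TensorProduct.map (degOp n q) (degOp n q)) := by
    intro x
    change _ * _ = _ * _
    induction x with
    | zero => simp
    | add x y hx hy => rw [map_add, mul_add, add_mul, hx, hy]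
    | tmul x y =>
      apply TensorProduct.ext_fourfold'
      intro x f y g
      rfl
  have hz : Commute (TensorProduct.map (mulU K n : Module.End K (V K n ⊗[K] P K))
      (↑(mulU K n)⁻¹ : Module.End K (V K n ⊗[K] P K)))
      (TensorProduct.map (degOp n q) (degOp n q)) := by
    change TensorProduct.map _ _ * TensorProduct.map _ _ =
      TensorProduct.map _ _ * TensorProduct.map _ _
    rw [← TensorProduct.map_mul, ← TensorProduct.map_mul, degOp_mulU, degOp_mulU_inv,
      TensorProduct.map_smul_left, TensorProduct.map_smul_right, smul_smul,
      mul_inv_cancel₀ q.ne_zero, one_smul]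
  rw [← mulU₁_mul_mulU₂_inv] at hz
  have hR := RhatVia_commute (r := r) (s := s) (rh := rh) (sh := sh)
    (A := Module.End K ((V K n ⊗[K] P K) ⊗[K] (V K n ⊗[K] P K)))
    (TensorProduct.map (degOp n q) (degOp n q)) (pairActP K n) _ hΦ hz
  rw [RhatUV_eq_RhatVia, mul_assoc, hR.eq, ← mul_assoc, hsw, mul_assoc]

theorem RhatUV_mul_tensorRep [Infinite K] (hn : 2 ≤ n) (h : Good r s) (hrh : rh ^ 2 = r)
    (hsh : sh ^ 2 = s) {a b : Kˣ} (hab : (a * b : K) = (r * s)⁻¹) (x : UAff r s n) :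
    RhatUV r s rh sh * tensorRep hn h a b x = tensorRep hn h a b x * RhatUV r s rh sh := by
  refine UAff.mul_eq (tensorRep hn h a b) (tensorRep hn h a b) (RhatUV r s rh sh) (fun g => ?_) x
  have hT : tensorRep hn h a b (UAff.gen r s n g) =
      endTensorP K n (Algebra.TensorProduct.map (evalRep hn h a b) (evalRep hn h a b)
        (comulGenD (UAff.gen r s n) g)) := by
    have hc : comul hn h (UAff.gen r s n g) = comulGenD (UAff.gen r s n) g :=
      UAff.lift_gen _ _ g
    rw [← hc]
    rfl
  rw [hT]
  have hg : ∀ g, evalRep hn h a b (UAff.gen r s n g) = evalGenD h n (a : K) b g :=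
    UAff.lift_gen _ _
  cases g with
  | base g =>
    have hb : ∀ g, evalRep hn h a b (UAff.gen r s n (.base g)) =
        evalGen r s (a : K) b (matAct K n) (mulU K n) g := fun g => hg (.base g)
    have hp := map_comulGen_evalGen
      (A := Module.End K ((V K n ⊗[K] P K) ⊗[K] (V K n ⊗[K] P K)))
      (C := Module.End K (V K n ⊗[K] P K)) (fun g => UAff.gen r s n (.base g)) g
      (evalRep hn h a b) (evalRep hn h a b) (endTensorP K n) (a : K) (b : K) (matAct K n) (mulU K n)
      (mulU K n) hb hb
    have hp' : endTensorP K n (Algebra.TensorProduct.map (evalRep hn h a b)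
        (evalRep hn h a b) (comulGenD (UAff.gen r s n) (.base g))) = pairGen
        (evalGen r s a b ((pairActP K n).comp Algebra.TensorProduct.includeLeft) (mulU₁ K n))
        (evalGen r s a b ((pairActP K n).comp Algebra.TensorProduct.includeRight) (mulU₂ K n)) g :=
      hp
    -- R̂(u/v) exchanges the two parameters in the action and `swapP` exchanges them back, which is
    -- why the same representation stands on both sides.
    rw [hp', RhatUV_eq_RhatVia, mul_assoc, RhatVia_mul_pairGen hn hrh hsh h.r_ne h.s_ne hab _ _ _
      pairActP_commute_mulU₁ pairActP_commute_mulU₂ mulU₁_commute_mulU₂, ← mul_assoc,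
      swapP_mul_pairGen, mul_assoc]
  | D =>
    have : endTensorP K n (Algebra.TensorProduct.map (evalRep hn h a b)
        (evalRep hn h a b) (comulGenD (UAff.gen r s n) .D)) =
        TensorProduct.map (evalGenD h n (a : K) b .D) (evalGenD h n (a : K) b .D) := by
      rw [← hg]; rfl
    rw [this]
    exact RhatUV_mul_degOp _
  | Dinv =>
    have : endTensorP K n (Algebra.TensorProduct.map (evalRep hn h a b)
        (evalRep hn h a b) (comulGenD (UAff.gen r s n) .Dinv)) =
        TensorProduct.map (evalGenD h n (a : K) b .Dinv) (evalGenD h n (a : K) b .Dinv) := by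
      rw [← hg]; rfl
    rw [this]
    exact RhatUV_mul_degOp _
  | D' =>
    have : endTensorP K n (Algebra.TensorProduct.map (evalRep hn h a b)
        (evalRep hn h a b) (comulGenD (UAff.gen r s n) .D')) =
        TensorProduct.map (evalGenD h n (a : K) b .D') (evalGenD h n (a : K) b .D') := by
      rw [← hg]; rfl
    rw [this]
    exact RhatUV_mul_degOp _
  | D'inv =>
    have : endTensorP K n (Algebra.TensorProduct.map (evalRep hn h a b)
        (evalRep hn h a b) (comulGenD (UAff.gen r s n) .D'inv)) =
        TensorProduct.map (evalGenD h n (a : K) b .D'inv) (evalGenD h n (a : K) b .D'inv) := by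
      rw [← hg]; rfl
    rw [this]
    exact RhatUV_mul_degOp _

end IndeterminateParameters

end TwoParamC

namespace TwoParamC

open scoped TensorProduct
open Matrix

/-! ### Action of the generators on basis vectors -/

section BasisVectors

variable {K : Type*} [Field K] {r s : K} {n : ℕ}

/-- The `k`-th basis vector of `V`, `1 ≤ k ≤ 2n`. -/
def bv (K : Type*) [Field K] (n k : ℕ) : V K n := fun x => if (x : ℕ) + 1 = k then 1 else 0

theorem mulVec_bv (A : Matrix (Fin (2 * n)) (Fin (2 * n)) K) (j : Fin (2 * n)) :
    toLin' A (bv K n (j + 1)) = fun x => A x j := by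
  funext x
  rw [toLin'_apply, mulVec, dotProduct, Finset.sum_eq_single j]
  · simp [bv]
  · intro y _ hy
    rw [bv, if_neg (fun h => hy (Fin.ext (by omega))), mul_zero]
  · simp

theorem matE_bv (i : Fin (n + 1)) (hi : i ≠ 0) (j : Fin (2 * n)) :
    toLin' (matE i) (bv K n (j + 1)) = etaNat K n i (j + 1) • bv K n j := by
  rw [mulVec_bv]
  funext x
  rw [matE_apply i hi, Pi.smul_apply, bv, smul_eq_mul, mul_ite, mul_one, mul_zero]

theorem matE_bv_one (hn : 2 ≤ n) (i : Fin (n + 1)) (hi : i ≠ 0) :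
    toLin' (matE i) (bv K n 1) = 0 := by
  have h := matE_bv (K := K) i hi ⟨0, by omega⟩
  have h0 : bv K n 0 = 0 := by
    funext x
    simp [bv]
  simpa [h0] using h

theorem diagonal_bv (w : Fin (2 * n) → K) (j : Fin (2 * n)) :
    toLin' (diagonal w) (bv K n (j + 1)) = w j • bv K n (j + 1) := by
  rw [mulVec_bv]
  funext x
  rw [diagonal_apply, Pi.smul_apply, bv, smul_eq_mul]
  by_cases h : x = j
  · subst h
    simp
  · rw [if_neg h, if_neg (fun h' => h (Fin.ext (by omega))), mul_zero]

theorem matF_bv (hn : 2 ≤ n) (hr : r ≠ 0) (hs : s ≠ 0) (i : Fin (n + 1)) (hi : i ≠ 0)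
    (j j' : Fin (2 * n)) (hj : (j : ℕ) + 1 = j') :
    toLin' (matF r s i) (bv K n (j + 1)) =
      (fScale r s i * weight s r i j' * etaNat K n i (j' + 1)) • bv K n (j' + 1) := by
  rw [mulVec_bv]
  funext x
  rw [matF_eq hn hr hs, Matrix.smul_apply, diagonal_mul, transpose_apply, matE_apply i hi,
    Pi.smul_apply, bv, smul_eq_mul, smul_eq_mul]
  by_cases h : x = j'
  · subst h
    rw [if_pos hj, if_pos rfl]
    ring
  · rw [if_neg (fun h' => h (Fin.ext (by omega))), if_neg (fun h' => h (Fin.ext (by omega)))]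
    ring

theorem matE_zero_bv (hn : 2 ≤ n) :
    toLin' (matE (0 : Fin (n + 1))) (bv K n 1) = bv K n (2 * n) := by
  have h := mulVec_bv (matE (K := K) (0 : Fin (n + 1))) (⟨0, by omega⟩ : Fin (2 * n))
  refine h.trans ?_
  funext x
  rw [matE_zero_apply]
  simp [bv]

theorem matF_zero_bv (hn : 2 ≤ n) :
    toLin' (matF r s (0 : Fin (n + 1))) (bv K n (2 * n)) = bv K n 1 := by
  have h := mulVec_bv (matF r s (0 : Fin (n + 1))) (⟨2 * n - 1, by omega⟩ : Fin (2 * n))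
  have e : 2 * n - 1 + 1 = 2 * n := by omega
  simp only [e] at h
  refine h.trans ?_
  funext x
  have hx := x.2
  rw [matF, if_pos (Fin.val_zero _), E, Matrix.of_apply, bv]
  dsimp only
  split_ifs <;> first | rfl | omega

/-- The node `i` for which `e_i` maps the `(k+1)`-st basis vector to a multiple of the
`k`-th one. -/
theorem exists_node {k : ℕ} (hk : 1 ≤ k) (hk' : k < 2 * n) :
    ∃ i : Fin (n + 1), i ≠ 0 ∧ etaNat K n i (k + 1) ≠ 0 ∧ (k = i ∨ k = 2 * n - i) := by
  by_cases h : k ≤ n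
  · refine ⟨⟨k, by omega⟩, fun h' => ?_, ?_, Or.inl rfl⟩
    · have := congrArg Fin.val h'
      simp at this
      omega
    · unfold etaNat etaLast etaMid
      dsimp only
      split_ifs <;> first | omega | simp
  · refine ⟨⟨2 * n - k, by omega⟩, fun h' => ?_, ?_, Or.inr (by dsimp only; omega)⟩
    · have := congrArg Fin.val h'
      simp at this
      omega
    · unfold etaNat etaLast etaMid
      dsimp only
      split_ifs <;> first | omega | simp

theorem exists_matE_bv {k : ℕ} (hk : 1 ≤ k) (hk' : k < 2 * n) :
    ∃ i : Fin (n + 1), i ≠ 0 ∧ ∃ c : K, c ≠ 0 ∧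
      toLin' (matE i) (bv K n (k + 1)) = c • bv K n k := by
  obtain ⟨i, hi, hc, -⟩ := exists_node (K := K) hk hk'
  exact ⟨i, hi, _, hc, matE_bv i hi ⟨k, hk'⟩⟩

theorem fScale_ne (hr : r ≠ 0) (hs : s ≠ 0) (i : Fin (n + 1)) : fScale r s i ≠ 0 := by
  unfold fScale
  split_ifs <;> simp [hr, hs]

/-- The sum w + w' is recorded because applying f_i twice to v_k ⊗ v_k produces it as a factor. It
is the only point of the uniqueness argument where r/s must avoid certain roots of unity. -/
theorem exists_matF_bv (hn : 2 ≤ n) (h : Good r s) {k : ℕ} (hk : 1 ≤ k) (hk' : k < 2 * n) :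
    ∃ i : Fin (n + 1), i ≠ 0 ∧ ∃ c w w' : K, c ≠ 0 ∧ w + w' ≠ 0 ∧
      toLin' (matF r s i) (bv K n k) = c • bv K n (k + 1) ∧
      toLin' (diagonal (weight s r i)) (bv K n k) = w • bv K n k ∧
      toLin' (diagonal (weight s r i)) (bv K n (k + 1)) = w' • bv K n (k + 1) := by
  obtain ⟨i, hi, hc, hik⟩ := exists_node (K := K) hk hk'
  have hr := h.r_ne
  have hs := h.s_ne
  have e : k - 1 + 1 = k := by omega
  have h1 := matF_bv hn hr hs i hi ⟨k - 1, by omega⟩ ⟨k, hk'⟩ (by dsimp only; omega)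
  have h2 := diagonal_bv (weight s r i) ⟨k - 1, by omega⟩
  have h3 := diagonal_bv (weight s r i) ⟨k, hk'⟩
  simp only [e] at h1 h2
  refine ⟨i, hi, _, _, _, ?_, ?_, h1, h2, h3⟩
  · exact mul_ne_zero (mul_ne_zero (fScale_ne hr hs i) (weight_ne s r hs hr i _)) hc
  · have hi' : (i : ℕ) ≠ 0 := fun h => hi (Fin.ext h)
    have hin := i.2
    -- Depending on the node, w + w' is r + s, r⁻¹ + s⁻¹ or s r⁻¹ + r s⁻¹. These are nonzero because
    -- r² ≠ s² and r⁴ ≠ s⁴.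
    have n1 : s + r ≠ 0 := fun h0 => h.pow_ne 2 two_pos (by linear_combination (r - s) * h0)
    have n2 : s ^ 2 + r ^ 2 ≠ 0 := fun h0 =>
      h.pow_ne 4 four_pos (by linear_combination (r ^ 2 - s ^ 2) * h0)
    have n3 : s⁻¹ + r⁻¹ ≠ 0 := by
      rw [inv_add_inv hs hr]
      exact div_ne_zero n1 (mul_ne_zero hs hr)
    have n4 : s * r⁻¹ + s⁻¹ * r ≠ 0 := by
      have : s * r⁻¹ + s⁻¹ * r = (s ^ 2 + r ^ 2) / (s * r) := by
        field_simp
      rw [this]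
      exact div_ne_zero n2 (mul_ne_zero hs hr)
    rw [weight_pos_node _ _ i hi, weight_pos_node _ _ i hi]
    simp only [e]
    unfold wLast wMid
    split_ifs <;>
      first
      | omega
      | exact n1
      | exact n3
      | exact n4
      | (rw [add_comm]; exact n1)
      | (rw [add_comm]; exact n3)

theorem exists_diagonal_bv {p q : K} (hp : p ≠ 0) (hq : q ≠ 0) (i : Fin (n + 1)) {k : ℕ}
    (hk : 1 ≤ k) (hk' : k ≤ 2 * n) :
    ∃ w : K, w ≠ 0 ∧ toLin' (diagonal (weight p q i)) (bv K n k) = w • bv K n k := by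
  have h := diagonal_bv (weight p q i) ⟨k - 1, by omega⟩
  have e : k - 1 + 1 = k := by omega
  simp only [e] at h
  exact ⟨_, weight_ne p q hp hq i _, h⟩

/-- Surjectivity allows the factor ω'_i on the last tensor slot to be absorbed into an arbitrary
vector there. -/
theorem exists_diagonal_eq {p q : K} (hp : p ≠ 0) (hq : q ≠ 0) (i : Fin (n + 1)) (x : V K n) :
    ∃ y, toLin' (diagonal (weight p q i)) y = x := by
  refine ⟨fun k => (weight p q i k)⁻¹ * x k, funext fun k => ?_⟩
  rw [toLin'_apply, mulVec_diagonal, mul_inv_cancel_left₀ (weight_ne p q hp hq i k)]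

theorem eq_sum_bv (x : V K n) : x = ∑ j : Fin (2 * n), x j • bv K n (j + 1) := by
  funext k
  rw [Finset.sum_apply, Finset.sum_eq_single k]
  · simp [bv]
  · intro j _ hj
    rw [Pi.smul_apply, bv, if_neg (fun h => hj (Fin.ext (by omega))), smul_zero]
  · simp

end BasisVectors

/-! ### The degenerate operators generate V ⊗ V ⊗ V from the highest weight vector -/

section Uniqueness

variable {K : Type*} [Field K] {r s : K} {n : ℕ}

/-- Triples of matrices, acting on `V ⊗ V ⊗ V`. -/
noncomputable def tri (A B C : Matrix (Fin (2 * n)) (Fin (2 * n)) K) :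
    Module.End K ((V K n ⊗[K] V K n) ⊗[K] V K n) :=
  TensorProduct.map (TensorProduct.map (toLin' A) (toLin' B)) (toLin' C)

theorem tri_tmul (A B C : Matrix (Fin (2 * n)) (Fin (2 * n)) K) (x y z : V K n) :
    tri A B C ((x ⊗ₜ y) ⊗ₜ z) = (toLin' A x ⊗ₜ toLin' B y) ⊗ₜ toLin' C z := rfl

theorem tri_tmul' (A B C : Matrix (Fin (2 * n)) (Fin (2 * n)) K) (y : V K n ⊗[K] V K n)
    (z : V K n) :
    tri A B C (y ⊗ₜ z) = TensorProduct.map (toLin' A) (toLin' B) y ⊗ₜ toLin' C z := rfl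

/-- The action of `e_i` on `V ⊗ V ⊗ V`, without spectral parameters. -/
noncomputable def triE (r s : K) (i : Fin (n + 1)) :
    Module.End K ((V K n ⊗[K] V K n) ⊗[K] V K n) :=
  tri (matE i) 1 1 + tri (diagonal (weight r s i)) (matE i) 1 +
    tri (diagonal (weight r s i)) (diagonal (weight r s i)) (matE i)

/-- The action of `f_i` on `V ⊗ V ⊗ V`, without spectral parameters. -/
noncomputable def triF (r s : K) (i : Fin (n + 1)) :
    Module.End K ((V K n ⊗[K] V K n) ⊗[K] V K n) :=
  tri 1 1 (matF r s i) + tri 1 (matF r s i) (diagonal (weight s r i)) +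
    tri (matF r s i) (diagonal (weight s r i)) (diagonal (weight s r i))

/-- The action of `f_i` on `V ⊗ V`, without spectral parameters. -/
noncomputable def pairF (r s : K) (i : Fin (n + 1)) : Module.End K (V K n ⊗[K] V K n) :=
  TensorProduct.map (toLin' 1) (toLin' (matF r s i)) +
    TensorProduct.map (toLin' (matF r s i)) (toLin' (diagonal (weight s r i)))

/-- An intertwiner between the degenerations of `V(u) ⊗ V(v) ⊗ V(w)` and `V(w) ⊗ V(v) ⊗ V(u)` in
which the action of `e_0` and `f_0` is dominated by one summand of the coproduct vanishes
if it vanishes on the highest weight vector. -/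
theorem eq_zero_of_intertwines (hn : 2 ≤ n) (h : Good r s)
    (T : Module.End K ((V K n ⊗[K] V K n) ⊗[K] V K n))
    (he : ∀ i : Fin (n + 1), i ≠ 0 → T * triE r s i = triE r s i * T)
    (hf : ∀ i : Fin (n + 1), i ≠ 0 → T * triF r s i = triF r s i * T)
    (he₀ : T * tri (diagonal (weight r s (0 : Fin (n + 1)))) (diagonal (weight r s (0 : Fin (n + 1))))
      (matE (0 : Fin (n + 1))) = tri (matE (0 : Fin (n + 1))) 1 1 * T)
    (hf₀ : T * tri (matF r s (0 : Fin (n + 1))) (diagonal (weight s r (0 : Fin (n + 1))))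
      (diagonal (weight s r (0 : Fin (n + 1)))) = tri 1 1 (matF r s (0 : Fin (n + 1))) * T)
    (h₁ : T ((bv K n 1 ⊗ₜ bv K n 1) ⊗ₜ bv K n 1) = 0) : T = 0 := by
  have hr := h.r_ne
  have hs := h.s_ne
  have app : ∀ {S S' : Module.End K ((V K n ⊗[K] V K n) ⊗[K] V K n)}, T * S = S' * T →
      ∀ {z}, T z = 0 → T (S z) = 0 := fun {S S'} hS {z} hz => by
    have h' := congrArg (· z) hS
    dsimp only [Module.End.mul_apply] at h'
    rw [h', hz, map_zero]
  -- N consists of the y with T(y ⊗ x) = 0 for all x. Working with N frees the third slot and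
  -- reduces the claim to N being all of V ⊗ V.
  set N : Submodule K (V K n ⊗[K] V K n) := LinearMap.ker (TensorProduct.curry T) with hN
  have memN : ∀ {y}, y ∈ N ↔ ∀ x, T (y ⊗ₜ x) = 0 := fun {y} => by
    rw [hN, LinearMap.mem_ker]
    exact ⟨fun h x => congrArg (· x) h, fun h => LinearMap.ext h⟩
  have smulN : ∀ {c : K} {y}, c ≠ 0 → c • y ∈ N → y ∈ N := fun {c y} hc hy => by
    have := N.smul_mem c⁻¹ hy
    rwa [smul_smul, inv_mul_cancel₀ hc, one_smul] at this
  -- The degenerate e_0 turns the third v_1 into v_{2n}. Since e_i v_1 = 0 for i ≠ 0, the e_i then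
  -- lower only the third index, through all basis vectors.
  have base : bv K n 1 ⊗ₜ bv K n 1 ∈ N := by
    have last : ∀ m k : ℕ, 1 ≤ k → k + m = 2 * n →
        T ((bv K n 1 ⊗ₜ bv K n 1) ⊗ₜ bv K n k) = 0 := by
      intro m
      induction m with
      | zero =>
        intro k _ hk
        obtain ⟨w, hw, hw'⟩ := exists_diagonal_bv (K := K) hr hs (0 : Fin (n + 1)) (k := 1)
          le_rfl (by omega)
        have h2 := app he₀ h₁
        rw [tri_tmul, hw', matE_zero_bv hn, TensorProduct.smul_tmul_smul, ← TensorProduct.smul_tmul',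
          map_smul] at h2
        have hk' : k = 2 * n := by omega
        rw [hk']
        exact (smul_eq_zero.1 h2).resolve_left (mul_ne_zero hw hw)
      | succ m ih =>
        intro k hk hkm
        obtain ⟨i, hi, c, hc, hic⟩ := exists_matE_bv (K := K) hk (show k < 2 * n by omega)
        obtain ⟨w, hw, hw'⟩ := exists_diagonal_bv (K := K) hr hs i (k := 1) le_rfl (by omega)
        have h2 := app (he i hi) (ih (k + 1) (by omega) (by omega))
        rw [triE, LinearMap.add_apply, LinearMap.add_apply, tri_tmul, tri_tmul, tri_tmul,
          matE_bv_one hn i hi, hw', hic, TensorProduct.zero_tmul, TensorProduct.zero_tmul,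
          TensorProduct.tmul_zero, TensorProduct.zero_tmul, zero_add, zero_add,
          TensorProduct.smul_tmul_smul, TensorProduct.smul_tmul_smul, map_smul] at h2
        exact (smul_eq_zero.1 h2).resolve_left (mul_ne_zero (mul_ne_zero hw hw) hc)
    refine memN.2 fun x => ?_
    rw [eq_sum_bv x, TensorProduct.tmul_sum, map_sum]
    refine Finset.sum_eq_zero fun j _ => ?_
    rw [TensorProduct.tmul_smul, map_smul,
      last (2 * n - (j + 1)) (j + 1) (by omega) (by have := j.2; omega), smul_zero]
  -- On y ⊗ x the summand 1 ⊗ 1 ⊗ f_i stays in N ⊗ V, which T kills; the other two summands form the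
  -- action of f_i on y, tensored with ω'_i x.
  have fN : ∀ i : Fin (n + 1), i ≠ 0 → ∀ y ∈ N, pairF r s i y ∈ N := by
    intro i hi y hy
    refine memN.2 fun x => ?_
    obtain ⟨x, rfl⟩ := exists_diagonal_eq (K := K) hs hr i x
    have h2 := app (hf i hi) (memN.1 hy x)
    rw [triF, LinearMap.add_apply, LinearMap.add_apply, tri_tmul', tri_tmul', tri_tmul', add_assoc,
      ← TensorProduct.add_tmul, map_add, toLin'_one, TensorProduct.map_id, LinearMap.id_apply,
      memN.1 hy, zero_add] at h2
    rw [pairF, toLin'_one]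
    exact h2
  have f₀N : ∀ y ∈ N, TensorProduct.map (toLin' (matF r s (0 : Fin (n + 1))))
      (toLin' (diagonal (weight s r (0 : Fin (n + 1))))) y ∈ N := by
    intro y hy
    refine memN.2 fun x => ?_
    obtain ⟨x, rfl⟩ := exists_diagonal_eq (K := K) hs hr (0 : Fin (n + 1)) x
    exact app hf₀ (memN.1 hy x)
  -- The vectors v_k ⊗ v_k are climbed by applying f_i twice, until v_{2n} ⊗ v_{2n} is reached.
  have diag : ∀ k : ℕ, 1 ≤ k → k ≤ 2 * n → bv K n k ⊗ₜ bv K n k ∈ N := by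
    intro k hk
    induction k, hk using Nat.le_induction with
    | base => exact fun _ => base
    | succ k hk ih =>
      intro hk'
      obtain ⟨i, hi, c, w, w', hc, hww, hF, hW, hW'⟩ := exists_matF_bv hn h hk
        (show k < 2 * n by omega)
      have hFF : toLin' (matF r s i) (bv K n (k + 1)) = 0 := by
        have h3 : toLin' (matF r s i) (toLin' (matF r s i) (bv K n k)) = 0 := by
          rw [← LinearMap.comp_apply, ← toLin'_mul, matF_sq r s hn, map_zero, LinearMap.zero_apply]
        rw [hF, map_smul] at h3
        exact (smul_eq_zero.1 h3).resolve_left hc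
      have h2 := fN i hi _ (fN i hi _ (ih (by omega)))
      -- As f_i squares to zero, only the mixed terms survive. They differ in whether ω'_i meets v_k
      -- or v_{k+1}, whence w + w'.
      have h4 : pairF r s i (pairF r s i (bv K n k ⊗ₜ bv K n k)) =
          (c * c * (w + w')) • (bv K n (k + 1) ⊗ₜ bv K n (k + 1)) := by
        simp only [pairF, LinearMap.add_apply, TensorProduct.map_tmul, toLin'_one,
          LinearMap.id_apply, map_add, hF, hW, hW', map_smul, hFF, TensorProduct.tmul_zero,
          TensorProduct.zero_tmul, smul_zero, zero_add, add_zero, TensorProduct.tmul_smul,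
          ← TensorProduct.smul_tmul', smul_smul]
        rw [← add_smul]
        congr 1
        ring
      rw [h4] at h2
      exact smulN (mul_ne_zero (mul_ne_zero hc hc) hww) h2
  -- The degenerate f_0 acts on the first slot only, so it resets that slot to v_1 and leaves v_{2n}
  -- in the second.
  have corner : bv K n 1 ⊗ₜ bv K n (2 * n) ∈ N := by
    have h2 := f₀N _ (diag (2 * n) (by omega) le_rfl)
    obtain ⟨w, hw, hw'⟩ := exists_diagonal_bv (K := K) hs hr (0 : Fin (n + 1)) (k := 2 * n)
      (by omega) le_rfl
    rw [TensorProduct.map_tmul, matF_zero_bv hn, hw', TensorProduct.tmul_smul] at h2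
    exact smulN hw h2
  have row : ∀ m k : ℕ, 1 ≤ k → k + m = 2 * n → bv K n 1 ⊗ₜ bv K n k ∈ N := by
    intro m
    induction m with
    | zero =>
      intro k _ hk
      have hk' : k = 2 * n := by omega
      rw [hk']
      exact corner
    | succ m ih =>
      intro k hk hkm
      obtain ⟨i, hi, c, hc, hic⟩ := exists_matE_bv (K := K) hk (show k < 2 * n by omega)
      obtain ⟨w, hw, hw'⟩ := exists_diagonal_bv (K := K) hr hs i (k := 1) le_rfl (by omega)
      obtain ⟨w₂, -, hw₂'⟩ := exists_diagonal_bv (K := K) hr hs i (k := k + 1) (by omega) (by omega)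
      have hmem := ih (k + 1) (by omega) (by omega)
      -- Of the three summands of e_i the first vanishes on v_1, the third keeps v_1 ⊗ v_{k+1} in
      -- the first two slots, where T vanishes, and the second lowers the index as wanted.
      have h2 : (w * c) • (bv K n 1 ⊗ₜ[K] bv K n k) ∈ N := by
        refine memN.2 fun x => ?_
        have h3 := app (he i hi) (memN.1 hmem x)
        rw [triE, LinearMap.add_apply, LinearMap.add_apply, tri_tmul, tri_tmul, tri_tmul,
          matE_bv_one hn i hi, hw', hw₂', hic, TensorProduct.zero_tmul, TensorProduct.zero_tmul,
          zero_add, TensorProduct.smul_tmul_smul, TensorProduct.smul_tmul_smul, map_add,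
          ← TensorProduct.smul_tmul' (w * w₂), map_smul, memN.1 hmem, smul_zero, add_zero,
          toLin'_one, LinearMap.id_apply] at h3
        exact h3
      exact smulN (mul_ne_zero hw hc) h2
  -- With v_k ⊗ V contained in N, the action of f_i on v_k ⊗ x is a multiple of v_{k+1} ⊗ ω'_i x
  -- modulo N, and ω'_i is surjective.
  have all : ∀ k : ℕ, 1 ≤ k → k ≤ 2 * n → ∀ x : V K n, bv K n k ⊗ₜ x ∈ N := by
    intro k hk
    induction k, hk using Nat.le_induction with
    | base =>
      intro _ x
      rw [eq_sum_bv x, TensorProduct.tmul_sum]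
      refine N.sum_mem fun j _ => ?_
      rw [TensorProduct.tmul_smul]
      exact N.smul_mem _ (row (2 * n - (j + 1)) (j + 1) (by omega) (by have := j.2; omega))
    | succ k hk ih =>
      intro hk' x
      obtain ⟨i, hi, c, w, w', hc, -, hF, -, -⟩ := exists_matF_bv hn h hk
        (show k < 2 * n by omega)
      obtain ⟨x, rfl⟩ := exists_diagonal_eq (K := K) hs hr i x
      have h2 := fN i hi _ (ih (by omega) x)
      rw [pairF, LinearMap.add_apply, TensorProduct.map_tmul, TensorProduct.map_tmul, toLin'_one,
        LinearMap.id_apply, hF, ← TensorProduct.smul_tmul'] at h2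
      exact smulN hc ((N.add_mem_iff_right (ih (by omega) _)).1 h2)
  refine TensorProduct.ext_threefold fun x y z => ?_
  rw [LinearMap.zero_apply]
  refine memN.1 ?_ z
  rw [eq_sum_bv x, TensorProduct.sum_tmul]
  refine N.sum_mem fun j _ => ?_
  rw [← TensorProduct.smul_tmul']
  exact N.smul_mem _ (all (j + 1) (by omega) (by have := j.2; omega) y)

end Uniqueness

end TwoParamC

namespace TwoParamC

open scoped TensorProduct
open Matrix

/-! ### Intertwining properties of the two sides of the braid relation -/

section TripleRepresentations

/-- Commuting actions of three copies of the matrix algebra on an algebra `S`, given by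
`A ⊗ B ⊗ C ↦ tri A B C`, together with the induced homomorphisms for the first and the last two
copies. -/
structure TripleRep (K : Type*) [Field K] (n : ℕ) (S : Type*) [Ring S] [Algebra K S] where
  /-- The image of `A ⊗ B ⊗ C`. -/
  t : Matrix (Fin (2 * n)) (Fin (2 * n)) K → Matrix (Fin (2 * n)) (Fin (2 * n)) K →
    Matrix (Fin (2 * n)) (Fin (2 * n)) K → S
  /-- The action of the first two copies. -/
  Φ₁₂ : Matrix (Fin (2 * n)) (Fin (2 * n)) K ⊗[K] Matrix (Fin (2 * n)) (Fin (2 * n)) K →ₐ[K] S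
  /-- The action of the last two copies. -/
  Φ₂₃ : Matrix (Fin (2 * n)) (Fin (2 * n)) K ⊗[K] Matrix (Fin (2 * n)) (Fin (2 * n)) K →ₐ[K] S
  t_mul : ∀ A B C A' B' C', t A B C * t A' B' C' = t (A * A') (B * B') (C * C')
  Φ₁₂_tmul : ∀ A B, Φ₁₂ (A ⊗ₜ B) = t A B 1
  Φ₂₃_tmul : ∀ A B, Φ₂₃ (A ⊗ₜ B) = t 1 A B

/-- Extends a node-0 relation from two tensor factors to three: the relation is multiplied by the
central weight p, and c is the summand of the coproduct not involved, with central weight q. -/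
theorem mul_weighted_sum {S : Type*} [Ring S] {R z a b c p q : S}
    (h : R * (z * a + b) = (a + z * b) * R) (hc : R * c = c * R) (hp : ∀ x, Commute x p)
    (hq : ∀ x, Commute x q) :
    R * (z * p * a + p * b + q * c) = (p * a + z * p * b + q * c) * R := by
  have h1 : z * p * a + p * b = p * (z * a + b) := by
    rw [mul_add, ← mul_assoc, (hp z).eq]
  have h2 : p * a + z * p * b = p * (a + z * b) := by
    rw [mul_add, ← mul_assoc, (hp z).eq]
  rw [h1, h2, mul_add, add_mul, ← mul_assoc, (hp R).eq, mul_assoc, h, ← mul_assoc, ← mul_assoc,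
    (hq R).eq, mul_assoc q, hc, mul_assoc q]

variable {K : Type*} [Field K] {r s rh sh : K} {n : ℕ} {S : Type*} [Ring S] [Algebra K S]

/-- v_1 ⊗ v_1 is the only product of basis vectors of its weight, so it is an eigenvector. The
rank-one projection makes this an identity of operators that can be specialized to any z. -/
theorem RMat_mul_highest (hn : 2 ≤ n) (z : K) :
    RMat r s n z * kron K n (Matrix.single ⟨0, by omega⟩ ⟨0, by omega⟩ 1 ⊗ₜ
      Matrix.single ⟨0, by omega⟩ ⟨0, by omega⟩ 1) = ((z - r⁻¹ * s) * (z - xi r s n)) •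
      kron K n (Matrix.single ⟨0, by omega⟩ ⟨0, by omega⟩ 1 ⊗ₜ
        Matrix.single ⟨0, by omega⟩ ⟨0, by omega⟩ 1) := by
  rw [kron_tmul, Matrix.single_kronecker_single, one_mul]
  ext ⟨x, y⟩ ⟨c, d⟩
  rw [Matrix.smul_apply, Matrix.mul_apply, Finset.sum_eq_single (⟨0, by omega⟩, ⟨0, by omega⟩)]
  · by_cases hcd : ((⟨0, by omega⟩, ⟨0, by omega⟩) : Fin (2 * n) × Fin (2 * n)) = (c, d)
    · obtain ⟨rfl, rfl⟩ := Prod.mk.inj hcd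
      rw [Matrix.single_apply_same, mul_one]
      by_cases hxy : ((⟨0, by omega⟩, ⟨0, by omega⟩) : Fin (2 * n) × Fin (2 * n)) = (x, y)
      · obtain ⟨rfl, rfl⟩ := Prod.mk.inj hxy
        rw [Matrix.single_apply_same, smul_eq_mul, mul_one]
        have h1 : (1 : ℕ) + 1 ≠ 2 * n + 1 := by omega
        simp [RMat, RNat, h1]
      · rw [Matrix.single_apply_of_ne _ _ _ _ _ (fun h => hxy h.1), smul_zero]
        have hxy' : ¬ ((x : ℕ) = 0 ∧ (y : ℕ) = 0) := fun h => hxy (by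
          ext <;> simp [h.1, h.2])
        simp only [RMat]
        exact RNat_of_not_support _ (by simp; omega)
    · rw [Matrix.single_apply_of_ne _ _ _ _ _ (fun h => hcd h.2),
        Matrix.single_apply_of_ne _ _ _ _ _ (fun h => hcd h.2), mul_zero, smul_zero]
  · intro p _ hp
    rw [Matrix.single_apply_of_ne _ _ _ _ _ (fun h => hp h.1.symm), mul_zero]
  · simp

namespace TripleRep

variable (ρ : TripleRep K n S)

theorem commute_Φ₁₂ (A : Matrix (Fin (2 * n)) (Fin (2 * n)) K)
    (x : Matrix (Fin (2 * n)) (Fin (2 * n)) K ⊗[K] Matrix (Fin (2 * n)) (Fin (2 * n)) K) :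
    Commute (ρ.Φ₁₂ x) (ρ.t 1 1 A) := by
  induction x with
  | zero => simp
  | add x y hx hy => rw [map_add]; exact hx.add_left hy
  | tmul x y =>
    rw [ρ.Φ₁₂_tmul]
    change _ * _ = _ * _
    rw [ρ.t_mul, ρ.t_mul, mul_one, mul_one, mul_one, one_mul, one_mul, one_mul]

theorem commute_Φ₂₃ (A : Matrix (Fin (2 * n)) (Fin (2 * n)) K)
    (x : Matrix (Fin (2 * n)) (Fin (2 * n)) K ⊗[K] Matrix (Fin (2 * n)) (Fin (2 * n)) K) :
    Commute (ρ.Φ₂₃ x) (ρ.t A 1 1) := by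
  induction x with
  | zero => simp
  | add x y hx hy => rw [map_add]; exact hx.add_left hy
  | tmul x y =>
    rw [ρ.Φ₂₃_tmul]
    change _ * _ = _ * _
    rw [ρ.t_mul, ρ.t_mul, mul_one, mul_one, mul_one, one_mul, one_mul, one_mul]

/-- `R̂(z)` on the first two factors. -/
noncomputable def R₁₂ (r s rh sh : K) (z : S) : S := RhatVia r s rh sh ρ.Φ₁₂ z

/-- `R̂(z)` on the last two factors. -/
noncomputable def R₂₃ (r s rh sh : K) (z : S) : S := RhatVia r s rh sh ρ.Φ₂₃ z

/-- The action of `e_i` with weights on the three summands of the coproduct. -/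
def actE (r s : K) (i : Fin (n + 1)) (p₁ p₂ p₃ : S) : S :=
  p₁ * ρ.t (matE i) 1 1 + p₂ * ρ.t (diagonal (weight r s i)) (matE i) 1 +
    p₃ * ρ.t (diagonal (weight r s i)) (diagonal (weight r s i)) (matE i)

/-- The action of `f_i` with weights on the three summands of the coproduct. -/
def actF (r s : K) (i : Fin (n + 1)) (p₁ p₂ p₃ : S) : S :=
  p₃ * ρ.t 1 1 (matF r s i) + p₂ * ρ.t 1 (matF r s i) (diagonal (weight s r i)) +
    p₁ * ρ.t (matF r s i) (diagonal (weight s r i)) (diagonal (weight s r i))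

theorem R₁₂_commute (z : S) (hz : ∀ x, Commute x z) (A : Matrix (Fin (2 * n)) (Fin (2 * n)) K) :
    Commute (ρ.R₁₂ r s rh sh z) (ρ.t 1 1 A) :=
  RhatVia_commute _ _ _ (ρ.commute_Φ₁₂ A) (hz _).symm

theorem R₂₃_commute (z : S) (hz : ∀ x, Commute x z) (A : Matrix (Fin (2 * n)) (Fin (2 * n)) K) :
    Commute (ρ.R₂₃ r s rh sh z) (ρ.t A 1 1) :=
  RhatVia_commute _ _ _ (ρ.commute_Φ₂₃ A) (hz _).symm

theorem t_eq₁₂ (A B C : Matrix (Fin (2 * n)) (Fin (2 * n)) K) :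
    ρ.t A B C = ρ.Φ₁₂ (A ⊗ₜ B) * ρ.t 1 1 C := by
  rw [ρ.Φ₁₂_tmul, ρ.t_mul, mul_one, mul_one, one_mul]

theorem t_eq₂₃ (A B C : Matrix (Fin (2 * n)) (Fin (2 * n)) K) :
    ρ.t A B C = ρ.Φ₂₃ (B ⊗ₜ C) * ρ.t A 1 1 := by
  rw [ρ.Φ₂₃_tmul, ρ.t_mul, mul_one, mul_one, one_mul]

/-- By coassociativity the threefold coproduct of e_i is Δ(e_i) ⊗ 1 + (ω_i ⊗ ω_i) ⊗ e_i, suited to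
R̂ on the first two factors, and also e_i ⊗ 1 ⊗ 1 + ω_i ⊗ Δ(e_i), suited to the last two. The lemmas
for f_i split similarly. -/
theorem R₁₂_mul_actE [Infinite K] (hrh : rh ^ 2 = r) (hsh : sh ^ 2 = s) (hr : r ≠ 0) (hs : s ≠ 0)
    (z : S) (hz : ∀ x, Commute x z) (i : Fin (n + 1)) (hi : i ≠ 0) :
    ρ.R₁₂ r s rh sh z * ρ.actE r s i 1 1 1 = ρ.actE r s i 1 1 1 * ρ.R₁₂ r s rh sh z := by
  have h1 : Commute (ρ.R₁₂ r s rh sh z) _ :=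
    RhatVia_mul_e hrh hsh hr hs ρ.Φ₁₂ z (fun _ => hz _) i hi
  have h2 : Commute (ρ.R₁₂ r s rh sh z) _ :=
    RhatVia_mul_diagonal hrh hsh hr hs ρ.Φ₁₂ z (fun _ => hz _) hr hs i
  have h3 := h1.add_right (h2.mul_right (ρ.R₁₂_commute z hz (matE i)))
  rw [map_add, ← ρ.t_eq₁₂, ρ.Φ₁₂_tmul, ρ.Φ₁₂_tmul] at h3
  simpa only [actE, one_mul] using h3.eq

theorem R₂₃_mul_actE [Infinite K] (hrh : rh ^ 2 = r) (hsh : sh ^ 2 = s) (hr : r ≠ 0) (hs : s ≠ 0)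
    (z : S) (hz : ∀ x, Commute x z) (i : Fin (n + 1)) (hi : i ≠ 0) :
    ρ.R₂₃ r s rh sh z * ρ.actE r s i 1 1 1 = ρ.actE r s i 1 1 1 * ρ.R₂₃ r s rh sh z := by
  have h1 : Commute (ρ.R₂₃ r s rh sh z) _ :=
    RhatVia_mul_e hrh hsh hr hs ρ.Φ₂₃ z (fun _ => hz _) i hi
  have h3 := (ρ.R₂₃_commute (r := r) (s := s) (rh := rh) (sh := sh) z hz (matE i)).add_right
    (h1.mul_right (ρ.R₂₃_commute z hz (diagonal (weight r s i))))
  rw [map_add, add_mul, ← ρ.t_eq₂₃, ← ρ.t_eq₂₃, ← add_assoc] at h3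
  simpa only [actE, one_mul] using h3.eq

theorem R₁₂_mul_actF [Infinite K] (hn : 2 ≤ n) (hrh : rh ^ 2 = r) (hsh : sh ^ 2 = s) (hr : r ≠ 0)
    (hs : s ≠ 0) (z : S) (hz : ∀ x, Commute x z) (i : Fin (n + 1)) (hi : i ≠ 0) :
    ρ.R₁₂ r s rh sh z * ρ.actF r s i 1 1 1 = ρ.actF r s i 1 1 1 * ρ.R₁₂ r s rh sh z := by
  have h1 : Commute (ρ.R₁₂ r s rh sh z) _ :=
    RhatVia_mul_f hn hrh hsh hr hs ρ.Φ₁₂ z (fun _ => hz _) i hi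
  have h3 := (ρ.R₁₂_commute (r := r) (s := s) (rh := rh) (sh := sh) z hz (matF r s i)).add_right
    (h1.mul_right (ρ.R₁₂_commute z hz (diagonal (weight s r i))))
  rw [map_add, add_mul, ← ρ.t_eq₁₂, ← ρ.t_eq₁₂, ← add_assoc] at h3
  simpa only [actF, one_mul] using h3.eq

theorem R₂₃_mul_actF [Infinite K] (hn : 2 ≤ n) (hrh : rh ^ 2 = r) (hsh : sh ^ 2 = s) (hr : r ≠ 0)
    (hs : s ≠ 0) (z : S) (hz : ∀ x, Commute x z) (i : Fin (n + 1)) (hi : i ≠ 0) :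
    ρ.R₂₃ r s rh sh z * ρ.actF r s i 1 1 1 = ρ.actF r s i 1 1 1 * ρ.R₂₃ r s rh sh z := by
  have h1 : Commute (ρ.R₂₃ r s rh sh z) _ :=
    RhatVia_mul_f hn hrh hsh hr hs ρ.Φ₂₃ z (fun _ => hz _) i hi
  have h2 : Commute (ρ.R₂₃ r s rh sh z) _ :=
    RhatVia_mul_diagonal hrh hsh hr hs ρ.Φ₂₃ z (fun _ => hz _) hs hr i
  have h3 := h1.add_right (h2.mul_right (ρ.R₂₃_commute z hz (matF r s i)))
  rw [map_add, ← ρ.t_eq₂₃, ρ.Φ₂₃_tmul, ρ.Φ₂₃_tmul] at h3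
  simpa only [actF, one_mul] using h3.eq

/-- The weights are the spectral parameters of the three factors up to a common scalar; R̂ at their
ratio z exchanges the two weights zp and p. -/
theorem R₁₂_mul_actE_zero [Infinite K] (hn : 2 ≤ n) (hrh : rh ^ 2 = r) (hsh : sh ^ 2 = s)
    (hr : r ≠ 0) (hs : s ≠ 0) {z p q : S} (hz : ∀ x, Commute x z) (hp : ∀ x, Commute x p)
    (hq : ∀ x, Commute x q) :
    ρ.R₁₂ r s rh sh z * ρ.actE r s 0 (z * p) p q = ρ.actE r s 0 p (z * p) q * ρ.R₁₂ r s rh sh z := by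
  have h1 := RhatVia_mul_e_zero hn hrh hsh hr hs ρ.Φ₁₂ z fun _ => hz _
  have h2 : Commute (ρ.R₁₂ r s rh sh z) _ :=
    RhatVia_mul_diagonal hrh hsh hr hs ρ.Φ₁₂ z (fun _ => hz _) hr hs (0 : Fin (n + 1))
  have h3 := h2.mul_right (ρ.R₁₂_commute z hz (matE (0 : Fin (n + 1))))
  rw [← ρ.t_eq₁₂] at h3
  rw [ρ.Φ₁₂_tmul, ρ.Φ₁₂_tmul] at h1
  exact mul_weighted_sum h1 h3.eq hp hq

/-- Here the two-factor relation is first multiplied by ω_0 on the first slot, which both involved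
summands of the coproduct carry. For f_0 on the first two factors this is done with ω'_0 on the
third. -/
theorem R₂₃_mul_actE_zero [Infinite K] (hn : 2 ≤ n) (hrh : rh ^ 2 = r) (hsh : sh ^ 2 = s)
    (hr : r ≠ 0) (hs : s ≠ 0) {z p q : S} (hz : ∀ x, Commute x z) (hp : ∀ x, Commute x p)
    (hq : ∀ x, Commute x q) :
    ρ.R₂₃ r s rh sh z * ρ.actE r s 0 q (z * p) p = ρ.actE r s 0 q p (z * p) * ρ.R₂₃ r s rh sh z := by
  have h1 := congrArg (· * ρ.t (diagonal (weight r s (0 : Fin (n + 1)))) 1 1)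
    (RhatVia_mul_e_zero hn hrh hsh hr hs ρ.Φ₂₃ z fun _ => hz _)
  have hW : Commute (RhatVia r s rh sh ρ.Φ₂₃ z) _ :=
    ρ.R₂₃_commute z hz (diagonal (weight r s (0 : Fin (n + 1))))
  have h3 : Commute (ρ.R₂₃ r s rh sh z) _ := ρ.R₂₃_commute z hz (matE (0 : Fin (n + 1)))
  simp only [mul_assoc] at h1
  rw [hW.eq, ← mul_assoc _ _ (RhatVia r s rh sh ρ.Φ₂₃ z), add_mul, add_mul, mul_assoc z,
    mul_assoc z, ← ρ.t_eq₂₃, ← ρ.t_eq₂₃] at h1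
  have h4 := mul_weighted_sum h1 h3.eq hp hq
  rw [add_comm _ (q * _), add_comm _ (q * _), ← add_assoc, ← add_assoc] at h4
  exact h4

theorem R₁₂_mul_actF_zero [Infinite K] (hn : 2 ≤ n) (hrh : rh ^ 2 = r) (hsh : sh ^ 2 = s)
    (hr : r ≠ 0) (hs : s ≠ 0) {z p q : S} (hz : ∀ x, Commute x z) (hp : ∀ x, Commute x p)
    (hq : ∀ x, Commute x q) :
    ρ.R₁₂ r s rh sh z * ρ.actF r s 0 p (z * p) q = ρ.actF r s 0 (z * p) p q * ρ.R₁₂ r s rh sh z := by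
  have h1 := congrArg (· * ρ.t 1 1 (diagonal (weight s r (0 : Fin (n + 1)))))
    (RhatVia_mul_f_zero hn hrh hsh hr hs ρ.Φ₁₂ z fun _ => hz _)
  have hW : Commute (RhatVia r s rh sh ρ.Φ₁₂ z) _ :=
    ρ.R₁₂_commute z hz (diagonal (weight s r (0 : Fin (n + 1))))
  have h3 : Commute (ρ.R₁₂ r s rh sh z) _ := ρ.R₁₂_commute z hz (matF r s (0 : Fin (n + 1)))
  simp only [mul_assoc] at h1
  rw [hW.eq, ← mul_assoc _ _ (RhatVia r s rh sh ρ.Φ₁₂ z), add_mul, add_mul, mul_assoc z,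
    mul_assoc z, ← ρ.t_eq₁₂, ← ρ.t_eq₁₂] at h1
  have h4 := mul_weighted_sum h1 h3.eq hp hq
  rw [add_comm _ (q * _), add_comm _ (q * _), ← add_assoc, ← add_assoc] at h4
  exact h4

theorem R₂₃_mul_actF_zero [Infinite K] (hn : 2 ≤ n) (hrh : rh ^ 2 = r) (hsh : sh ^ 2 = s)
    (hr : r ≠ 0) (hs : s ≠ 0) {z p q : S} (hz : ∀ x, Commute x z) (hp : ∀ x, Commute x p)
    (hq : ∀ x, Commute x q) :
    ρ.R₂₃ r s rh sh z * ρ.actF r s 0 q p (z * p) = ρ.actF r s 0 q (z * p) p * ρ.R₂₃ r s rh sh z := by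
  have h1 := RhatVia_mul_f_zero hn hrh hsh hr hs ρ.Φ₂₃ z fun _ => hz _
  have h2 : Commute (ρ.R₂₃ r s rh sh z) _ :=
    RhatVia_mul_diagonal hrh hsh hr hs ρ.Φ₂₃ z (fun _ => hz _) hs hr (0 : Fin (n + 1))
  have h3 := h2.mul_right (ρ.R₂₃_commute z hz (matF r s (0 : Fin (n + 1))))
  rw [← ρ.t_eq₂₃] at h3
  rw [ρ.Φ₂₃_tmul, ρ.Φ₂₃_tmul] at h1
  exact mul_weighted_sum h1 h3.eq hp hq

/-- The difference of the two sides of the braid form of the Yang–Baxter equation for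
`u / v = a`, `v / w = b`. -/
noncomputable def defect (r s rh sh : K) (a b : S) : S :=
  ρ.R₁₂ r s rh sh b * ρ.R₂₃ r s rh sh (a * b) * ρ.R₁₂ r s rh sh a -
    ρ.R₂₃ r s rh sh a * ρ.R₁₂ r s rh sh (a * b) * ρ.R₂₃ r s rh sh b

theorem chain_mul {R₁ R₂ R₃ x y z w : S} (h₁ : R₁ * x = y * R₁) (h₂ : R₂ * y = z * R₂)
    (h₃ : R₃ * z = w * R₃) : R₃ * R₂ * R₁ * x = w * (R₃ * R₂ * R₁) := by
  rw [mul_assoc, h₁, ← mul_assoc, mul_assoc R₃ R₂, h₂, ← mul_assoc, h₃]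
  simp only [mul_assoc]

variable {a b : S}

theorem defect_mul_actE [Infinite K] (hrh : rh ^ 2 = r) (hsh : sh ^ 2 = s) (hr : r ≠ 0) (hs : s ≠ 0)
    (ha : ∀ x, Commute x a) (hb : ∀ x, Commute x b) (i : Fin (n + 1)) (hi : i ≠ 0) :
    ρ.defect r s rh sh a b * ρ.actE r s i 1 1 1 = ρ.actE r s i 1 1 1 * ρ.defect r s rh sh a b := by
  have hab : ∀ x, Commute x (a * b) := fun x => (ha x).mul_right (hb x)
  have h12 := fun z hz => ρ.R₁₂_mul_actE hrh hsh hr hs z hz i hi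
  have h23 := fun z hz => ρ.R₂₃_mul_actE hrh hsh hr hs z hz i hi
  rw [defect, sub_mul, mul_sub, chain_mul (h12 a ha) (h23 _ hab) (h12 b hb),
    chain_mul (h23 b hb) (h12 _ hab) (h23 a ha)]

theorem defect_mul_actF [Infinite K] (hn : 2 ≤ n) (hrh : rh ^ 2 = r) (hsh : sh ^ 2 = s) (hr : r ≠ 0)
    (hs : s ≠ 0) (ha : ∀ x, Commute x a) (hb : ∀ x, Commute x b) (i : Fin (n + 1)) (hi : i ≠ 0) :
    ρ.defect r s rh sh a b * ρ.actF r s i 1 1 1 = ρ.actF r s i 1 1 1 * ρ.defect r s rh sh a b := by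
  have hab : ∀ x, Commute x (a * b) := fun x => (ha x).mul_right (hb x)
  have h12 := fun z hz => ρ.R₁₂_mul_actF hn hrh hsh hr hs z hz i hi
  have h23 := fun z hz => ρ.R₂₃_mul_actF hn hrh hsh hr hs z hz i hi
  rw [defect, sub_mul, mul_sub, chain_mul (h12 a ha) (h23 _ hab) (h12 b hb),
    chain_mul (h23 b hb) (h12 _ hab) (h23 a ha)]

/-- The weights are (u, v, w) divided by w, that is (ab, b, 1). Either side of the braid relation
performs three exchanges and reverses them: (ab, b, 1) → (b, ab, 1) → (b, 1, ab) → (1, b, ab), and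
(ab, b, 1) → (ab, 1, b) → (1, ab, b) → (1, b, ab). -/
theorem defect_mul_actE_zero [Infinite K] (hn : 2 ≤ n) (hrh : rh ^ 2 = r) (hsh : sh ^ 2 = s)
    (hr : r ≠ 0) (hs : s ≠ 0) (ha : ∀ x, Commute x a) (hb : ∀ x, Commute x b) :
    ρ.defect r s rh sh a b * ρ.actE r s 0 (a * b) b 1 =
      ρ.actE r s 0 1 b (a * b) * ρ.defect r s rh sh a b := by
  have h1 : ∀ x : S, Commute x 1 := Commute.one_right
  have hab : ∀ x, Commute x (a * b) := fun x => (ha x).mul_right (hb x)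
  have e1 := ρ.R₁₂_mul_actE_zero hn hrh hsh hr hs ha hb h1
  have e2 := ρ.R₂₃_mul_actE_zero hn hrh hsh hr hs hab h1 hb
  have e3 := ρ.R₁₂_mul_actE_zero hn hrh hsh hr hs hb h1 hab
  have e4 := ρ.R₂₃_mul_actE_zero hn hrh hsh hr hs hb h1 hab
  have e5 := ρ.R₁₂_mul_actE_zero hn hrh hsh hr hs hab h1 hb
  have e6 := ρ.R₂₃_mul_actE_zero hn hrh hsh hr hs ha hb h1
  rw [mul_one] at e2 e3 e4 e5
  rw [defect, sub_mul, mul_sub, chain_mul e1 e2 e3, chain_mul e4 e5 e6]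

/-- Now the weights are the inverse parameters (u⁻¹, v⁻¹, w⁻¹) multiplied by u, namely (1, a, ab).
Each of the two normalizations avoids inverses and leaves a single weight 1. -/
theorem defect_mul_actF_zero [Infinite K] (hn : 2 ≤ n) (hrh : rh ^ 2 = r) (hsh : sh ^ 2 = s)
    (hr : r ≠ 0) (hs : s ≠ 0) (ha : ∀ x, Commute x a) (hb : ∀ x, Commute x b) :
    ρ.defect r s rh sh a b * ρ.actF r s 0 1 a (a * b) =
      ρ.actF r s 0 (a * b) a 1 * ρ.defect r s rh sh a b := by
  have h1 : ∀ x : S, Commute x 1 := Commute.one_right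
  have hab : ∀ x, Commute x (a * b) := fun x => (ha x).mul_right (hb x)
  have e1 := ρ.R₁₂_mul_actF_zero hn hrh hsh hr hs ha h1 hab
  have e2 := ρ.R₂₃_mul_actF_zero hn hrh hsh hr hs hab h1 ha
  have e3 := ρ.R₁₂_mul_actF_zero hn hrh hsh hr hs hb ha h1
  have e4 := ρ.R₂₃_mul_actF_zero hn hrh hsh hr hs hb ha h1
  have e5 := ρ.R₁₂_mul_actF_zero hn hrh hsh hr hs hab h1 ha
  have e6 := ρ.R₂₃_mul_actF_zero hn hrh hsh hr hs ha h1 hab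
  rw [mul_one] at e1 e2 e5 e6
  rw [← (hb a).eq] at e3 e4
  rw [defect, sub_mul, mul_sub, chain_mul e1 e2 e3, chain_mul e4 e5 e6]

/-- Both products act on v_1 ⊗ v_1 ⊗ v_1 by the same three central eigenvalues, at a, ab and b, only
in a different order. -/
theorem defect_mul_highest [Infinite K] (hn : 2 ≤ n) (hrh : rh ^ 2 = r) (hsh : sh ^ 2 = s)
    (hr : r ≠ 0) (hs : s ≠ 0) (ha : ∀ x, Commute x a) (hb : ∀ x, Commute x b)
    {p : Matrix (Fin (2 * n)) (Fin (2 * n)) K}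
    (hp : p = Matrix.single ⟨0, by omega⟩ ⟨0, by omega⟩ 1) :
    ρ.defect r s rh sh a b * ρ.t p p p = 0 := by
  have hab : ∀ x, Commute x (a * b) := fun x => (ha x).mul_right (hb x)
  obtain ⟨κ, hκ⟩ : ∃ κ : S → S, ∀ z, κ z =
    (z + algebraMap K S (-(r⁻¹ * s))) * (z + algebraMap K S (-(xi r s n))) := ⟨_, fun _ => rfl⟩
  have hcen : ∀ z, (∀ x, Commute x z) → ∀ x, Commute x (κ z) := fun z hz x => by
    rw [hκ]
    exact ((hz x).add_right (Algebra.commutes _ _).symm).mul_right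
      ((hz x).add_right (Algebra.commutes _ _).symm)
  have k12 : ∀ z, (∀ x, Commute x z) → ρ.R₁₂ r s rh sh z * ρ.t p p p = κ z * ρ.t p p p := by
    intro z hz
    rw [ρ.t_eq₁₂, ← mul_assoc, ← mul_assoc]
    congr 1
    rw [hp, hκ]
    exact RhatVia_mul_eigen hrh hsh hr hs (RMat_mul_highest hn) ρ.Φ₁₂ z fun _ => hz _
  have k23 : ∀ z, (∀ x, Commute x z) → ρ.R₂₃ r s rh sh z * ρ.t p p p = κ z * ρ.t p p p := by
    intro z hz
    rw [ρ.t_eq₂₃, ← mul_assoc, ← mul_assoc]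
    congr 1
    rw [hp, hκ]
    exact RhatVia_mul_eigen hrh hsh hr hs (RMat_mul_highest hn) ρ.Φ₂₃ z fun _ => hz _
  have step : ∀ {R z c}, (∀ x, Commute x z) → R * ρ.t p p p = c * ρ.t p p p →
      R * (z * ρ.t p p p) = z * (c * ρ.t p p p) := fun {R z c} hz h => by
    rw [← mul_assoc, (hz R).eq, mul_assoc, h]
  have l1 : ρ.R₁₂ r s rh sh b * ρ.R₂₃ r s rh sh (a * b) * ρ.R₁₂ r s rh sh a * ρ.t p p p =
      κ a * (κ (a * b) * (κ b * ρ.t p p p)) := by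
    rw [mul_assoc, k12 a ha, mul_assoc, step (hcen a ha) (k23 _ hab), ← mul_assoc (κ a),
      step (fun x => (hcen a ha x).mul_right (hcen _ hab x)) (k12 b hb), mul_assoc]
  have l2 : ρ.R₂₃ r s rh sh a * ρ.R₁₂ r s rh sh (a * b) * ρ.R₂₃ r s rh sh b * ρ.t p p p =
      κ b * (κ (a * b) * (κ a * ρ.t p p p)) := by
    rw [mul_assoc, k23 b hb, mul_assoc, step (hcen b hb) (k12 _ hab), ← mul_assoc (κ b),
      step (fun x => (hcen b hb x).mul_right (hcen _ hab x)) (k23 a ha), mul_assoc]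
  rw [defect, sub_mul, l1, l2, sub_eq_zero, ← mul_assoc, ← mul_assoc, ← mul_assoc, ← mul_assoc,
    (hcen b hb (κ a * κ (a * b))).eq, (hcen _ hab (κ a)).eq]
  simp only [mul_assoc]

end TripleRep

end TripleRepresentations

end TwoParamC

namespace TwoParamC

open scoped TensorProduct
open Matrix Polynomial

/-! ### Lowest coefficients of intertwiners -/

section LowestCoefficients

/-- In degree k the parts divisible by X meet only coefficients of Z below k, which vanish. A lowest
coefficient thus intertwines the specializations at X = 0. -/
theorem coeff_mul_eq_of_intertwines {B : Type*} [Ring B] {Z α β : B[X]} {α₀ β₀ : B}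
    (h : Z * (C α₀ + X * α) = (C β₀ + X * β) * Z) {k : ℕ} (hk : ∀ j < k, Z.coeff j = 0) :
    Z.coeff k * α₀ = β₀ * Z.coeff k := by
  have h1 := congrArg (coeff · k) h
  have h2 : (X * (Z * α)).coeff k = 0 := by
    cases k with
    | zero => exact coeff_X_mul_zero _
    | succ k =>
      rw [coeff_X_mul, coeff_mul]
      refine Finset.sum_eq_zero fun p hp => ?_
      rw [hk _ (by have := Finset.HasAntidiagonal.mem_antidiagonal.1 hp; omega), zero_mul]
  have h3 : (X * (β * Z)).coeff k = 0 := by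
    cases k with
    | zero => exact coeff_X_mul_zero _
    | succ k =>
      rw [coeff_X_mul, coeff_mul]
      refine Finset.sum_eq_zero fun p hp => ?_
      rw [hk _ (by have := Finset.HasAntidiagonal.mem_antidiagonal.1 hp; omega), mul_zero]
  rw [mul_add, add_mul, ← mul_assoc, ← X_mul, mul_assoc, mul_assoc] at h1
  simpa only [coeff_add, h2, h3, add_zero, coeff_mul_C, coeff_C_mul] using h1

end LowestCoefficients

/-! ### The braid relation and the Yang–Baxter equation -/

section BraidRelation

variable {K : Type*} [Field K] {r s rh sh : K} {n : ℕ}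

local notation "V₃" => (V K n ⊗[K] V K n) ⊗[K] V K n

noncomputable instance instRingEndTriple : Ring (Module.End K V₃) := Algebra.semiringToRing K

variable (K n) in
/-- `F ↦ F_{12}` as a homomorphism. -/
noncomputable def op12Hom : Module.End K (V K n ⊗[K] V K n) →ₐ[K] Module.End K V₃ :=
  Module.End.rTensorAlgHom K (V K n ⊗[K] V K n) (V K n)

variable (K n) in
/-- `F ↦ F_{23}` as a homomorphism. -/
noncomputable def op23Hom : Module.End K (V K n ⊗[K] V K n) →ₐ[K] Module.End K V₃ :=
  ((TensorProduct.assoc K (V K n) (V K n) (V K n)).symm.conjAlgEquiv K).toAlgHom.comp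
    (Module.End.lTensorAlgHom K (V K n ⊗[K] V K n) (V K n))

theorem op12_pairAct (A B : Matrix (Fin (2 * n)) (Fin (2 * n)) K) :
    op12 (pairAct K n (A ⊗ₜ B)) = tri A B 1 := by
  refine TensorProduct.ext_threefold fun x y z => ?_
  rw [tri_tmul, toLin'_one]
  rfl

theorem op23_pairAct (A B : Matrix (Fin (2 * n)) (Fin (2 * n)) K) :
    op23 (pairAct K n (A ⊗ₜ B)) = tri 1 A B := by
  refine TensorProduct.ext_threefold fun x y z => ?_
  rw [tri_tmul, toLin'_one]
  rfl

theorem tri_mul (A B D A' B' D' : Matrix (Fin (2 * n)) (Fin (2 * n)) K) :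
    tri A B D * tri A' B' D' = tri (A * A') (B * B') (D * D') := by
  refine TensorProduct.ext_threefold fun x y z => ?_
  rw [Module.End.mul_apply, tri_tmul, tri_tmul, tri_tmul, toLin'_mul, toLin'_mul, toLin'_mul]
  rfl

variable (K n) in
/-- Three copies of the matrix algebra acting on `V ⊗ V ⊗ V`, with a polynomial variable
adjoined. -/
noncomputable def tripleRep : TripleRep K n (Module.End K V₃)[X] where
  t A B D := C (tri A B D)
  Φ₁₂ := (CAlgHom (R := K) (A := Module.End K V₃)).comp ((op12Hom K n).comp (pairAct K n))
  Φ₂₃ := (CAlgHom (R := K) (A := Module.End K V₃)).comp ((op23Hom K n).comp (pairAct K n))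
  t_mul A B D A' B' D' := by rw [← C_mul, tri_mul]
  Φ₁₂_tmul A B := by
    rw [← op12_pairAct]
    rfl
  Φ₂₃_tmul A B := by
    rw [← op23_pairAct]
    rfl

theorem tri_highest (hn : 2 ≤ n) {p : Matrix (Fin (2 * n)) (Fin (2 * n)) K}
    (hp : p = Matrix.single ⟨0, by omega⟩ ⟨0, by omega⟩ 1) :
    tri p p p ((bv K n 1 ⊗ₜ bv K n 1) ⊗ₜ bv K n 1) = (bv K n 1 ⊗ₜ bv K n 1) ⊗ₜ bv K n 1 := by
  have h : toLin' p (bv K n 1) = bv K n 1 := by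
    refine (mulVec_bv p ⟨0, by omega⟩).trans ?_
    funext x
    simp only [hp, Matrix.single_apply, bv, Fin.ext_iff]
    simp [eq_comm]
  rw [tri_tmul, h]

theorem commute_X_mul_C {B : Type*} [Ring B] [Algebra K B] (c : K) (x : B[X]) :
    Commute x (X * C (algebraMap K B c)) :=
  (commute_X x).symm.mul_right (Algebra.commutes (A := B[X]) c x).symm

/-- The variable X is introduced to deform a and b to 0. There the actions of e_0 and f_0 reduce to
one summand each, and by induction each coefficient in turn meets the hypotheses of
`eq_zero_of_intertwines`. -/
theorem defect_eq_zero [Infinite K] (hn : 2 ≤ n) (h : Good r s) (hrh : rh ^ 2 = r)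
    (hsh : sh ^ 2 = s) (x y : K) :
    (tripleRep K n).defect r s rh sh (X * C (algebraMap K _ x)) (X * C (algebraMap K _ y)) = 0 := by
  have hr := h.r_ne
  have hs := h.s_ne
  have ha := commute_X_mul_C (B := Module.End K V₃) x
  have hb := commute_X_mul_C (B := Module.End K V₃) y
  have he := (tripleRep K n).defect_mul_actE hrh hsh hr hs ha hb
  have hf := (tripleRep K n).defect_mul_actF hn hrh hsh hr hs ha hb
  have he₀ := (tripleRep K n).defect_mul_actE_zero hn hrh hsh hr hs ha hb
  have hf₀ := (tripleRep K n).defect_mul_actF_zero hn hrh hsh hr hs ha hb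
  have h₁ := (tripleRep K n).defect_mul_highest hn hrh hsh hr hs ha hb rfl
  generalize (tripleRep K n).defect r s rh sh (X * C (algebraMap K _ x))
    (X * C (algebraMap K _ y)) = Z at *
  ext1 k
  rw [coeff_zero]
  induction k using Nat.strong_induction_on with
  | _ k ih =>
  have e1 : ∀ i, (tripleRep K n).actE r s i 1 1 1 = C (triE r s i) + X * 0 := fun i => by
    simp only [TripleRep.actE, triE, tripleRep, one_mul, mul_zero, add_zero, C_add]
  have f1 : ∀ i, (tripleRep K n).actF r s i 1 1 1 = C (triF r s i) + X * 0 := fun i => by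
    simp only [TripleRep.actF, triF, tripleRep, one_mul, mul_zero, add_zero, C_add]
  -- The two rearrangements isolate the summand of weight 1, the constant term: it comes last on the
  -- source side and first on the target side.
  have step : ∀ c d m : Module.End K V₃, ∀ t₁ t₂ t₃ : (Module.End K V₃)[X],
      X * C c * (X * C d) * t₁ + X * C m * t₂ + 1 * t₃ =
        t₃ + X * (C c * (X * C d) * t₁ + C m * t₂) := fun c d m t₁ t₂ t₃ => by
    simp only [mul_add, mul_assoc, one_mul]
    abel
  have step' : ∀ c d m : Module.End K V₃, ∀ t₁ t₂ t₃ : (Module.End K V₃)[X],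
      1 * t₁ + X * C m * t₂ + X * C c * (X * C d) * t₃ =
        t₁ + X * (C m * t₂ + C c * (X * C d) * t₃) := fun c d m t₁ t₂ t₃ => by
    simp only [mul_add, mul_assoc, one_mul]
    abel
  refine eq_zero_of_intertwines hn h _ (fun i hi => ?_) (fun i hi => ?_) ?_ ?_ ?_
  · have h2 := he i hi
    rw [e1] at h2
    exact coeff_mul_eq_of_intertwines h2 ih
  · have h2 := hf i hi
    rw [f1] at h2
    exact coeff_mul_eq_of_intertwines h2 ih
  · rw [TripleRep.actE, TripleRep.actE, step, step'] at he₀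
    exact coeff_mul_eq_of_intertwines he₀ ih
  · rw [TripleRep.actF, TripleRep.actF, step, step'] at hf₀
    exact coeff_mul_eq_of_intertwines hf₀ ih
  · have h2 := congrArg (coeff · k) h₁
    rw [show (tripleRep K n).t _ _ _ = C _ from rfl, coeff_mul_C, coeff_zero] at h2
    have h3 := congrArg (· ((bv K n 1 ⊗ₜ bv K n 1) ⊗ₜ bv K n 1)) h2
    rwa [Module.End.mul_apply, tri_highest hn rfl] at h3

/-- The braid form of the Yang–Baxter equation. -/
theorem Rhat_braid [Infinite K] (hn : 2 ≤ n) (h : Good r s) (hrh : rh ^ 2 = r)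
    (hsh : sh ^ 2 = s) (x y : K) :
    op12 (Rhat (n := n) r s rh sh y) * op23 (Rhat r s rh sh (x * y)) * op12 (Rhat r s rh sh x) =
      op23 (Rhat r s rh sh x) * op12 (Rhat r s rh sh (x * y)) * op23 (Rhat r s rh sh y) := by
  -- The auxiliary variable is evaluated at 1, so that a and b become the scalars x and y.
  have hc : ∀ f : Module.End K V₃, Commute (AlgHom.id K (Module.End K V₃) f) 1 :=
    fun f => Commute.one_right f
  have hX : ∀ c : K, eval₂AlgHom (AlgHom.id K (Module.End K V₃)) 1 hc
      (X * C (algebraMap K _ c)) = algebraMap K _ c := fun c => by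
    rw [map_mul]
    refine Eq.trans (congrArg₂ (· * ·) (eval₂_X _ _) (eval₂_C _ _)) ?_
    exact one_mul _
  have h12 : ∀ c z, eval₂AlgHom (AlgHom.id K (Module.End K V₃)) 1 hc z = algebraMap K _ c →
      eval₂AlgHom (AlgHom.id K (Module.End K V₃)) 1 hc ((tripleRep K n).R₁₂ r s rh sh z) =
        op12 (Rhat r s rh sh c) := fun c z hz => by
    refine (map_RhatVia (K := K) (n := n) (A := (Module.End K V₃)[X]) (B := Module.End K V₃)
      (eval₂AlgHom (AlgHom.id K (Module.End K V₃)) 1 hc) (tripleRep K n).Φ₁₂ z).trans ?_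
    refine Eq.trans ?_ (map_RhatVia (K := K) (n := n) (A := Module.End K (V K n ⊗[K] V K n))
      (B := Module.End K V₃) (op12Hom K n) (pairAct K n) (algebraMap K _ c)).symm
    rw [hz, AlgHom.commutes]
    congr 1
    exact AlgHom.ext fun f => eval₂_C _ _
  have h23 : ∀ c z, eval₂AlgHom (AlgHom.id K (Module.End K V₃)) 1 hc z = algebraMap K _ c →
      eval₂AlgHom (AlgHom.id K (Module.End K V₃)) 1 hc ((tripleRep K n).R₂₃ r s rh sh z) =
        op23 (Rhat r s rh sh c) := fun c z hz => by
    refine (map_RhatVia (K := K) (n := n) (A := (Module.End K V₃)[X]) (B := Module.End K V₃)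
      (eval₂AlgHom (AlgHom.id K (Module.End K V₃)) 1 hc) (tripleRep K n).Φ₂₃ z).trans ?_
    refine Eq.trans ?_ (map_RhatVia (K := K) (n := n) (A := Module.End K (V K n ⊗[K] V K n))
      (B := Module.End K V₃) (op23Hom K n) (pairAct K n) (algebraMap K _ c)).symm
    rw [hz, AlgHom.commutes]
    congr 1
    exact AlgHom.ext fun f => eval₂_C _ _
  have key := congrArg (eval₂AlgHom (AlgHom.id K (Module.End K V₃)) 1 hc)
    (sub_eq_zero.1 (defect_eq_zero hn h hrh hsh x y))
  have hxy : eval₂AlgHom (AlgHom.id K (Module.End K V₃)) 1 hc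
      (X * C (algebraMap K _ x) * (X * C (algebraMap K _ y))) = algebraMap K _ (x * y) := by
    rw [map_mul, hX, hX, map_mul]
  rw [map_mul, map_mul, map_mul, map_mul, h12 _ _ (hX y), h12 _ _ (hX x), h12 _ _ hxy,
    h23 _ _ (hX y), h23 _ _ (hX x), h23 _ _ hxy] at key
  exact key

theorem op12_mul (F G : Module.End K (V K n ⊗[K] V K n)) : op12 (F * G) = op12 F * op12 G :=
  map_mul (op12Hom K n) F G

theorem op23_mul (F G : Module.End K (V K n ⊗[K] V K n)) : op23 (F * G) = op23 F * op23 G :=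
  map_mul (op23Hom K n) F G

theorem flip_mul_flip : flip K n * flip K n = 1 :=
  TensorProduct.ext' fun _ _ => rfl

theorem op23_flip_mul_op23_flip : op23 (flip K n) * op23 (flip K n) = 1 := by
  rw [← op23_mul, flip_mul_flip]
  exact map_one (op23Hom K n)

/-- Both sides send x ⊗ y ⊗ z to F(y ⊗ z) ⊗ x: moving the first factor to the end carries the last
two places to the first two. For F the flip it is the braid relation of the flips themselves. -/
theorem op23_flip_mul_op12_flip_mul_op23 (F : Module.End K (V K n ⊗[K] V K n)) :
    op23 (flip K n) * op12 (flip K n) * op23 F = op12 F * op23 (flip K n) * op12 (flip K n) := by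
  have h : ∀ (x : V K n) (t : V K n ⊗[K] V K n),
      op23 (flip K n) (op12 (flip K n) ((TensorProduct.assoc K _ _ _).symm (x ⊗ₜ t))) =
        t ⊗ₜ x := fun x t => by
    induction t with
    | zero => rw [TensorProduct.tmul_zero, TensorProduct.zero_tmul, LinearEquiv.map_zero,
        LinearMap.map_zero, LinearMap.map_zero]
    | add t u ht hu =>
      rw [TensorProduct.tmul_add, map_add, map_add, map_add, ht, hu, TensorProduct.add_tmul]
    | tmul y z => rfl
  refine TensorProduct.ext_threefold fun x y z => ?_
  exact h x (F (y ⊗ₜ z))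

theorem op12_flip_mul_op23_flip_mul_op12 (F : Module.End K (V K n ⊗[K] V K n)) :
    op12 (flip K n) * op23 (flip K n) * op12 F = op23 F * op12 (flip K n) * op23 (flip K n) := by
  have h : ∀ (x : V K n) (t : V K n ⊗[K] V K n),
      op12 (flip K n) (op23 (flip K n) (t ⊗ₜ x)) =
        (TensorProduct.assoc K _ _ _).symm (x ⊗ₜ t) := fun x t => by
    induction t with
    | zero => rw [TensorProduct.tmul_zero, TensorProduct.zero_tmul, LinearEquiv.map_zero,
        LinearMap.map_zero, LinearMap.map_zero]
    | add t u ht hu =>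
      rw [TensorProduct.add_tmul, map_add, map_add, ht, hu, TensorProduct.tmul_add, map_add]
    | tmul y z => rfl
  refine TensorProduct.ext_threefold fun x y z => ?_
  exact h z (F (x ⊗ₜ y))

/-- The braid relation turns into the Yang–Baxter equation after multiplication with flips. -/
theorem yangBaxter_of_braid {B : Type*} [Monoid B] {p q a₁ b₁ c₁ a₂ b₂ c₂ : B} (hq : q * q = 1)
    (hpq : q * p * q = p * q * p) (ha : p * q * a₁ = a₂ * p * q) (hb : p * q * b₁ = b₂ * p * q)
    (hc : q * p * c₂ = c₁ * q * p) (h : a₁ * b₂ * c₁ = c₂ * b₁ * a₂) :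
    a₁ * p * (q * (b₁ * p) * q) * (c₂ * q) = c₂ * q * (q * (b₁ * p) * q) * (a₁ * p) := by
  calc a₁ * p * (q * (b₁ * p) * q) * (c₂ * q) = a₁ * (p * q * b₁) * p * q * c₂ * q := by
        simp only [mul_assoc]
    _ = a₁ * b₂ * (p * q * p) * q * c₂ * q := by
        rw [hb]
        simp only [mul_assoc]
    _ = a₁ * b₂ * q * p * (q * q) * c₂ * q := by
        rw [← hpq]
        simp only [mul_assoc]
    _ = a₁ * b₂ * (q * p * c₂) * q := by
        rw [hq, mul_one]
        simp only [mul_assoc]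
    _ = a₁ * b₂ * c₁ * (q * p * q) := by
        rw [hc]
        simp only [mul_assoc]
    _ = c₂ * b₁ * (a₂ * p * q) * p := by
        rw [h, hpq]
        simp only [mul_assoc]
    _ = c₂ * (q * q) * b₁ * p * q * a₁ * p := by
        rw [← ha, hq, mul_one]
        simp only [mul_assoc]
    _ = c₂ * q * (q * (b₁ * p) * q) * (a₁ * p) := by
        simp only [mul_assoc]

/-- The Yang–Baxter equation. -/
theorem Rmat_yangBaxter [Infinite K] (hn : 2 ≤ n) (h : Good r s) (hrh : rh ^ 2 = r)
    (hsh : sh ^ 2 = s) (x y : K) :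
    op12 (Rmat (n := n) r s rh sh y) * op13 (Rmat r s rh sh (x * y)) * op23 (Rmat r s rh sh x) =
      op23 (Rmat r s rh sh x) * op13 (Rmat r s rh sh (x * y)) * op12 (Rmat r s rh sh y) := by
  rw [op13, Rmat, Rmat, Rmat, op12_mul, op12_mul, op23_mul]
  -- Here p and q are the flips of the first and of the last two factors; a₁, b₁, c₁ and a₂, b₂, c₂
  -- are R̂ on those places at y, xy and x respectively.
  exact yangBaxter_of_braid op23_flip_mul_op23_flip (op23_flip_mul_op12_flip_mul_op23 _)
    (op12_flip_mul_op23_flip_mul_op12 _) (op12_flip_mul_op23_flip_mul_op12 _)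
    (op23_flip_mul_op12_flip_mul_op23 _) (Rhat_braid hn h hrh hsh x y)

end BraidRelation

end TwoParamC

theorem theorem6p9 {K : Type*} [Field K] [IsAlgClosed K] [Algebra ℂ K] (r s : K)
    (hrs : AlgebraicIndependent ℂ ![r, s]) (rh sh : K) (hrh : rh ^ 2 = r) (hsh : sh ^ 2 = s)
    (n : ℕ) (hn : 2 ≤ n) :
    (∀ a b : Kˣ, (a * b : K) = (r * s)⁻¹ →
      (∀ x : TwoParamC.UAff r s n,
        TwoParamC.RhatUV r s rh sh *
            TwoParamC.tensorRep hn (TwoParamC.Good.of_algebraicIndependent hrs) a b x =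
          TwoParamC.tensorRep hn (TwoParamC.Good.of_algebraicIndependent hrs) a b x *
            TwoParamC.RhatUV r s rh sh) ∧
      (∀ u v : Kˣ, ∀ x : TwoParamC.UAff' r s n,
        TwoParamC.Rhat r s rh sh (u / v : K) *
            TwoParamC.tensorRep' hn (TwoParamC.Good.of_algebraicIndependent hrs) a b u v x =
          TwoParamC.tensorRep' hn (TwoParamC.Good.of_algebraicIndependent hrs) a b v u x *
            TwoParamC.Rhat r s rh sh (u / v : K))) ∧
    (∀ u v w : Kˣ,
      TwoParamC.op12 (TwoParamC.Rmat (n := n) r s rh sh (v / w : K)) *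
          TwoParamC.op13 (TwoParamC.Rmat r s rh sh (u / w : K)) *
          TwoParamC.op23 (TwoParamC.Rmat r s rh sh (u / v : K)) =
        TwoParamC.op23 (TwoParamC.Rmat r s rh sh (u / v : K)) *
          TwoParamC.op13 (TwoParamC.Rmat r s rh sh (u / w : K)) *
          TwoParamC.op12 (TwoParamC.Rmat r s rh sh (v / w : K)) ∧
      TwoParamC.op12 (TwoParamC.Rhat (n := n) r s rh sh (v / w : K)) *
          TwoParamC.op23 (TwoParamC.Rhat r s rh sh (u / w : K)) *
          TwoParamC.op12 (TwoParamC.Rhat r s rh sh (u / v : K)) =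
        TwoParamC.op23 (TwoParamC.Rhat r s rh sh (u / v : K)) *
          TwoParamC.op12 (TwoParamC.Rhat r s rh sh (u / w : K)) *
          TwoParamC.op23 (TwoParamC.Rhat r s rh sh (v / w : K))) := by 
  have h := TwoParamC.Good.of_algebraicIndependent hrs
  -- The three arguments depend only on x = u/v and y = v/w, the middle one being their product.
  have huvw : ∀ u v w : Kˣ, (u / w : K) = (u / v : K) * (v / w : K) := fun u v w => by
    rw [div_mul_div_cancel₀ v.ne_zero]
  refine ⟨fun a b hab => ⟨fun x => TwoParamC.RhatUV_mul_tensorRep hn _ hrh hsh hab x,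
    fun u v x => TwoParamC.Rhat_mul_tensorRep' hn _ hrh hsh hab u v x⟩, fun u v w => ?_⟩
  rw [huvw u v w]
  exact ⟨TwoParamC.Rmat_yangBaxter hn h hrh hsh _ _, TwoParamC.Rhat_braid hn h hrh hsh _ _⟩
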